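/- Let $d\ge 0$ be an integer that is either $0$ or square-free, and let $\mathcal O$ be an order in $\mathbb Q(\sqrt{-d})$ (which is $\mathbb Q$ if $d=0$), i.e. a subring that is finitely generated as a $\mathbb Z$-module and contains a $\mathbb Q$-basis of $\mathbb Q(\sqrt{-d})$. Write $\mathcal I_d$ for the maximal order (the ring of integers) of $\mathbb Q(\sqrt{-d})$. For a commutative ring $R$ let $\mathrm E_2(R)\le \mathrm{GL}_2(R)$ be the subgroup generated by the matrices $E(x)=\begin{pmatrix} x & 1\\ -1 & 0\end{pmatrix}$, $x\in R$, let $\mathrm B_2(R)\le\mathrm{GL}_2(R)$ be the subgroup of invertible upper triangular matrices, and put $\mathrm B_2'(R)=\mathrm E_2(R)\cap \mathrm B_2(R)$. For injective group homomorphisms $f_1:H\to G_1$ and $f_2:H\to G_2$, the amalgamated product $G_1*_H G_2$ is the quotient of the free product $G_1*G_2$ by the normal subgroup generated by the elements $f_1(h)f_2(h)^{-1}$, $h\in H$; it is non-trivial if neither $f_1$ nor $f_2$ is surjective. 1. $\mathrm E_2(\mathcal O)$ is isomorphic to a non-trivial amalgamated product if and only if $\mathcal O\ne\mathcal I_3$.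 2. If $\mathcal O$ is neither $\mathbb Z[\sqrt{-3}]$ nor $\mathcal I_{d}$ with $d\in\{1,2,3,7,11\}$, then $$\mathrm E_2(\mathcal O)\;\cong\;\mathrm E_2(\mathbb Z) *_{\mathrm B_2'(\mathbb Z)} \mathrm B_2'(\mathcal O),$$ where $\mathrm B_2'(\mathbb Z)\to \mathrm E_2(\mathbb Z)$ is the inclusion and $\mathrm B_2'(\mathbb Z)\to \mathrm B_2'(\mathcal O)$ is the injection induced by $\mathbb Z\subseteq\mathcal O$; this amalgamated product is non-trivial if $\mathcal O\neq\mathbb Z$. -/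

import Mathlib

open scoped MatrixGroups

noncomputable section

namespace EltwoAmalgam

/-! ### Elementary and Borel subgroups of `GL₂(R)` -/

/-- The matrix `E(x) = (x, 1; -1, 0)`, as an element of `GL₂(R)`. -/
def elemE {R : Type*} [CommRing R] (x : R) : GL (Fin 2) R where
  val := !![x, 1; -1, 0]
  inv := !![0, -1; 1, x]
  val_inv := by ext i j; fin_cases i <;> fin_cases j <;> simp [Matrix.mul_apply, Fin.sum_univ_two]
  inv_val := by ext i j; fin_cases i <;> fin_cases j <;> simp [Matrix.mul_apply, Fin.sum_univ_two]

/-- `E₂(R)`: the subgroup of `GL₂(R)` generated by the matrices `E(x)`, `x ∈ R`. -/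
def E₂ (R : Type*) [CommRing R] : Subgroup (GL (Fin 2) R) :=
  Subgroup.closure (Set.range elemE)

/-- The Borel subgroup `B₂(R)`: the invertible upper triangular `2 × 2` matrices. -/
def B₂ (R : Type*) [CommRing R] : Subgroup (GL (Fin 2) R) where
  carrier := {g | (g : Matrix (Fin 2) (Fin 2) R) 1 0 = 0}
  one_mem' := by simp
  mul_mem' := by
    intro a b ha hb
    simp only [Set.mem_ofPred_eq] at ha hb ⊢
    simp [Matrix.mul_apply, Fin.sum_univ_two, ha, hb]
  inv_mem' := by
    intro a ha
    simp only [Set.mem_ofPred_eq] at ha ⊢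
    simp [Matrix.inv_def, Matrix.adjugate_fin_two, ha]

/-- `B₂'(R) = E₂(R) ∩ B₂(R)`. -/
def B₂' (R : Type*) [CommRing R] : Subgroup (GL (Fin 2) R) := E₂ R ⊓ B₂ R

/-- The inclusion `B₂'(R) → E₂(R)`. -/
def borelToE₂ (R : Type*) [CommRing R] : B₂' R →* E₂ R :=
  Subgroup.inclusion inf_le_left

theorem map_elemE {R S : Type*} [CommRing R] [CommRing S] (f : R →+* S) (x : R) :
    Matrix.GeneralLinearGroup.map (n := Fin 2) f (elemE x) = elemE (f x) := by
  ext i j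
  fin_cases i <;> fin_cases j <;> simp [elemE]

theorem B₂'_le_comap {R S : Type*} [CommRing R] [CommRing S] (f : R →+* S) :
    B₂' R ≤ (B₂' S).comap (Matrix.GeneralLinearGroup.map f) := by
  rintro g ⟨hg, hg'⟩
  refine ⟨?_, ?_⟩
  · have h : E₂ R ≤ (E₂ S).comap (Matrix.GeneralLinearGroup.map f) := by
      refine (Subgroup.closure_le _).2 ?_
      rintro _ ⟨x, rfl⟩
      exact Subgroup.subset_closure ⟨f x, (map_elemE f x).symm⟩
    exact h hg
  · have h : (g : Matrix (Fin 2) (Fin 2) R) 1 0 = 0 := hg'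
    change f ((g : Matrix (Fin 2) (Fin 2) R) 1 0) = 0
    rw [h, map_zero]

/-- The homomorphism `B₂'(R) → B₂'(S)` that applies a ring homomorphism `R → S` entrywise. -/
def borelMap {R S : Type*} [CommRing R] [CommRing S] (f : R →+* S) : B₂' R →* B₂' S :=
  ((Matrix.GeneralLinearGroup.map f).comp (B₂' R).subtype).codRestrict (B₂' S)
    fun g => B₂'_le_comap f g.2

/-! ### Free products with amalgamation -/

/-- `G₁ *_H G₂` for homomorphisms `f₁ : H → G₁`, `f₂ : H → G₂` (injective in all uses below):
the quotient of the free product `G₁ * G₂` by the normal subgroup generated by the elements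
`f₁(h) f₂(h)⁻¹`. -/
abbrev Amalgam {H G₁ G₂ : Type*} [Group H] [Group G₁] [Group G₂]
    (f₁ : H →* G₁) (f₂ : H →* G₂) : Type _ :=
  Monoid.Coprod G₁ G₂ ⧸ Subgroup.normalClosure
    (Set.range fun h : H =>
      ((Monoid.Coprod.inl (f₁ h) * (Monoid.Coprod.inr (f₂ h))⁻¹ : Monoid.Coprod G₁ G₂)))

/-- `G` is a non-trivial amalgamated product: it is isomorphic to some `G₁ *_H G₂` with
`H → G₁` and `H → G₂` injective and neither of them surjective. (The factors embed in `G`, so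
it is no restriction to take them in the universe of `G`.) -/
def IsNontrivialAmalgam.{u} (G : Type u) [Group G] : Prop :=
  ∃ (H G₁ G₂ : Type u) (_ : Group H) (_ : Group G₁) (_ : Group G₂)
    (f₁ : H →* G₁) (f₂ : H →* G₂),
    Function.Injective f₁ ∧ Function.Injective f₂ ∧
    ¬ Function.Surjective f₁ ∧ ¬ Function.Surjective f₂ ∧
    Nonempty (G ≃* Amalgam f₁ f₂)

/-! ### Orders in `ℚ(√-d)` -/

/-- `O` is a `ℤ`-order in the `ℚ`-algebra `A`: a subring that is finitely generated as a
`ℤ`-module and contains a `ℚ`-basis of (equivalently, spans) `A`. -/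
def IsZOrder {A : Type*} [Ring A] [Algebra ℚ A] (O : Subring A) : Prop :=
  Module.Finite ℤ O ∧ Submodule.span ℚ (O : Set A) = ⊤

/-- The field `ℚ(√-d)`, as a subfield of `ℂ`; it is `ℚ` for `d = 0`. -/
abbrev QuadField (d : ℕ) : IntermediateField ℚ ℂ :=
  IntermediateField.adjoin ℚ {Complex.I * (Real.sqrt d : ℂ)}

/-- The element `√-d` of `ℚ(√-d)`. -/
def sqrtNeg (d : ℕ) : QuadField d :=
  ⟨Complex.I * (Real.sqrt d : ℂ), IntermediateField.mem_adjoin_simple_self ℚ _⟩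

/-- The maximal order `𝓘_d` of `ℚ(√-d)`: its ring of algebraic integers. -/
def maxOrder (d : ℕ) : Subring (QuadField d) := (integralClosure ℤ (QuadField d)).toSubring

/-- The order `ℤ[√-d]` of `ℚ(√-d)`. -/
def zSqrtNeg (d : ℕ) : Subring (QuadField d) := Subring.closure {sqrtNeg d}

end EltwoAmalgam

end

noncomputable section

namespace EltwoAmalgam

/-! Amalgams are detected by normal forms. If two subgroups containing `H` generate `G` and no
alternating product of their elements outside `H` is trivial, then `G` is their amalgam over `H`
(`nonempty_mulEquiv_amalgam`, `isNontrivialAmalgam_of_subgroups`). The normal form theorem gives the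
converse (`IsNontrivialAmalgam.exists_subgroups`).

Generic orders: by a trace and norm computation, every non-integer in the order has absolute value
at least 2 (`exceptional_of_norm_lt_two`). Play ping-pong on `ℂ ∪ {∞}` with the points at distance
more than 1 from all integers (among them `∞`) and the points at distance less than 1 from some
integer. A non-triangular matrix over `ℤ` sends far points to near ones (`FarInt.nearInt`). A
triangular matrix over `O` that does not come from `ℤ` translates near points to far ones
(`NearInt.farInt`).

The remaining orders act on hyperbolic 3-space. A plane that crosses none of its translates yields a
tree, and `IsWall` records the signed distance from the orbit of a base point to such a plane. The
plane is an indefinite hermitian form of discriminant 1. Two translates do not cross when a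
difference or sum of their forms is semidefinite, which is an integrality statement about one
coefficient. For `ℤ`, `ℤ[√-3]`, `𝓘_1`, `𝓘_2` the plane above the imaginary axis works. `E(0)`
exchanges its sides, so the group is the amalgam of a component stabilizer and a wall stabilizer
(`IsWall.isNontrivialAmalgam_of_flip`). For `𝓘_7`, `𝓘_11` the plane above the real axis is used. No
element flips it, so the tree gives only an HNN extension. This is folded into an amalgam by means
of a conjugate of a congruence-type subgroup (`IsWall.isNontrivialAmalgam_of_translate`).

For `𝓘_3`, the group is generated by three elements of finite order with pairwise products of finite
order. By an argument of Serre such a group has a fixed vertex in every tree, so it is no nontrivial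
amalgam (`not_isNontrivialAmalgam_of_isOfFinOrder`). -/

/-! ### Alternating products -/

/-- `AltProd L i j n g`: `g` is a product of `n ≥ 1` elements taken alternately from the two
sets `L false`, `L true`, the first one from `L i` and the last one from `L j`. -/
inductive AltProd {G : Type*} [Group G] (L : Bool → Set G) : Bool → Bool → ℕ → G → Prop
  | single {i : Bool} {a : G} : a ∈ L i → AltProd L i i 1 a
  | cons {i j : Bool} {n : ℕ} {a g : G} :
      a ∈ L i → AltProd L (!i) j n g → AltProd L i j (n + 1) (a * g)

namespace AltProd

variable {G G' : Type*} [Group G] [Group G'] {L : Bool → Set G}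

theorem pos {i j : Bool} {n : ℕ} {g : G} (h : AltProd L i j n g) : 1 ≤ n := by
  cases h <;> omega

theorem mul {i j k : Bool} {n m : ℕ} {g h : G} (hg : AltProd L i j n g)
    (hh : AltProd L (!j) k m h) : AltProd L i k (n + m) (g * h) := by
  induction hg with
  | single ha => rw [add_comm]; exact cons ha hh
  | cons ha _ ih =>
    rw [mul_assoc, show ∀ a b : ℕ, a + 1 + b = a + b + 1 by intros; omega]
    exact cons ha (ih hh)

theorem map {L' : Bool → Set G'} (φ : G →* G') (hL : ∀ i, ∀ a ∈ L i, φ a ∈ L' i)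
    {i j : Bool} {n : ℕ} {g : G} (hg : AltProd L i j n g) : AltProd L' i j n (φ g) := by
  induction hg with
  | single ha => exact single (hL _ _ ha)
  | cons ha _ ih => rw [map_mul]; exact cons (hL _ _ ha) ih

theorem inv (hL : ∀ i, ∀ a ∈ L i, a⁻¹ ∈ L i) {i j : Bool} {n : ℕ} {g : G}
    (hg : AltProd L i j n g) : AltProd L j i n g⁻¹ := by
  induction hg with
  | single ha => exact single (hL _ _ ha)
  | @cons i j n a g ha _ ih =>
    rw [mul_inv_rev]
    exact ih.mul (by rw [Bool.not_not]; exact single (hL _ _ ha))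

theorem smul_of_forall {i j : Bool} {n : ℕ} {g h : G} (hL : ∀ a ∈ L i, h * a ∈ L i)
    (hg : AltProd L i j n g) : AltProd L i j n (h * g) := by
  cases hg with
  | single ha => exact single (hL _ ha)
  | cons ha hg => rw [← mul_assoc]; exact cons (hL _ ha) hg

theorem exists_snoc {i j : Bool} {n : ℕ} {g : G} (hg : AltProd L i j n g) :
    (n = 1 ∧ i = j ∧ g ∈ L j) ∨
      ∃ m g' a, n = m + 1 ∧ a ∈ L j ∧ AltProd L i (!j) m g' ∧ g = g' * a := by
  induction hg with
  | single ha => exact Or.inl ⟨rfl, rfl, ha⟩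
  | @cons i j n a g ha _ ih =>
    right
    rcases ih with ⟨rfl, hij, hg⟩ | ⟨m, g', b, rfl, hb, hg', rfl⟩
    · refine ⟨1, a, g, rfl, hg, ?_, rfl⟩
      rw [← hij, Bool.not_not]
      exact single ha
    · exact ⟨m + 1, a * g', b, rfl, hb, cons ha hg', (mul_assoc _ _ _).symm⟩

/-- When the first and last letters have different types, copies of the word concatenate without
cancellation. This is the source of all elements of infinite order below. -/
theorem pow {i : Bool} {n : ℕ} {g : G} (hg : AltProd L i (!i) n g) (k : ℕ) :
    ∃ m, AltProd L i (!i) m (g ^ (k + 1)) := by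
  induction k with
  | zero => exact ⟨n, by simpa using hg⟩
  | succ k ih =>
    obtain ⟨m, hm⟩ := ih
    exact ⟨m + n, by rw [pow_succ]; exact hm.mul (by rwa [Bool.not_not])⟩

end AltProd

/-! ### Pairs of subgroups with a common subgroup -/

section Pair

variable {G : Type*} [Group G] (K : Bool → Subgroup G) (H : Subgroup G)

/-- The elements of the two subgroups that lie outside of the common subgroup. -/
def letters (i : Bool) : Set G := {a | a ∈ K i ∧ a ∉ H}

variable {K H}

theorem letters_inv {i : Bool} {a : G} (ha : a ∈ letters K H i) : a⁻¹ ∈ letters K H i :=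
  ⟨inv_mem ha.1, fun h => ha.2 (by simpa using inv_mem h)⟩

theorem letters_mul_left (hle : ∀ i, H ≤ K i) {i : Bool} {a h : G}
    (hh : h ∈ H) (ha : a ∈ letters K H i) :
    h * a ∈ letters K H i :=
  ⟨mul_mem (hle i hh) ha.1, fun h' => ha.2 ((H.mul_mem_cancel_left hh).1 h')⟩

theorem letters_mul_right (hle : ∀ i, H ≤ K i) {i : Bool} {a h : G}
    (hh : h ∈ H) (ha : a ∈ letters K H i) :
    a * h ∈ letters K H i :=
  ⟨mul_mem ha.1 (hle i hh), fun h' => ha.2 ((H.mul_mem_cancel_right hh).1 h')⟩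

/-- The effect of multiplying an alternating product by an element of one of the subgroups. -/
theorem mul_altProd (hle : ∀ i, H ≤ K i) {i i' j : Bool} {n : ℕ} {a g : G} (ha : a ∈ K i)
    (hg : AltProd (letters K H) i' j n g) :
    (a * g ∈ H ∧ n = 1 ∧ i' = i) ∨ AltProd (letters K H) i' j n (a * g) ∨
      (i' = i ∧ ∃ m, n = m + 1 ∧ AltProd (letters K H) (!i) j m (a * g)) ∨
      (i' = !i ∧ AltProd (letters K H) i j (n + 1) (a * g)) := by
  by_cases haH : a ∈ H
  · exact Or.inr (Or.inl (hg.smul_of_forall fun b hb => letters_mul_left hle haH hb))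
  by_cases hi : i' = i
  · subst hi
    cases hg with
    | single hb =>
      by_cases hab : a * g ∈ H
      · exact Or.inl ⟨hab, rfl, rfl⟩
      · exact Or.inr (Or.inl (.single ⟨mul_mem ha hb.1, hab⟩))
    | @cons _ _ m b g' hb hg' =>
      rw [← mul_assoc]
      by_cases hab : a * b ∈ H
      · exact Or.inr (Or.inr (Or.inl ⟨rfl, m, rfl,
          hg'.smul_of_forall fun c hc => letters_mul_left hle hab hc⟩))
      · exact Or.inr (Or.inl (.cons ⟨mul_mem ha hb.1, hab⟩ hg'))
  · have hi' : i' = !i := by cases i <;> cases i' <;> simp_all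
    subst hi'
    exact Or.inr (Or.inr (Or.inr ⟨rfl, .cons ⟨ha, haH⟩ hg⟩))

theorem mem_or_altProd (hle : ∀ i, H ≤ K i) (hgen : K false ⊔ K true = ⊤) (g : G) :
    g ∈ H ∨ ∃ i j n, AltProd (letters K H) i j n g := by
  have key : ∀ (i : Bool) (a x : G), a ∈ K i → (x ∈ H ∨ ∃ i j n, AltProd (letters K H) i j n x) →
      (a * x ∈ H ∨ ∃ i j n, AltProd (letters K H) i j n (a * x)) := by
    rintro i a x ha (hx | ⟨i', j, n, hx⟩)
    · by_cases haH : a ∈ H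
      · exact Or.inl (mul_mem haH hx)
      · exact Or.inr ⟨i, i, 1, .single (letters_mul_right hle hx ⟨ha, haH⟩)⟩
    · rcases mul_altProd hle ha hx with h | h | ⟨-, m, -, h⟩ | ⟨-, h⟩
      · exact Or.inl h.1
      · exact Or.inr ⟨_, _, _, h⟩
      · exact Or.inr ⟨_, _, _, h⟩
      · exact Or.inr ⟨_, _, _, h⟩
  have hg : g ∈ Subgroup.closure ((K false : Set G) ∪ K true) := by
    rw [Subgroup.closure_union, Subgroup.closure_eq, Subgroup.closure_eq, hgen]
    trivial
  induction hg using Subgroup.closure_induction_left with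
  | one => exact Or.inl H.one_mem
  | mul_left x hx y _ ih =>
    rcases hx with hx | hx
    · exact key _ _ _ hx ih
    · exact key _ _ _ hx ih
  | inv_mul_cancel x hx y _ ih =>
    rcases hx with hx | hx
    · exact key _ _ _ (inv_mem hx) ih
    · exact key _ _ _ (inv_mem hx) ih

end Pair

/-! ### Recognizing amalgamated products -/

section Amalgam

variable {H G₁ G₂ : Type*} [Group H] [Group G₁] [Group G₂] (f₁ : H →* G₁) (f₂ : H →* G₂)

/-- The homomorphism from the first factor to the amalgamated product. -/
def Amalgam.inl : G₁ →* Amalgam f₁ f₂ := (QuotientGroup.mk' _).comp Monoid.Coprod.inl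

/-- The homomorphism from the second factor to the amalgamated product. -/
def Amalgam.inr : G₂ →* Amalgam f₁ f₂ := (QuotientGroup.mk' _).comp Monoid.Coprod.inr

theorem Amalgam.inl_eq_inr (h : H) : Amalgam.inl f₁ f₂ (f₁ h) = Amalgam.inr f₁ f₂ (f₂ h) := by
  have : (Monoid.Coprod.inl (f₁ h) * (Monoid.Coprod.inr (f₂ h))⁻¹ : Monoid.Coprod G₁ G₂) ∈
      Subgroup.normalClosure (Set.range fun h : H =>
        ((Monoid.Coprod.inl (f₁ h) * (Monoid.Coprod.inr (f₂ h))⁻¹ : Monoid.Coprod G₁ G₂))) :=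
    Subgroup.subset_normalClosure ⟨h, rfl⟩
  rw [← QuotientGroup.eq_one_iff, QuotientGroup.mk_mul, QuotientGroup.mk_inv,
    mul_inv_eq_one] at this
  exact this

theorem Amalgam.range_sup_range :
    (Amalgam.inr f₁ f₂).range ⊔ (Amalgam.inl f₁ f₂).range = ⊤ := by
  rw [Amalgam.inr, Amalgam.inl, MonoidHom.range_comp, MonoidHom.range_comp, ← Subgroup.map_sup,
    sup_comm, Monoid.Coprod.range_inl_sup_range_inr, ← MonoidHom.range_eq_map,
    MonoidHom.range_eq_top]
  exact QuotientGroup.mk'_surjective _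

variable {f₁ f₂} {G : Type*} [Group G]

/-- The homomorphism from an amalgamated product that is given by two homomorphisms on the
factors. -/
def Amalgam.lift (j₁ : G₁ →* G) (j₂ : G₂ →* G) (h : ∀ x, j₁ (f₁ x) = j₂ (f₂ x)) :
    Amalgam f₁ f₂ →* G :=
  QuotientGroup.lift _ (Monoid.Coprod.lift j₁ j₂) (by
    refine Subgroup.normalClosure_le_normal ?_
    rintro _ ⟨x, rfl⟩
    simp [MonoidHom.mem_ker, h])

variable (j₁ : G₁ →* G) (j₂ : G₂ →* G) (h : ∀ x, j₁ (f₁ x) = j₂ (f₂ x))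

@[simp]
theorem Amalgam.lift_inl (x : G₁) : Amalgam.lift j₁ j₂ h (Amalgam.inl f₁ f₂ x) = j₁ x := by
  change Monoid.Coprod.lift j₁ j₂ (Monoid.Coprod.inl x) = _
  simp

@[simp]
theorem Amalgam.lift_inr (x : G₂) : Amalgam.lift j₁ j₂ h (Amalgam.inr f₁ f₂ x) = j₂ x := by
  change Monoid.Coprod.lift j₁ j₂ (Monoid.Coprod.inr x) = _
  simp

/-- Letter sets for two homomorphisms: the images of the elements outside of the common
subgroup. -/
def imageLetters (f₁ : H →* G₁) (f₂ : H →* G₂) (j₁ : G₁ →* G) (j₂ : G₂ →* G) (i : Bool) : Set G :=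
  cond i (j₁ '' {x | x ∉ f₁.range}) (j₂ '' {x | x ∉ f₂.range})

/-- The two subgroups of an amalgamated product given by its factors. -/
def Amalgam.factor (f₁ : H →* G₁) (f₂ : H →* G₂) (i : Bool) : Subgroup (Amalgam f₁ f₂) :=
  cond i (Amalgam.inl f₁ f₂).range (Amalgam.inr f₁ f₂).range

/-- The subgroup of an amalgamated product given by the amalgamated group. -/
def Amalgam.base (f₁ : H →* G₁) (f₂ : H →* G₂) : Subgroup (Amalgam f₁ f₂) :=
  ((Amalgam.inl f₁ f₂).comp f₁).range

theorem Amalgam.base_le_factor (i : Bool) : Amalgam.base f₁ f₂ ≤ Amalgam.factor f₁ f₂ i := by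
  rintro _ ⟨x, rfl⟩
  cases i
  · exact ⟨f₂ x, (Amalgam.inl_eq_inr f₁ f₂ x).symm⟩
  · exact ⟨f₁ x, rfl⟩

theorem Amalgam.lift_mem_imageLetters (i : Bool) (a : Amalgam f₁ f₂)
    (ha : a ∈ letters (Amalgam.factor f₁ f₂) (Amalgam.base f₁ f₂) i) :
    Amalgam.lift j₁ j₂ h a ∈ imageLetters f₁ f₂ j₁ j₂ i := by
  obtain ⟨ha, haH⟩ := ha
  cases i
  · obtain ⟨x, rfl⟩ := ha
    refine ⟨x, ?_, by simp⟩
    rintro ⟨y, rfl⟩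
    exact haH ⟨y, Amalgam.inl_eq_inr f₁ f₂ y⟩
  · obtain ⟨x, rfl⟩ := ha
    refine ⟨x, ?_, by simp⟩
    rintro ⟨y, rfl⟩
    exact haH ⟨y, rfl⟩

/-- A group is an amalgamated product if no alternating product is trivial. -/
theorem nonempty_mulEquiv_amalgam (hinj : Function.Injective (j₁.comp f₁))
    (h : ∀ x, j₁ (f₁ x) = j₂ (f₂ x)) (hgen : j₁.range ⊔ j₂.range = ⊤)
    (halt : ∀ i j n, ¬ AltProd (imageLetters f₁ f₂ j₁ j₂) i j n 1) :
    Nonempty (G ≃* Amalgam f₁ f₂) := by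
  refine ⟨(MulEquiv.ofBijective (Amalgam.lift j₁ j₂ h) ⟨?_, ?_⟩).symm⟩
  · rw [injective_iff_map_eq_one]
    intro a ha
    rcases mem_or_altProd (K := Amalgam.factor f₁ f₂) Amalgam.base_le_factor
      (Amalgam.range_sup_range f₁ f₂) a with ⟨x, rfl⟩ | ⟨i, j, n, hx⟩
    · have : x = 1 := hinj (by simpa using ha)
      rw [this, map_one]
    · have := hx.map _ (Amalgam.lift_mem_imageLetters j₁ j₂ h)
      rw [ha] at this
      exact absurd this (halt _ _ _)
  · rw [← MonoidHom.range_eq_top, eq_top_iff, ← hgen, sup_le_iff]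
    constructor
    · rintro _ ⟨x, rfl⟩
      exact ⟨Amalgam.inl f₁ f₂ x, by simp⟩
    · rintro _ ⟨x, rfl⟩
      exact ⟨Amalgam.inr f₁ f₂ x, by simp⟩

end Amalgam

theorem isNontrivialAmalgam_of_subgroups {G : Type*} [Group G] (K : Bool → Subgroup G)
    (H : Subgroup G) (hlt : ∀ i, H < K i) (hgen : K false ⊔ K true = ⊤)
    (halt : ∀ i j n, ¬ AltProd (letters K H) i j n 1) : IsNontrivialAmalgam G := by
  have hns : ∀ i, ¬ Function.Surjective (Subgroup.inclusion (hlt i).le) := by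
    intro i hs
    refine (hlt i).not_ge fun x hx => ?_
    obtain ⟨y, hy⟩ := hs ⟨x, hx⟩
    have := congrArg Subtype.val hy
    simp only [Subgroup.coe_inclusion] at this
    exact this ▸ y.2
  refine ⟨H, K true, K false, inferInstance, inferInstance, inferInstance,
    Subgroup.inclusion (hlt true).le, Subgroup.inclusion (hlt false).le,
    Subgroup.inclusion_injective _, Subgroup.inclusion_injective _, hns true, hns false,
    nonempty_mulEquiv_amalgam (K true).subtype (K false).subtype ?_ (fun _ => rfl) ?_ ?_⟩
  · exact Subtype.val_injective
  · rw [Subgroup.range_subtype, Subgroup.range_subtype, sup_comm, hgen]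
  · intro i j n hx
    refine halt i j n (hx.map (MonoidHom.id G) fun i a ha => ?_)
    cases i
    · obtain ⟨x, hx, rfl⟩ := ha
      exact ⟨x.2, fun h => hx ⟨⟨x, h⟩, rfl⟩⟩
    · obtain ⟨x, hx, rfl⟩ := ha
      exact ⟨x.2, fun h => hx ⟨⟨x, h⟩, rfl⟩⟩

/-! ### The normal form theorem -/

section NormalForm

universe u

variable {H G₁ G₂ : Type u} [Group H] [Group G₁] [Group G₂]

/-- The two factors of an amalgamated product as a family of groups. -/
def FactorType (G₁ G₂ : Type u) : Bool → Type u
  | true => G₁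
  | false => G₂

instance : ∀ i, Group (FactorType G₁ G₂ i)
  | true => inferInstanceAs (Group G₁)
  | false => inferInstanceAs (Group G₂)

/-- The two homomorphisms of an amalgamated product as a family. -/
def factorHom (f₁ : H →* G₁) (f₂ : H →* G₂) : ∀ i, H →* FactorType G₁ G₂ i
  | true => f₁
  | false => f₂

/-- Translates alternating products into the reduced words of `Monoid.PushoutI`. Tracking `fstIdx`
allows the next letter to be prepended and shows that the word is not empty. -/
theorem exists_reduced_word_of_altProd {ι : Bool → Type u} [∀ i, Group (ι i)]
    (φ : ∀ i, H →* ι i) {i j : Bool} {n : ℕ} {x : Monoid.PushoutI φ}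
    (hx : AltProd (fun i => Monoid.PushoutI.of (φ := φ) i '' {a | a ∉ (φ i).range}) i j n x) :
    ∃ w : Monoid.CoprodI.Word ι, Monoid.PushoutI.Reduced φ w ∧
      Monoid.PushoutI.ofCoprodI w.prod = x ∧ w.fstIdx = some i := by
  induction hx with
  | @single i a ha =>
    obtain ⟨a, ha, rfl⟩ := ha
    have h1 : a ≠ 1 := fun h => ha (h ▸ one_mem _)
    have h0 : (Monoid.CoprodI.Word.empty : Monoid.CoprodI.Word ι).fstIdx ≠ some i := nofun
    refine ⟨Monoid.CoprodI.Word.cons a .empty h0 h1, ?_, ?_, ?_⟩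
    · intro g hg
      simp [Monoid.CoprodI.Word.cons, Monoid.CoprodI.Word.empty] at hg
      subst hg
      exact ha
    · rw [Monoid.CoprodI.Word.prod_cons, map_mul, Monoid.PushoutI.ofCoprodI_of,
        Monoid.CoprodI.Word.prod_empty, map_one, mul_one]
    · exact Monoid.CoprodI.Word.fstIdx_cons _ _ _ _
  | @cons i j n a g ha _ ih =>
    obtain ⟨a, ha, rfl⟩ := ha
    obtain ⟨w, hw, rfl, hi⟩ := ih
    have h1 : a ≠ 1 := fun h => ha (h ▸ one_mem _)
    have h0 : w.fstIdx ≠ some i := by rw [hi]; cases i <;> nofun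
    refine ⟨Monoid.CoprodI.Word.cons a w h0 h1, ?_, ?_, ?_⟩
    · intro g hg
      simp only [Monoid.CoprodI.Word.cons, List.mem_cons] at hg
      rcases hg with rfl | hg
      · exact ha
      · exact hw _ hg
    · rw [Monoid.CoprodI.Word.prod_cons, map_mul, Monoid.PushoutI.ofCoprodI_of]
    · exact Monoid.CoprodI.Word.fstIdx_cons _ _ _ _

theorem Amalgam.not_altProd_one {f₁ : H →* G₁} {f₂ : H →* G₂} (h₁ : Function.Injective f₁)
    (h₂ : Function.Injective f₂) (i j : Bool) (n : ℕ) :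
    ¬ AltProd (imageLetters f₁ f₂ (Amalgam.inl f₁ f₂) (Amalgam.inr f₁ f₂)) i j n 1 := by
  intro hx
  have hφ : ∀ i, Function.Injective (factorHom f₁ f₂ i) := by
    rintro (_ | _)
    · exact h₂
    · exact h₁
  let Ψ : Amalgam f₁ f₂ →* Monoid.PushoutI (factorHom f₁ f₂) :=
    Amalgam.lift (Monoid.PushoutI.of (φ := factorHom f₁ f₂) true)
      (Monoid.PushoutI.of (φ := factorHom f₁ f₂) false) fun x =>
      (Monoid.PushoutI.of_apply_eq_base (factorHom f₁ f₂) true x).trans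
        (Monoid.PushoutI.of_apply_eq_base (factorHom f₁ f₂) false x).symm
  obtain ⟨w, hw, hw1, hwi⟩ := exists_reduced_word_of_altProd (factorHom f₁ f₂)
    (hx.map Ψ (by
      rintro (_ | _) _ ⟨a, ha, rfl⟩
      · exact ⟨a, ha, (Amalgam.lift_inr _ _ _ _).symm⟩
      · exact ⟨a, ha, (Amalgam.lift_inl _ _ _ _).symm⟩))
  have := hw.eq_empty_of_mem_range hφ (by rw [hw1, map_one]; exact one_mem _)
  rw [this] at hwi
  simp [Monoid.CoprodI.Word.fstIdx, Monoid.CoprodI.Word.empty] at hwi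

/-- The two subgroups of a nontrivial amalgamated product. -/
theorem IsNontrivialAmalgam.exists_subgroups {G : Type u} [Group G] (hG : IsNontrivialAmalgam G) :
    ∃ (K : Bool → Subgroup G) (H : Subgroup G), (∀ i, H < K i) ∧ K false ⊔ K true = ⊤ ∧
      ∀ i j n, ¬ AltProd (letters K H) i j n 1 := by
  obtain ⟨H, G₁, G₂, _, _, _, f₁, f₂, h₁, h₂, s₁, s₂, ⟨e⟩⟩ := hG
  have halt := Amalgam.not_altProd_one h₁ h₂
  have hlet : ∀ i, ∀ a ∈ letters (Amalgam.factor f₁ f₂) (Amalgam.base f₁ f₂) i,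
      a ∈ imageLetters f₁ f₂ (Amalgam.inl f₁ f₂) (Amalgam.inr f₁ f₂) i := by
    rintro (_ | _) _ ⟨⟨x, rfl⟩, hx⟩
    · exact ⟨x, fun ⟨y, hy⟩ => hx ⟨y, hy ▸ Amalgam.inl_eq_inr f₁ f₂ y⟩, rfl⟩
    · exact ⟨x, fun ⟨y, hy⟩ => hx ⟨y, hy ▸ rfl⟩, rfl⟩
  have hlt : ∀ i, Amalgam.base f₁ f₂ < Amalgam.factor f₁ f₂ i := by
    refine fun i => lt_of_le_not_ge (Amalgam.base_le_factor i) fun hge => ?_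
    -- A letter is an alternating product of length one, hence nontrivial. If a factor collapsed to
    -- the base, some letter times the inverse of a base element would be a trivial letter.
    have key : ∀ a ∈ imageLetters f₁ f₂ (Amalgam.inl f₁ f₂) (Amalgam.inr f₁ f₂) i, a ≠ 1 :=
      fun a ha h1 => halt i i 1 (h1 ▸ .single ha)
    cases i
    · refine s₂ fun x => ?_
      by_contra hx
      obtain ⟨y, hy⟩ := hge ⟨x, rfl⟩
      refine key _ ⟨x * (f₂ y)⁻¹, fun h => hx ?_, rfl⟩ ?_
      · exact (Subgroup.mul_mem_cancel_right _ (inv_mem (MonoidHom.mem_range.2 ⟨y, rfl⟩))).1 h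
      · rw [map_mul, map_inv, ← Amalgam.inl_eq_inr, ← hy]
        exact mul_inv_cancel _
    · refine s₁ fun x => ?_
      by_contra hx
      obtain ⟨y, hy⟩ := hge ⟨x, rfl⟩
      refine key _ ⟨x * (f₁ y)⁻¹, fun h => hx ?_, rfl⟩ ?_
      · exact (Subgroup.mul_mem_cancel_right _ (inv_mem (MonoidHom.mem_range.2 ⟨y, rfl⟩))).1 h
      · rw [map_mul, map_inv, ← hy]
        exact mul_inv_cancel _
  refine ⟨fun i => (Amalgam.factor f₁ f₂ i).comap e.toMonoidHom,
    (Amalgam.base f₁ f₂).comap e.toMonoidHom, fun i => ?_, ?_, ?_⟩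
  · exact (Subgroup.comap_lt_comap_of_surjective e.surjective).2 (hlt i)
  · have : Amalgam.factor f₁ f₂ false ⊔ Amalgam.factor f₁ f₂ true = ⊤ :=
      Amalgam.range_sup_range f₁ f₂
    refine (Subgroup.comap_sup_eq e.toMonoidHom _ _ e.surjective).trans ?_
    rw [this, Subgroup.comap_top]
  · intro i j n hx
    refine halt i j n ?_
    rw [← map_one e.toMonoidHom]
    exact hx.map e.toMonoidHom fun i a ha => hlet i _ ha

end NormalForm

/-! ### Elements of finite order in amalgamated products -/

section Torsion

variable {G : Type*} [Group G] {K : Bool → Subgroup G} {H : Subgroup G}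

theorem AltProd.mul_right_of_forall {L : Bool → Set G} {i j : Bool} {n : ℕ} {g h : G}
    (hL : ∀ a ∈ L j, a * h ∈ L j) (hg : AltProd L i j n g) : AltProd L i j n (g * h) := by
  induction hg with
  | single ha => exact single (hL _ ha)
  | cons ha _ ih => rw [mul_assoc]; exact cons ha (ih hL)

theorem mem_of_mem_of_mem_not (halt : ∀ i j n, ¬ AltProd (letters K H) i j n 1) {i : Bool}
    {g : G} (h₁ : g ∈ K i) (h₂ : g ∈ K (!i)) : g ∈ H := by
  by_contra hg
  have : AltProd (letters K H) i (!i) (1 + 1) (g * g⁻¹) :=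
    .cons ⟨h₁, hg⟩ (.single (letters_inv ⟨h₂, hg⟩))
  rw [mul_inv_cancel] at this
  exact halt _ _ _ this

theorem AltProd.not_isOfFinOrder (halt : ∀ i j n, ¬ AltProd (letters K H) i j n 1) {i : Bool}
    {n : ℕ} {g : G} (hg : AltProd (letters K H) i (!i) n g) : ¬ IsOfFinOrder g := by
  rw [isOfFinOrder_iff_pow_eq_one]
  rintro ⟨m, hm, h⟩
  obtain ⟨k, hk⟩ := hg.pow (m - 1)
  rw [Nat.sub_add_cancel hm, h] at hk
  exact halt _ _ _ hk

/-- Cyclic reduction: if the end letters have the same type, conjugating by the first letter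
shortens the word. If their types differ, the element has infinite order. -/
theorem AltProd.exists_conj_mem (hle : ∀ i, H ≤ K i)
    (halt : ∀ i j n, ¬ AltProd (letters K H) i j n 1) {i j : Bool} {n : ℕ} {g : G}
    (hg : AltProd (letters K H) i j n g) (hfin : IsOfFinOrder g) :
    ∃ x k, x⁻¹ * g * x ∈ K k := by
  induction n using Nat.strong_induction_on generalizing i j g with
  | _ n ih =>
    by_cases hij : j = i
    swap
    · have : j = !i := by cases i <;> cases j <;> simp_all
      subst this
      exact absurd hfin (hg.not_isOfFinOrder halt)
    subst hij
    cases hg with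
    | single ha => exact ⟨1, j, by simpa using ha.1⟩
    | @cons _ _ m a g' ha hg' =>
      have hconj : a⁻¹ * (a * g') * a = g' * a := by group
      have hfin' : IsOfFinOrder (g' * a) := by
        have := (MulAut.conj a⁻¹).toMonoidHom.isOfFinOrder hfin
        simpa [mul_assoc] using this
      suffices ∃ m' i j, m' < m + 1 ∧ AltProd (letters K H) i j m' (g' * a) by
        obtain ⟨m', i', j', hlt, h⟩ := this
        obtain ⟨x, k, hx⟩ := ih m' hlt h hfin'
        refine ⟨a * x, k, ?_⟩
        rw [← hconj] at hx
        convert hx using 1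
        group
      rcases hg'.exists_snoc with ⟨-, h, -⟩ | ⟨m', g'', b, rfl, hb, hg'', rfl⟩
      · cases j <;> simp at h
      · rw [mul_assoc]
        by_cases hba : b * a ∈ H
        · exact ⟨m', _, _, by omega, hg''.mul_right_of_forall fun c hc =>
            letters_mul_right hle hba hc⟩
        · refine ⟨m' + 1, _, _, by omega, hg''.mul (k := j) ?_⟩
          rw [Bool.not_not]
          exact .single ⟨mul_mem hb.1 ha.1, hba⟩

/-- An element of finite order is conjugate to an element of one of the two subgroups. -/
theorem exists_conj_mem_of_isOfFinOrder (hle : ∀ i, H ≤ K i) (hgen : K false ⊔ K true = ⊤)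
    (halt : ∀ i j n, ¬ AltProd (letters K H) i j n 1) {g : G} (hfin : IsOfFinOrder g) :
    ∃ x k, x⁻¹ * g * x ∈ K k := by
  rcases mem_or_altProd hle hgen g with h | ⟨i, j, n, h⟩
  · exact ⟨1, true, by simpa using hle true h⟩
  · exact h.exists_conj_mem hle halt hfin

/-- Serre's argument in the Bass–Serre tree, phrased with words. `A` fixes the vertex `y K k`, `t`
fixes the vertex `y w K l`, and `w` describes the path between them. As long as one side also fixes
the next vertex on the path, the path can be shortened from that side. Otherwise some `a * t` is
hyperbolic and has infinite order. -/
theorem exists_conj_mem_insert_aux (hle : ∀ i, H ≤ K i)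
    (halt : ∀ i j n, ¬ AltProd (letters K H) i j n 1) {A : Set G} {t : G}
    (hfin : ∀ a ∈ A, IsOfFinOrder (a * t)) (n : ℕ) (y w : G) (k l : Bool)
    (hA : ∀ a ∈ A, y⁻¹ * a * y ∈ K k) (ht : (y * w)⁻¹ * t * (y * w) ∈ K l)
    (hw : w ∈ H ∨ ∃ i j, AltProd (letters K H) i j n w) :
    ∃ x k, ∀ a ∈ insert t A, x⁻¹ * a * x ∈ K k := by
  have hfin' : ∀ a ∈ A, ∀ y : G, IsOfFinOrder ((y⁻¹ * a * y) * (y⁻¹ * t * y)) := by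
    intro a ha y
    have := (MulAut.conj y⁻¹).toMonoidHom.isOfFinOrder (hfin a ha)
    simpa [mul_assoc] using this
  have hnot : ∀ i j : Bool, i ≠ j → i = !j := by decide
  induction n using Nat.strong_induction_on generalizing y w k l with
  | _ n ih =>
    rcases hw with hw | ⟨i, j, hw⟩
    · have ht' : y⁻¹ * t * y ∈ K l := by
        have := mul_mem (mul_mem (hle l hw) ht) (hle l (inv_mem hw))
        convert this using 1
        group
      by_cases hkl : l = k
      · subst hkl
        exact ⟨y, l, by rintro a (rfl | ha); exacts [ht', hA a ha]⟩
      obtain rfl := hnot l k hkl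
      by_cases htH : y⁻¹ * t * y ∈ H
      · exact ⟨y, k, by rintro a (rfl | ha); exacts [hle k htH, hA a ha]⟩
      by_cases hAH : ∀ a ∈ A, y⁻¹ * a * y ∈ H
      · exact ⟨y, !k, by rintro a (rfl | ha); exacts [ht', hle _ (hAH a ha)]⟩
      push Not at hAH
      obtain ⟨a, ha, haH⟩ := hAH
      have : AltProd (letters K H) k (!k) (1 + 1) ((y⁻¹ * a * y) * (y⁻¹ * t * y)) :=
        .cons ⟨hA a ha, haH⟩ (.single ⟨ht', htH⟩)
      exact absurd (hfin' a ha y) (this.not_isOfFinOrder halt)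
    · by_cases hAi : ∀ a ∈ A, y⁻¹ * a * y ∈ K i
      · cases hw with
        | single hc =>
          refine ih 0 (by omega) (y * w) 1 i l (fun a ha => ?_) (by simpa using ht)
            (Or.inl H.one_mem)
          convert mul_mem (mul_mem (inv_mem hc.1) (hAi a ha)) hc.1 using 1
          group
        | @cons _ _ m c w' hc hw' =>
          refine ih m (by omega) (y * c) w' i l (fun a ha => ?_) (by rwa [mul_assoc y])
            (Or.inr ⟨_, _, hw'⟩)
          convert mul_mem (mul_mem (inv_mem hc.1) (hAi a ha)) hc.1 using 1
          group
      by_cases htj : (y * w)⁻¹ * t * (y * w) ∈ K j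
      · rcases hw.exists_snoc with ⟨-, rfl, hc⟩ | ⟨m, w', c, rfl, hc, hw', rfl⟩
        · refine ih 0 (by have := hw.pos; omega) y 1 k i hA ?_ (Or.inl H.one_mem)
          convert mul_mem (mul_mem hc.1 htj) (inv_mem hc.1) using 1
          group
        · refine ih m (by omega) y w' k j hA ?_ (Or.inr ⟨_, _, hw'⟩)
          convert mul_mem (mul_mem hc.1 htj) (inv_mem hc.1) using 1
          group
      exfalso
      push Not at hAi
      obtain ⟨a, ha, hai⟩ := hAi
      have hki : i = !k := hnot _ _ (by rintro rfl; exact hai (hA a ha))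
      have hlj : j = !l := hnot _ _ (by rintro rfl; exact htj ht)
      -- Neither end can advance, so `(y⁻¹ a y) · w · ((y w)⁻¹ t (y w)) · w⁻¹` is alternating with
      -- ends of different types. It equals a conjugate of `a * t`.
      have h₁ : AltProd (letters K H) k k 1 (y⁻¹ * a * y) :=
        .single ⟨hA a ha, fun h => hai (hle _ h)⟩
      have h₂ : AltProd (letters K H) l l 1 ((y * w)⁻¹ * t * (y * w)) :=
        .single ⟨ht, fun h => htj (hle _ h)⟩
      have h₃ := hw.inv fun _ _ => letters_inv
      rw [hki, hlj] at hw h₃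
      have h₄ := (h₁.mul hw).mul (by rw [Bool.not_not]; exact h₂.mul h₃)
      refine h₄.not_isOfFinOrder halt ?_
      convert hfin' a ha y using 1
      group

theorem exists_conj_mem_insert (hle : ∀ i, H ≤ K i) (hgen : K false ⊔ K true = ⊤)
    (halt : ∀ i j n, ¬ AltProd (letters K H) i j n 1) {A : Set G} {t : G}
    (hA : ∃ x k, ∀ a ∈ A, x⁻¹ * a * x ∈ K k) (ht : IsOfFinOrder t)
    (hfin : ∀ a ∈ A, IsOfFinOrder (a * t)) :
    ∃ x k, ∀ a ∈ insert t A, x⁻¹ * a * x ∈ K k := by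
  obtain ⟨y, k, hA⟩ := hA
  obtain ⟨z, l, hz⟩ := exists_conj_mem_of_isOfFinOrder hle hgen halt ht
  have hw : ∃ n, y⁻¹ * z ∈ H ∨ ∃ i j, AltProd (letters K H) i j n (y⁻¹ * z) := by
    rcases mem_or_altProd hle hgen (y⁻¹ * z) with h | ⟨i, j, n, h⟩
    · exact ⟨0, Or.inl h⟩
    · exact ⟨n, Or.inr ⟨i, j, h⟩⟩
  obtain ⟨n, hw⟩ := hw
  exact exists_conj_mem_insert_aux hle halt hfin n y _ k l hA (by simpa using hz) hw

end Torsion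

/-- A group that is generated by three elements of finite order whose pairwise products have
finite order is not a nontrivial amalgamated product. -/
theorem not_isNontrivialAmalgam_of_isOfFinOrder {G : Type*} [Group G] {a b c : G}
    (hgen : Subgroup.closure {a, b, c} = ⊤) (ha : IsOfFinOrder a) (hb : IsOfFinOrder b)
    (hc : IsOfFinOrder c) (hab : IsOfFinOrder (b * a)) (hac : IsOfFinOrder (c * a))
    (hbc : IsOfFinOrder (c * b)) : ¬ IsNontrivialAmalgam G := by
  intro hG
  obtain ⟨K, H, hlt, hK, halt⟩ := hG.exists_subgroups
  have hle := fun i => (hlt i).le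
  have h₁ : ∃ x k, ∀ g ∈ ({c} : Set G), x⁻¹ * g * x ∈ K k := by
    obtain ⟨x, k, h⟩ := exists_conj_mem_of_isOfFinOrder hle hK halt hc
    exact ⟨x, k, by rintro _ rfl; exact h⟩
  have h₂ := exists_conj_mem_insert hle hK halt h₁ hb (by rintro _ rfl; exact hbc)
  obtain ⟨x, k, h₃⟩ := exists_conj_mem_insert hle hK halt h₂ ha
    (by rintro _ (rfl | rfl); exacts [hab, hac])
  have htop : ∀ g, x⁻¹ * g * x ∈ K k := by
    have hle' : Subgroup.closure {a, b, c} ≤ (K k).comap (MulAut.conj x⁻¹).toMonoidHom := by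
      rw [Subgroup.closure_le]
      intro g hg
      have := h₃ g hg
      simpa [mul_assoc] using this
    intro g
    have : g ∈ Subgroup.closure {a, b, c} := hgen ▸ Subgroup.mem_top g
    simpa [mul_assoc] using hle' this
  -- Since a conjugate of `K k` is the whole group, so is `K k`. The other subgroup therefore lies
  -- in the intersection of the two, which is `H`.
  refine (hlt (!k)).not_ge fun g hg => mem_of_mem_of_mem_not halt (i := k) ?_ hg
  have := htop (x * g * x⁻¹)
  simpa [mul_assoc] using this

/-! ### Walls -/

/-- A real-valued function on a group that behaves like the signed distance of the translates of a
base point to a wall that does not cross any of its translates, and that is at least as close to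
the base point as any of its translates. -/
structure IsWall {G : Type*} [Group G] (F : G → ℝ) (μ : ℝ) : Prop where
  pos : 0 < μ
  one : F 1 = μ
  le_abs : ∀ g, μ ≤ |F g|
  nested : ∀ g, ∃ ε : ℝ, (ε = 1 ∨ ε = -1) ∧
    ((∀ h, F (g * h) ≤ ε * F h) ∨ (∀ h, ε * F h ≤ F (g * h))) ∧
    ∀ h₀, F (g * h₀) = ε * F h₀ → ∀ h, F (g * h) = ε * F h

/-- The stabilizer of the wall together with its sides. -/
def wallStab {G : Type*} [Group G] (F : G → ℝ) : Subgroup G where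
  carrier := {g | ∀ h, F (g * h) = F h}
  one_mem' := by simp
  mul_mem' := by
    intro a b ha hb h
    rw [mul_assoc, ha, hb]
  inv_mem' := by
    intro a ha h
    rw [← ha, mul_inv_cancel_left]

/-- The elements that move the base point across none of the walls. -/
def wallComp {G : Type*} [Group G] (F : G → ℝ) : Subgroup G where
  carrier := {g | ∀ h, 0 < F (h * g) ↔ 0 < F h}
  one_mem' := by simp
  mul_mem' := by
    intro a b ha hb h
    rw [← mul_assoc, hb, ha]
  inv_mem' := by
    intro a ha h
    rw [← ha, inv_mul_cancel_right]

/-- The stabilizer of the wall. -/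
def wallFlip {G : Type*} [Group G] (F : G → ℝ) : Subgroup G where
  carrier := {g | (∀ h, F (g * h) = F h) ∨ (∀ h, F (g * h) = -F h)}
  one_mem' := by simp
  mul_mem' := by
    rintro a b (ha | ha) (hb | hb)
    · left; intro h; rw [mul_assoc, ha, hb]
    · right; intro h; rw [mul_assoc, ha, hb]
    · right; intro h; rw [mul_assoc, ha, hb]
    · left; intro h; rw [mul_assoc, ha, hb, neg_neg]
  inv_mem' := by
    rintro a (ha | ha)
    · left; intro h; rw [← ha, mul_inv_cancel_left]
    · right; intro h; rw [← neg_neg (F (a⁻¹ * h)), ← ha, mul_inv_cancel_left]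

namespace IsWall

variable {G : Type*} [Group G] {F : G → ℝ} {μ : ℝ}

theorem ne_zero (hF : IsWall F μ) (g : G) : F g ≠ 0 := fun h => by
  have := hF.le_abs g
  rw [h, abs_zero] at this
  exact this.not_gt hF.pos

theorem not_pos_iff (hF : IsWall F μ) (g : G) : ¬ 0 < F g ↔ F g < 0 := by
  have := hF.ne_zero g
  grind

theorem le_of_pos (hF : IsWall F μ) {g : G} (h : 0 < F g) : μ ≤ F g := by
  have := hF.le_abs g
  rwa [abs_of_pos h] at this

theorem le_of_neg (hF : IsWall F μ) {g : G} (h : F g < 0) : F g ≤ -μ := by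
  have := hF.le_abs g
  rw [abs_of_neg h] at this
  linarith

theorem pos_of_mem_comp (hF : IsWall F μ) {g : G} (hg : g ∈ wallComp F) : 0 < F g := by
  have := (hg 1).2 (by rw [hF.one]; exact hF.pos)
  rwa [one_mul] at this

/-- If `c` preserves the wall and its sides, then `1` and `c` both lie at the minimal distance `μ`
on its positive side. A translate of the wall separating them would, by nestedness, have to touch
that minimum. Equality at one point then identifies it with the wall itself, which does not separate
them. -/
theorem stab_le_comp (hF : IsWall F μ) : wallStab F ≤ wallComp F := by
  have hpos := hF.pos
  have h1 := hF.one
  have key : ∀ c ∈ wallStab F, ∀ h, 0 < F h → 0 < F (h * c) := by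
    intro c hc h hh
    by_contra hneg
    rw [hF.not_pos_iff] at hneg
    have hc1 : F c = μ := by rw [← h1, ← hc 1, mul_one]
    obtain ⟨ε, rfl | rfl, hle | hle, hr⟩ := hF.nested h
    · have e := hle 1
      rw [mul_one, one_mul, h1] at e
      have := hr 1 (by
        rw [mul_one, one_mul, h1]; exact le_antisymm e (hF.le_of_pos hh)) c
      rw [this, hc1] at hneg
      linarith
    · have e := hle c
      rw [hc1] at e
      linarith
    · have e := hle 1
      rw [mul_one, h1] at e
      linarith
    · have e := hle c
      rw [hc1] at e
      have := hr c (by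
        rw [hc1]; linarith [hF.le_of_neg hneg]) 1
      rw [mul_one, h1] at this
      linarith
  intro c hc h
  refine ⟨fun hh => ?_, key c hc h⟩
  have := key _ (inv_mem hc) _ hh
  rwa [mul_inv_cancel_right] at this

/-- An element that moves the base point across no wall fixes the wall or moves its far side
to its near side. -/
theorem mem_stab_or (hF : IsWall F μ) {k : G} (hk : k ∈ wallComp F) :
    k ∈ wallStab F ∨ ∀ h, F h < 0 → 0 < F (k * h) := by
  have hpos := hF.pos
  have h1 := hF.one
  have hk0 := hF.pos_of_mem_comp hk
  have hk1 := hF.pos_of_mem_comp (inv_mem hk)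
  obtain ⟨ε, rfl | rfl, hle | hle, hr⟩ := hF.nested k
  · left
    have e := hle 1
    rw [mul_one, one_mul, h1] at e
    have := hr 1 (by
      rw [mul_one, one_mul, h1]; exact le_antisymm e (hF.le_of_pos hk0))
    exact fun h => by rw [this, one_mul]
  · left
    have e := hle k⁻¹
    rw [mul_inv_cancel, one_mul, h1] at e
    have := hr k⁻¹ (by
      rw [mul_inv_cancel, one_mul, h1]; exact le_antisymm (hF.le_of_pos hk1) e)
    exact fun h => by rw [this, one_mul]
  · have e := hle 1
    rw [mul_one, h1] at e
    linarith
  · right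
    intro h hh
    have := hle h
    linarith

/-- If some element of the group exchanges the two sides of a wall, then the group is an
amalgamated product of the stabilizer of the wall and the stabilizer of a component of the
complement of the walls. -/
theorem isNontrivialAmalgam_of_flip (hF : IsWall F μ) {s r : G} (hs : ∀ h, F (s * h) = -F h)
    (hr : r ∈ wallComp F) (hr' : r ∉ wallStab F) (hgen : wallComp F ⊔ wallFlip F = ⊤) :
    IsNontrivialAmalgam G := by
  have hsf : wallStab F < wallFlip F :=
    lt_of_le_not_ge (fun g hg => Or.inl hg) fun hle => by
      have h₁ := hle (show s ∈ wallFlip F from Or.inr hs) 1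
      rw [hs, hF.one] at h₁
      linarith [hF.pos]
  have hsc : wallStab F < wallComp F := lt_of_le_not_ge hF.stab_le_comp fun hle => hr' (hle hr)
  have hle : ∀ i, wallStab F ≤ cond i (wallFlip F) (wallComp F) := by
    rintro (_ | _)
    exacts [hsc.le, hsf.le]
  refine isNontrivialAmalgam_of_subgroups (fun i => cond i (wallFlip F) (wallComp F)) (wallStab F)
    (by rintro (_ | _); exacts [hsc, hsf]) hgen ?_
  have hflip : ∀ a ∈ letters (fun i => cond i (wallFlip F) (wallComp F)) (wallStab F) true,
      ∀ h, F (a * h) = -F h := by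
    rintro a ⟨ha, ha'⟩
    exact ha.resolve_left ha'
  have hcomp : ∀ a ∈ letters (fun i => cond i (wallFlip F) (wallComp F)) (wallStab F) false,
      ∀ h, F h < 0 → 0 < F (a * h) := by
    rintro a ⟨ha, ha'⟩
    exact (hF.mem_stab_or ha).resolve_left ha'
  -- Ping-pong between the two sides of the wall: the type of the first letter decides on which side
  -- the base point lands.
  have key : ∀ i j n g, AltProd (letters (fun i => cond i (wallFlip F) (wallComp F)) (wallStab F))
      i j n g → (i = true → F g < 0) ∧ (i = false → 0 < F g) := by
    intro i j n g hg
    induction hg with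
    | @single i a ha =>
      constructor
      · rintro rfl
        have := hflip a ha 1
        rw [mul_one, hF.one] at this
        linarith [hF.pos]
      · rintro rfl
        exact hF.pos_of_mem_comp ha.1
    | @cons i j n a g ha _ ih =>
      constructor
      · rintro rfl
        rw [hflip a ha]
        linarith [ih.2 rfl]
      · rintro rfl
        exact hcomp a ha _ (ih.1 rfl)
  intro i j n hg
  generalize hx : (1 : G) = x at hg
  cases hg with
  | single ha => exact ha.2 (hx ▸ one_mem _)
  | @cons _ _ m a g ha hg' =>
    cases i
    · have h₁ := (key _ _ _ _ hg').1 rfl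
      have h₂ : g = a⁻¹ := eq_inv_of_mul_eq_one_right hx.symm
      rw [h₂] at h₁
      exact h₁.not_gt (hF.pos_of_mem_comp (inv_mem ha.1))
    · have := (key _ _ _ _ (AltProd.cons ha hg')).1 rfl
      rw [← hx, hF.one] at this
      exact this.not_gt hF.pos

/-- The translate of a wall with the opposite orientation. -/
theorem translate_neg (hF : IsWall F μ) {u : G} (hu : F u⁻¹ = -μ) :
    IsWall (fun h => -F (u⁻¹ * h)) μ where
  pos := hF.pos
  one := by rw [mul_one, hu, neg_neg]
  le_abs g := by rw [abs_neg]; exact hF.le_abs _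
  nested g := by
    obtain ⟨ε, hε, h, hr⟩ := hF.nested (u⁻¹ * g * u)
    have e : ∀ x, F (u⁻¹ * g * u * (u⁻¹ * x)) = F (u⁻¹ * (g * x)) := fun x => by
      congr 1
      group
    refine ⟨ε, hε, h.symm.imp (fun h x => ?_) (fun h x => ?_), fun h₀ he x => ?_⟩
    · have := h (u⁻¹ * x)
      rw [e] at this
      linarith
    · have := h (u⁻¹ * x)
      rw [e] at this
      linarith
    · have := hr (u⁻¹ * h₀) (by rw [e]; linarith) (u⁻¹ * x)
      rw [e] at this
      rw [this]
      ring

/-- Components depend only on the whole family of walls, and translating or reorienting one wall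
leaves the family unchanged. -/
theorem comp_translate_neg (hF : IsWall F μ) (u : G) :
    wallComp (fun h => -F (u⁻¹ * h)) = wallComp F := by
  have e : ∀ g, 0 < -F g ↔ ¬ 0 < F g := fun g => by rw [hF.not_pos_iff, neg_pos]
  ext k
  constructor
  · intro hk h
    have : 0 < -F (u⁻¹ * (u * h * k)) ↔ 0 < -F (u⁻¹ * (u * h)) := hk (u * h)
    rw [e, e, not_iff_not, mul_assoc, inv_mul_cancel_left, inv_mul_cancel_left] at this
    exact this
  · intro hk h
    change 0 < -F (u⁻¹ * (h * k)) ↔ 0 < -F (u⁻¹ * h)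
    rw [e, e, not_iff_not, ← mul_assoc]
    exact hk _

theorem conj_mem_comp (hF : IsWall F μ) {u : G} (hu : F u⁻¹ = -μ) {c : G} (hc : c ∈ wallStab F) :
    u * c * u⁻¹ ∈ wallComp F := by
  rw [← hF.comp_translate_neg u]
  refine (hF.translate_neg hu).stab_le_comp fun h => ?_
  beta_reduce
  rw [show u⁻¹ * (u * c * u⁻¹ * h) = c * (u⁻¹ * h) by group, hc]

/-- For `k` in the component stabilizer, the `k`-translate and the `u`-translate of the wall bound
the same component, so their far sides are disjoint. The walls could coincide only if `u⁻¹ * k`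
exchanged the two sides of the original wall, which is excluded. -/
theorem pos_translate_of_neg (hF : IsWall F μ) {u : G} (hu : F u⁻¹ = -μ)
    (hflip : ¬ ∃ g, ∀ h, F (g * h) = -F h) {k : G} (hk : k ∈ wallComp F) {h : G} (hh : F h < 0) :
    F (u⁻¹ * k * h) < 0 := by
  have hpos := hF.pos
  have h1 := hF.one
  have hk' : 0 < -F (u⁻¹ * k) :=
    (hF.translate_neg hu).pos_of_mem_comp (by rwa [hF.comp_translate_neg])
  have hk1 := hF.pos_of_mem_comp (inv_mem hk)
  obtain ⟨ε, rfl | rfl, hle | hle, hr⟩ := hF.nested (u⁻¹ * k)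
  · have := hle h
    linarith
  · have := hle 1
    rw [mul_one, h1] at this
    linarith
  · refine absurd ⟨u⁻¹ * k, fun x => ?_⟩ hflip
    have e := hle k⁻¹
    rw [mul_inv_cancel_right, hu] at e
    rw [hr k⁻¹ (by
      rw [mul_inv_cancel_right, hu]; linarith [hF.le_of_pos hk1]), neg_one_mul]
  · refine absurd ⟨u⁻¹ * k, fun x => ?_⟩ hflip
    have e := hle 1
    rw [mul_one, h1] at e
    rw [hr 1 (by
      rw [mul_one, h1]; linarith [hF.le_of_neg (neg_pos.1 hk')]), neg_one_mul]

end IsWall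

/-! ### Folding an HNN extension -/

section Fold

variable {G : Type*} [Group G] (γ : Bool → G) (H : Subgroup G)

/-- Reduced words in the elements `γ true`, `γ false = (γ true)⁻¹` and the elements of `H`, with
first letters `h ∈ H` and `γ ε`. -/
inductive ReducedWord : G → G → Bool → Prop
  | base {h h' : G} {ε : Bool} : h ∈ H → h' ∈ H → ReducedWord (h * γ ε * h') h ε
  | step {h w h' : G} {ε ε' : Bool} : h ∈ H → ReducedWord w h' ε' →
      (ε' = ε ∨ γ ε * h' * γ (!ε) ∉ H) → ReducedWord (h * γ ε * w) h ε

variable {γ H}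

theorem ReducedWord.mem {w h : G} {ε : Bool} (hw : ReducedWord γ H w h ε) : h ∈ H := by
  cases hw <;> assumption

theorem ReducedWord.mul_left {w h a : G} {ε : Bool} (ha : a ∈ H) (hw : ReducedWord γ H w h ε) :
    ReducedWord γ H (a * w) (a * h) ε := by
  cases hw with
  | base hh hh' => simpa only [mul_assoc] using ReducedWord.base (γ := γ) (mul_mem ha hh) hh'
  | step hh hw' hε =>
    simpa only [mul_assoc] using ReducedWord.step (γ := γ) (mul_mem ha hh) hw' hε

/-- Britton reduction: when a new letter creates a pinch `γ δ * h * γ (!δ) ∈ H`, the pinch is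
absorbed into the remainder of the word. -/
theorem mem_or_reducedWord (hγ : ∀ ε, γ (!ε) = (γ ε)⁻¹) {w : G}
    (hw : w ∈ Subgroup.closure ((H : Set G) ∪ {γ true})) :
    w ∈ H ∨ ∃ h ε, ReducedWord γ H w h ε := by
  have keyH : ∀ a ∈ H, ∀ w, (w ∈ H ∨ ∃ h ε, ReducedWord γ H w h ε) →
      (a * w ∈ H ∨ ∃ h ε, ReducedWord γ H (a * w) h ε) := by
    rintro a ha w (hw | ⟨h, ε, hw⟩)
    · exact Or.inl (mul_mem ha hw)
    · exact Or.inr ⟨_, _, hw.mul_left ha⟩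
  have keyγ : ∀ δ w, (w ∈ H ∨ ∃ h ε, ReducedWord γ H w h ε) →
      (γ δ * w ∈ H ∨ ∃ h ε, ReducedWord γ H (γ δ * w) h ε) := by
    rintro δ w (hw | ⟨h, ε, hw⟩)
    · exact Or.inr ⟨1, δ, by simpa using ReducedWord.base (γ := γ) (ε := δ) (one_mem H) hw⟩
    · by_cases hred : ε = δ ∨ γ δ * h * γ (!δ) ∉ H
      · exact Or.inr ⟨1, δ, by simpa using ReducedWord.step (one_mem H) hw hred⟩
      push Not at hred
      obtain ⟨hεδ, hmem⟩ := hred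
      have : ε = !δ := Bool.eq_not.2 hεδ
      subst this
      cases hw with
      | @base _ h' _ hh hh' =>
        left
        simpa only [mul_assoc] using mul_mem hmem hh'
      | @step _ w' h' _ ε' hh hw' hε' =>
        right
        exact ⟨_, _, by simpa only [mul_assoc] using hw'.mul_left hmem⟩
  induction hw using Subgroup.closure_induction_left with
  | one => exact Or.inl (one_mem H)
  | mul_left x hx y _ ih =>
    rcases hx with hx | rfl
    · exact keyH _ hx _ ih
    · exact keyγ true _ ih
  | inv_mul_cancel x hx y _ ih =>
    rcases hx with hx | rfl
    · exact keyH _ (inv_mem hx) _ ih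
    · have := keyγ false _ ih
      rwa [show false = !true from rfl, hγ] at this

/-- Ping-pong for the stable letter. The next letter can fail to apply only if the current point
lies in the forbidden set. `hdisj` excludes this when the exponent repeats. When the exponent
changes, `hstab` would produce a pinch, contrary to reducedness. -/
theorem ReducedWord.mul_mem {K : Subgroup G} {A : Bool → Set G} (hHK : H ≤ K)
    (hmap : ∀ ε x, x ∉ A (!ε) → γ ε * x ∈ A ε)
    (hdisj : ∀ ε, ∀ k ∈ K, ∀ x ∈ A ε, k * x ∉ A (!ε))
    (hstab : ∀ ε, ∀ k ∈ K, ∀ x ∈ A ε, k * x ∈ A ε → k ∈ H ∧ γ (!ε) * k * γ ε ∈ H)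
    {w h : G} {ε : Bool} (hw : ReducedWord γ H w h ε) {x : G}
    (hx : ∀ ε, ∀ h ∈ H, h * x ∉ A ε) : h⁻¹ * (w * x) ∈ A ε := by
  induction hw with
  | @base h h' ε hh hh' =>
    rw [show h⁻¹ * (h * γ ε * h' * x) = γ ε * (h' * x) by group]
    exact hmap _ _ (hx _ _ hh')
  | @step h w h' ε ε' hh hw' hε ih =>
    rw [show h⁻¹ * (h * γ ε * w * x) = γ ε * (w * x) by group]
    refine hmap _ _ fun hmem => ?_
    have hw'' := hHK hw'.mem
    have e : w * x = h' * (h'⁻¹ * (w * x)) := by group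
    rcases hε with rfl | hε
    · rw [e] at hmem
      exact hdisj _ _ hw'' _ ih hmem
    · by_cases hεε : ε' = ε
      · subst hεε
        rw [e] at hmem
        exact hdisj _ _ hw'' _ ih hmem
      · have : ε' = !ε := Bool.eq_not.2 hεε
        subst this
        rw [e] at hmem
        have := (hstab _ _ hw'' _ ih hmem).2
        rw [Bool.not_not] at this
        exact hε this

/-- A criterion for a group to be the amalgamated product of a subgroup `K` and the subgroup that
is generated by an element and a subgroup of `K`. -/
theorem isNontrivialAmalgam_of_fold {K : Subgroup G} {A : Bool → Set G}
    (hγ : ∀ ε, γ (!ε) = (γ ε)⁻¹) (hHK : H < K)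
    (hmap : ∀ ε x, x ∉ A (!ε) → γ ε * x ∈ A ε)
    (hdisj : ∀ ε, ∀ k ∈ K, ∀ x ∈ A ε, k * x ∉ A (!ε))
    (hstab : ∀ ε, ∀ k ∈ K, ∀ x ∈ A ε, k * x ∈ A ε → k ∈ H ∧ γ (!ε) * k * γ ε ∈ H)
    (hbase : ∀ ε, ∀ k ∈ K, k ∉ A ε) (hgen : ∀ L : Subgroup G, K ≤ L → γ true ∈ L → L = ⊤) :
    IsNontrivialAmalgam G := by
  have hH₂ : H ≤ Subgroup.closure ((H : Set G) ∪ {γ true}) :=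
    fun h hh => Subgroup.subset_closure (Or.inl hh)
  have hγ₂ : γ true ∈ Subgroup.closure ((H : Set G) ∪ {γ true}) :=
    Subgroup.subset_closure (Or.inr rfl)
  have hγH : γ true ∉ H := fun hmem => by
    have := hmap true 1 (hbase _ _ (one_mem K))
    rw [mul_one] at this
    exact hbase _ _ (hHK.le hmem) this
  refine isNontrivialAmalgam_of_subgroups
    (fun i => cond i (Subgroup.closure ((H : Set G) ∪ {γ true})) K) H ?_ ?_ ?_
  · rintro (_ | _)
    · exact hHK
    · exact lt_of_le_not_ge hH₂ fun hle => hγH (hle hγ₂)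
  · exact hgen _ le_sup_left ((le_sup_right : _ ≤ K ⊔ _) hγ₂)
  -- A word beginning with a letter of `⟨H, γ⟩` ends up in an `H`-translate of some `A ε`. A letter
  -- of `K` outside `H` then moves it to a translate not reachable from `H`, so the next letter of
  -- `⟨H, γ⟩` applies again.
  have key : ∀ i j n g, AltProd
      (letters (fun i => cond i (Subgroup.closure ((H : Set G) ∪ {γ true})) K) H) i j n g →
      (i = true → ∃ ε, ∃ h ∈ H, h * g ∈ A ε) ∧
      (i = false → (g ∈ K ∧ g ∉ H) ∨ ∃ ε, ∃ k ∈ K, k ∉ H ∧ k * g ∈ A ε) := by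
    have hletter : ∀ a ∈ letters
        (fun i => cond i (Subgroup.closure ((H : Set G) ∪ {γ true})) K) H true, ∀ x,
        (∀ ε, ∀ h ∈ H, h * x ∉ A ε) → ∃ ε, ∃ h ∈ H, h * (a * x) ∈ A ε := by
      rintro a ⟨ha, ha'⟩ x hx
      obtain ⟨h, ε, hw⟩ := (mem_or_reducedWord hγ ha).resolve_left ha'
      exact ⟨ε, h⁻¹, inv_mem hw.mem, hw.mul_mem hHK.le hmap hdisj hstab hx⟩
    intro i j n g hg
    induction hg with
    | @single i a ha =>
      constructor
      · rintro rfl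
        have := hletter a ha 1 fun ε h hh => by
          rw [mul_one]
          exact hbase _ _ (hHK.le hh)
        rwa [mul_one] at this
      · rintro rfl
        exact Or.inl ha
    | @cons i j n a g ha _ ih =>
      constructor
      · rintro rfl
        refine hletter a ha g ?_
        rcases ih.2 rfl with h | ⟨ε', k, hk, hkH, hkg⟩
        · exact fun ε h' hh' => hbase _ _ (mul_mem (hHK.le hh') h.1)
        · intro ε h hh hmem
          have e : h * g = h * k⁻¹ * (k * g) := by group
          have hhk : h * k⁻¹ ∈ K := mul_mem (hHK.le hh) (inv_mem hk)
          rw [e] at hmem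
          by_cases hε : ε = ε'
          · subst hε
            have := (hstab _ _ hhk _ hkg hmem).1
            rw [H.mul_mem_cancel_left hh] at this
            exact hkH (by simpa using inv_mem this)
          · have : ε = !ε' := Bool.eq_not.2 hε
            subst this
            exact hdisj _ _ hhk _ hkg hmem
      · rintro rfl
        obtain ⟨ε, h, hh, hmem⟩ := ih.1 rfl
        refine Or.inr ⟨ε, h * a⁻¹, mul_mem (hHK.le hh) (inv_mem ha.1), fun h' => ?_, ?_⟩
        · rw [H.mul_mem_cancel_left hh] at h'
          exact ha.2 (by simpa using inv_mem h')
        · rwa [show h * a⁻¹ * (a * g) = h * g by group]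
  intro i j n h1
  cases i
  · rcases (key _ _ _ _ h1).2 rfl with h | ⟨ε, k, hk, -, h⟩
    · exact h.2 (one_mem H)
    · rw [mul_one] at h
      exact hbase _ _ hk h
  · obtain ⟨ε, h', hh', h⟩ := (key _ _ _ _ h1).1 rfl
    rw [mul_one] at h
    exact hbase _ _ (hHK.le hh') h

end Fold

/-- Geometrically this is an HNN extension of `wallComp F` with stable letter `u`, conjugating `C =
wallStab F` into `wallComp F`. Put `γ = u * k₀` and `H = wallComp F ⊓ L`. Both associated subgroups
`u C u⁻¹` and `k₀⁻¹ C k₀` lie in `H`, so the extension folds to the amalgam of `wallComp F` and `⟨H,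
γ⟩` over `H`. The ping-pong sets are the half-spaces beyond the wall translated by `u` and by
`k₀⁻¹`. -/
theorem IsWall.isNontrivialAmalgam_of_translate {G : Type*} [Group G] {F : G → ℝ} {μ : ℝ}
    (hF : IsWall F μ) {u k₀ : G} (hu : F u⁻¹ = -μ) (hflip : ¬ ∃ g, ∀ h, F (g * h) = -F h)
    (L : Subgroup G) (hL : ∀ c ∈ wallStab F, u * c * u⁻¹ ∈ L) (hk₀ : k₀ ∈ wallComp F)
    (hk₀L : u * k₀ ∈ L) (hKL : ¬ wallComp F ≤ L)
    (hgen : ∀ L : Subgroup G, wallComp F ≤ L → u ∈ L → L = ⊤) : IsNontrivialAmalgam G := by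
  have hF₁ := hF.translate_neg hu
  have hneg : ∀ k ∈ wallComp F, ∀ x, 0 < F (u⁻¹ * x) → 0 < F (k * x) := by
    intro k hk x hx
    by_contra h
    rw [hF.not_pos_iff] at h
    have := hF.pos_translate_of_neg hu hflip (inv_mem hk) h
    rw [mul_assoc, inv_mul_cancel_left] at this
    linarith
  have hC₁ : ∀ c ∈ wallStab F, u * c * u⁻¹ ∈ wallComp F := fun c hc => hF.conj_mem_comp hu hc
  refine isNontrivialAmalgam_of_fold (γ := fun ε => cond ε (u * k₀) (u * k₀)⁻¹)
    (H := wallComp F ⊓ L) (K := wallComp F)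
    (A := fun ε => cond ε {x | 0 < F (u⁻¹ * x)} {x | F (k₀ * x) < 0})
    ?_ ?_ ?_ ?_ ?_ ?_ ?_
  · rintro (_ | _) <;> simp
  · exact lt_of_le_not_ge inf_le_left fun hle => hKL (hle.trans inf_le_right)
  · rintro (_ | _) x hx
    · change F (k₀ * ((u * k₀)⁻¹ * x)) < 0
      rw [show k₀ * ((u * k₀)⁻¹ * x) = u⁻¹ * x by group]
      exact (hF.not_pos_iff _).1 hx
    · change 0 < F (u⁻¹ * (u * k₀ * x))
      rw [show u⁻¹ * (u * k₀ * x) = k₀ * x by group]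
      exact not_not.1 fun h => hx ((hF.not_pos_iff _).1 h)
  · rintro (_ | _) k hk x hx
    · change ¬ 0 < F (u⁻¹ * (k * x))
      have := hF.pos_translate_of_neg hu hflip (mul_mem hk (inv_mem hk₀)) hx
      rw [show u⁻¹ * (k * k₀⁻¹) * (k₀ * x) = u⁻¹ * (k * x) by group] at this
      exact this.not_gt
    · change ¬ F (k₀ * (k * x)) < 0
      rw [← mul_assoc]
      exact (hneg _ (mul_mem hk₀ hk) x hx).not_gt
  · rintro (_ | _) k hk x hx hkx
    · change F (k₀ * x) < 0 at hx
      change F (k₀ * (k * x)) < 0 at hkx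
      have hc : k₀ * k * k₀⁻¹ ∈ wallStab F := by
        refine (hF.mem_stab_or (mul_mem (mul_mem hk₀ hk) (inv_mem hk₀))).resolve_right fun h => ?_
        have := h _ hx
        rw [show k₀ * k * k₀⁻¹ * (k₀ * x) = k₀ * (k * x) by group] at this
        exact this.not_gt hkx
      have e : u * k₀ * k * (u * k₀)⁻¹ = u * (k₀ * k * k₀⁻¹) * u⁻¹ := by group
      have hmem : u * k₀ * k * (u * k₀)⁻¹ ∈ L := e ▸ hL _ hc
      refine ⟨⟨hk, ?_⟩, e ▸ hC₁ _ hc, hmem⟩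
      have := mul_mem (mul_mem (inv_mem hk₀L) hmem) hk₀L
      rwa [show (u * k₀)⁻¹ * (u * k₀ * k * (u * k₀)⁻¹) * (u * k₀) = k by group] at this
    · change 0 < F (u⁻¹ * x) at hx
      change 0 < F (u⁻¹ * (k * x)) at hkx
      have hc : u⁻¹ * k * u ∈ wallStab F := by
        have := (hF₁.mem_stab_or (k := k) (by rwa [hF.comp_translate_neg])).resolve_right
          fun h => by linarith [h x (by linarith)]
        intro h
        have := this (u * h)
        simp only [inv_mul_cancel_left, neg_inj] at this
        rw [← this]
        congr 1
        group
      have hkL : k ∈ L := by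
        have := hL _ hc
        rwa [show u * (u⁻¹ * k * u) * u⁻¹ = k by group] at this
      refine ⟨⟨hk, hkL⟩, ?_, mul_mem (S := Subgroup G) (mul_mem (inv_mem hk₀L) hkL) hk₀L⟩
      have := mul_mem (mul_mem (inv_mem hk₀) (hF.stab_le_comp hc)) hk₀
      rw [show k₀⁻¹ * (u⁻¹ * k * u) * k₀ = (u * k₀)⁻¹ * k * (u * k₀) by group] at this
      exact this
  · rintro (_ | _) k hk
    · exact (hF.pos_of_mem_comp (mul_mem hk₀ hk)).not_gt
    · have := hF₁.pos_of_mem_comp (g := k) (by rwa [hF.comp_translate_neg])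
      change ¬ 0 < F (u⁻¹ * k)
      linarith
  · intro L' hK huk
    refine hgen L' hK ?_
    have := mul_mem huk (inv_mem (hK hk₀))
    rwa [cond_true, mul_inv_cancel_right] at this

/-! ### Binary hermitian forms -/

open ComplexConjugate in
/-- The binary hermitian form with coefficients `A`, `B`, `C`. -/
def herm (A : ℝ) (B : ℂ) (C : ℝ) (x y : ℂ) : ℝ :=
  A * Complex.normSq x + (B * x * conj y).im + C * Complex.normSq y

section Herm

open ComplexConjugate

variable {A C : ℝ} {B : ℂ}

/-- Cauchy–Schwarz and the hypothesis bound the mixed term: its square is at most `4AC|x|²|y|² ≤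
(A|x|² + C|y|²)²`. The common sign of `A` and `C` decides. -/
theorem herm_semidefinite (h : Complex.normSq B ≤ 4 * A * C) :
    (∀ x y, 0 ≤ herm A B C x y) ∨ (∀ x y, herm A B C x y ≤ 0) := by
  have key : ∀ x y, |(B * x * conj y).im| ≤ |A * Complex.normSq x + C * Complex.normSq y| := by
    intro x y
    rw [← sq_le_sq]
    have h₁ : (B * x * conj y).im ^ 2 ≤ Complex.normSq (B * x * conj y) := by
      rw [Complex.normSq_apply]
      nlinarith [sq_nonneg (B * x * conj y).re]
    rw [Complex.normSq_mul, Complex.normSq_mul, Complex.normSq_conj] at h₁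
    have hx := Complex.normSq_nonneg x
    have hy := Complex.normSq_nonneg y
    have h₂ := mul_le_mul_of_nonneg_right h (mul_nonneg hx hy)
    nlinarith [sq_nonneg (A * Complex.normSq x - C * Complex.normSq y)]
  have hAC : 0 ≤ A * C := by linarith [Complex.normSq_nonneg B]
  rcases mul_nonneg_iff.1 hAC with ⟨hA, hC⟩ | ⟨hA, hC⟩
  · left
    intro x y
    have := key x y
    rw [abs_of_nonneg (a := A * Complex.normSq x + C * Complex.normSq y)
      (add_nonneg (mul_nonneg hA (Complex.normSq_nonneg x))
        (mul_nonneg hC (Complex.normSq_nonneg y)))] at this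
    rw [herm]
    linarith [neg_abs_le (B * x * conj y).im]
  · right
    intro x y
    have := key x y
    rw [abs_of_nonpos (a := A * Complex.normSq x + C * Complex.normSq y)
      (add_nonpos (mul_nonpos_of_nonpos_of_nonneg hA (Complex.normSq_nonneg x))
        (mul_nonpos_of_nonpos_of_nonneg hC (Complex.normSq_nonneg y)))] at this
    rw [herm]
    linarith [le_abs_self (B * x * conj y).im]

theorem herm_add (x₁ y₁ x₂ y₂ a b : ℂ) :
    herm A B C (a * x₁ + b * x₂) (a * y₁ + b * y₂) =
      Complex.normSq a * herm A B C x₁ y₁ + Complex.normSq b * herm A B C x₂ y₂ +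
      ((2 * Complex.I * A * x₁ * conj x₂ + B * x₁ * conj y₂ - conj B * conj x₂ * y₁ +
        2 * Complex.I * C * y₁ * conj y₂) * a * conj b).im := by
  simp [herm, Complex.normSq_apply]
  ring

/-- In the basis of the two null vectors only a cross term with coefficient `β` survives. At the
coordinates `(± i conj β, 1)` the form takes the values `± |β|²`, so semidefiniteness forces `β =
0`. -/
theorem herm_eq_zero (h : (∀ x y, 0 ≤ herm A B C x y) ∨ (∀ x y, herm A B C x y ≤ 0))
    {x₁ y₁ x₂ y₂ : ℂ} (hdet : x₁ * y₂ - x₂ * y₁ ≠ 0) (h₁ : herm A B C x₁ y₁ = 0)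
    (h₂ : herm A B C x₂ y₂ = 0) (x y : ℂ) : herm A B C x y = 0 := by
  set β := 2 * Complex.I * A * x₁ * conj x₂ + B * x₁ * conj y₂ - conj B * conj x₂ * y₁ +
    2 * Complex.I * C * y₁ * conj y₂ with hβ
  have hadd : ∀ a b, herm A B C (a * x₁ + b * x₂) (a * y₁ + b * y₂) = (β * a * conj b).im := by
    intro a b
    rw [herm_add, h₁, h₂, ← hβ]
    ring
  have e : ∀ t : ℝ, (β * (t * Complex.I * conj β) * conj 1).im = t * Complex.normSq β := by
    intro t
    simp [Complex.normSq_apply]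
    ring
  have hβ0 : β = 0 := by
    rw [← Complex.normSq_eq_zero]
    have := Complex.normSq_nonneg β
    rcases h with h | h
    · have h' := h ((((-1 : ℝ) : ℂ) * Complex.I * conj β) * x₁ + 1 * x₂)
        ((((-1 : ℝ) : ℂ) * Complex.I * conj β) * y₁ + 1 * y₂)
      rw [hadd, e] at h'
      linarith
    · have h' := h ((((1 : ℝ) : ℂ) * Complex.I * conj β) * x₁ + 1 * x₂)
        ((((1 : ℝ) : ℂ) * Complex.I * conj β) * y₁ + 1 * y₂)
      rw [hadd, e] at h'
      linarith
  have hx : (x * y₂ - x₂ * y) / (x₁ * y₂ - x₂ * y₁) * x₁ +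
      (x₁ * y - x * y₁) / (x₁ * y₂ - x₂ * y₁) * x₂ = x := by
    rw [div_mul_eq_mul_div, div_mul_eq_mul_div, ← add_div, div_eq_iff hdet]
    ring
  have hy : (x * y₂ - x₂ * y) / (x₁ * y₂ - x₂ * y₁) * y₁ +
      (x₁ * y - x * y₁) / (x₁ * y₂ - x₂ * y₁) * y₂ = y := by
    rw [div_mul_eq_mul_div, div_mul_eq_mul_div, ← add_div, div_eq_iff hdet]
    ring
  have := hadd ((x * y₂ - x₂ * y) / (x₁ * y₂ - x₂ * y₁))
    ((x₁ * y - x * y₁) / (x₁ * y₂ - x₂ * y₁))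
  rwa [hx, hy, hβ0, zero_mul, zero_mul, Complex.zero_im] at this

theorem coeff_eq_zero_of_herm (h : ∀ x y, herm A B C x y = 0) : A = 0 ∧ B = 0 ∧ C = 0 := by
  have hA := h 1 0
  have hC := h 0 1
  have h₁ := h 1 1
  have h₂ := h Complex.I 1
  simp [herm] at hA hC h₁ h₂
  subst hA hC
  exact ⟨rfl, Complex.ext (by simpa using h₂) (by simpa using h₁), rfl⟩

end Herm

/-! ### The walls given by a hermitian form -/

section WallForm

open ComplexConjugate

/-- The coefficient of `|x|²` in `wallForm`. -/
def formA (l : ℂ) (M : Matrix (Fin 2) (Fin 2) ℂ) : ℝ := (l * M 0 0 * conj (M 1 0)).im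

/-- The coefficient of `|y|²` in `wallForm`. -/
def formC (l : ℂ) (M : Matrix (Fin 2) (Fin 2) ℂ) : ℝ := (l * M 0 1 * conj (M 1 1)).im

/-- The mixed coefficient in `wallForm`. -/
def formB (l : ℂ) (M : Matrix (Fin 2) (Fin 2) ℂ) : ℂ :=
  l * M 0 0 * conj (M 1 1) - conj l * conj (M 0 1) * M 1 0

/-- The hermitian form `Im (l x ȳ)`, transformed by a matrix. -/
def wallForm (l : ℂ) (M : Matrix (Fin 2) (Fin 2) ℂ) (x y : ℂ) : ℝ :=
  (l * (M 0 0 * x + M 0 1 * y) * conj (M 1 0 * x + M 1 1 * y)).im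

variable {l : ℂ}

theorem wallForm_eq_herm (M : Matrix (Fin 2) (Fin 2) ℂ) (x y : ℂ) :
    wallForm l M x y = herm (formA l M) (formB l M) (formC l M) x y := by
  simp [wallForm, herm, formA, formB, formC, Complex.normSq_apply]
  ring

theorem wallForm_mul (M N : Matrix (Fin 2) (Fin 2) ℂ) (x y : ℂ) :
    wallForm l (M * N) x y =
      wallForm l M (N 0 0 * x + N 0 1 * y) (N 1 0 * x + N 1 1 * y) := by
  simp only [wallForm, Matrix.mul_apply, Fin.sum_univ_two]
  congr 3 <;> ring_nf

theorem formA_one : formA l 1 = 0 := by simp [formA]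

theorem formC_one : formC l 1 = 0 := by simp [formC]

theorem formB_one : formB l 1 = l := by simp [formB]

/-- The discriminant `|B|² - 4AC` is multiplied by `|det M|²` under a change of variables, and that
of `Im (l x ȳ)` is `|l|² = 1`. -/
theorem normSq_formB (hl : Complex.normSq l = 1) (M : Matrix (Fin 2) (Fin 2) ℂ)
    (hM : M 0 0 * M 1 1 - M 0 1 * M 1 0 = 1) :
    Complex.normSq (formB l M) = 4 * formA l M * formC l M + 1 := by
  have h2 : Complex.normSq (formB l M) = 4 * formA l M * formC l M +
      Complex.normSq l * Complex.normSq (M 0 0 * M 1 1 - M 0 1 * M 1 0) := by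
    simp [formA, formB, formC, Complex.normSq_apply]
    ring
  rw [h2, hM, hl]
  simp

variable {G : Type*} [Group G] (l) (ρ : G →* Matrix (Fin 2) (Fin 2) ℂ) (z₁ z₂ : ℂ)

/-- The value of the transformed hermitian form at the base point. -/
def wallFun (g : G) : ℝ := wallForm l (ρ g) z₁ 1 + wallForm l (ρ g) z₂ 1

variable {l ρ z₁ z₂}

/-- Comparing a wall with a translate amounts to the sign of one hermitian form, evaluated at the
two vectors `(z₁, 1)`, `(z₂, 1)` that represent the base point, moved by `h`. -/
theorem wallFun_sub (ε : ℝ) (g h : G) : wallFun l ρ z₁ z₂ (g * h) - ε * wallFun l ρ z₁ z₂ h =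
    herm (formA l (ρ g)) (formB l (ρ g) - ε * l) (formC l (ρ g))
        (ρ h 0 0 * z₁ + ρ h 0 1) (ρ h 1 0 * z₁ + ρ h 1 1) +
      herm (formA l (ρ g)) (formB l (ρ g) - ε * l) (formC l (ρ g))
        (ρ h 0 0 * z₂ + ρ h 0 1) (ρ h 1 0 * z₂ + ρ h 1 1) := by
  have key : ∀ x y, herm (formA l (ρ g)) (formB l (ρ g) - ε * l) (formC l (ρ g)) x y =
      wallForm l (ρ g) x y - ε * (l * x * conj y).im := by
    intro x y
    rw [wallForm_eq_herm]
    simp [herm]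
    ring
  rw [key, key]
  simp only [wallFun, map_mul, wallForm_mul, mul_one]
  simp only [wallForm, mul_one]
  ring

/-- Expanding, `|B - εl|² = |B|² - 2ε Re(B l̄) + 1 = 4AC + 2 - 2ε Re(B l̄)`, which is at most `4AC`
exactly under `hN`. -/
theorem wallFun_herm_semidefinite (hl : Complex.normSq l = 1) {g : G}
    (hg : ρ g 0 0 * ρ g 1 1 - ρ g 0 1 * ρ g 1 0 = 1) {ε : ℝ} (hε : ε = 1 ∨ ε = -1)
    (hN : 1 ≤ ε * (formB l (ρ g) * conj l).re) :
    (∀ x y, 0 ≤ herm (formA l (ρ g)) (formB l (ρ g) - ε * l) (formC l (ρ g)) x y) ∨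
      (∀ x y, herm (formA l (ρ g)) (formB l (ρ g) - ε * l) (formC l (ρ g)) x y ≤ 0) := by
  apply herm_semidefinite
  have h₁ := normSq_formB hl _ hg
  have h₂ : Complex.normSq (formB l (ρ g) - ε * l) = Complex.normSq (formB l (ρ g)) -
      2 * (ε * (formB l (ρ g) * conj l).re) + ε ^ 2 * Complex.normSq l := by
    simp [Complex.normSq_apply]
    ring
  have h₃ : ε ^ 2 = 1 := by rcases hε with rfl | rfl <;> norm_num
  rw [h₂, h₁, hl, h₃]
  linarith

theorem wallFun_coeff (hl : Complex.normSq l = 1) (hz : z₁ ≠ z₂) {g h₀ : G}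
    (hdet : ∀ g, ρ g 0 0 * ρ g 1 1 - ρ g 0 1 * ρ g 1 0 = 1) {ε : ℝ} (hε : ε = 1 ∨ ε = -1)
    (hN : 1 ≤ ε * (formB l (ρ g) * conj l).re)
    (h : wallFun l ρ z₁ z₂ (g * h₀) = ε * wallFun l ρ z₁ z₂ h₀) :
    formA l (ρ g) = 0 ∧ formB l (ρ g) = ε * l ∧ formC l (ρ g) = 0 := by
  have hs := wallFun_herm_semidefinite hl (hdet g) hε hN
  have h₀' := wallFun_sub (l := l) (ρ := ρ) (z₁ := z₁) (z₂ := z₂) ε g h₀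
  rw [h, sub_self] at h₀'
  have hzero : herm (formA l (ρ g)) (formB l (ρ g) - ε * l) (formC l (ρ g))
      (ρ h₀ 0 0 * z₁ + ρ h₀ 0 1) (ρ h₀ 1 0 * z₁ + ρ h₀ 1 1) = 0 ∧
      herm (formA l (ρ g)) (formB l (ρ g) - ε * l) (formC l (ρ g))
        (ρ h₀ 0 0 * z₂ + ρ h₀ 0 1) (ρ h₀ 1 0 * z₂ + ρ h₀ 1 1) = 0 := by
    rcases hs with hs | hs
    · constructor <;>
      linarith [hs (ρ h₀ 0 0 * z₁ + ρ h₀ 0 1) (ρ h₀ 1 0 * z₁ + ρ h₀ 1 1),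
        hs (ρ h₀ 0 0 * z₂ + ρ h₀ 0 1) (ρ h₀ 1 0 * z₂ + ρ h₀ 1 1)]
    · constructor <;>
      linarith [hs (ρ h₀ 0 0 * z₁ + ρ h₀ 0 1) (ρ h₀ 1 0 * z₁ + ρ h₀ 1 1),
        hs (ρ h₀ 0 0 * z₂ + ρ h₀ 0 1) (ρ h₀ 1 0 * z₂ + ρ h₀ 1 1)]
  have hind : (ρ h₀ 0 0 * z₁ + ρ h₀ 0 1) * (ρ h₀ 1 0 * z₂ + ρ h₀ 1 1) -
      (ρ h₀ 0 0 * z₂ + ρ h₀ 0 1) * (ρ h₀ 1 0 * z₁ + ρ h₀ 1 1) ≠ 0 := by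
    rw [show (ρ h₀ 0 0 * z₁ + ρ h₀ 0 1) * (ρ h₀ 1 0 * z₂ + ρ h₀ 1 1) -
      (ρ h₀ 0 0 * z₂ + ρ h₀ 0 1) * (ρ h₀ 1 0 * z₁ + ρ h₀ 1 1) =
      (ρ h₀ 0 0 * ρ h₀ 1 1 - ρ h₀ 0 1 * ρ h₀ 1 0) * (z₁ - z₂) by ring, hdet, one_mul]
    exact sub_ne_zero.2 hz
  obtain ⟨h₁, h₂, h₃⟩ := coeff_eq_zero_of_herm (herm_eq_zero hs hind hzero.1 hzero.2)
  exact ⟨h₁, sub_eq_zero.1 h₂, h₃⟩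

theorem isWall_wallFun (hl : Complex.normSq l = 1) (hz : z₁ ≠ z₂)
    (hdet : ∀ g, ρ g 0 0 * ρ g 1 1 - ρ g 0 1 * ρ g 1 0 = 1) {μ : ℝ} (hμ : 0 < μ)
    (h1 : wallFun l ρ z₁ z₂ 1 = μ) (habs : ∀ g, μ ≤ |wallFun l ρ z₁ z₂ g|)
    (hN : ∀ g, ∃ ε : ℝ, (ε = 1 ∨ ε = -1) ∧ 1 ≤ ε * (formB l (ρ g) * conj l).re) :
    IsWall (wallFun l ρ z₁ z₂) μ where
  pos := hμ
  one := h1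
  le_abs := habs
  nested g := by
    obtain ⟨ε, hε, hN⟩ := hN g
    refine ⟨ε, hε, ?_, fun h₀ he h => ?_⟩
    · rcases wallFun_herm_semidefinite hl (hdet g) hε hN with hs | hs
      · exact Or.inr fun h => by
          have := wallFun_sub (l := l) (ρ := ρ) (z₁ := z₁) (z₂ := z₂) ε g h
          linarith [hs (ρ h 0 0 * z₁ + ρ h 0 1) (ρ h 1 0 * z₁ + ρ h 1 1),
            hs (ρ h 0 0 * z₂ + ρ h 0 1) (ρ h 1 0 * z₂ + ρ h 1 1)]
      · exact Or.inl fun h => by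
          have := wallFun_sub (l := l) (ρ := ρ) (z₁ := z₁) (z₂ := z₂) ε g h
          linarith [hs (ρ h 0 0 * z₁ + ρ h 0 1) (ρ h 1 0 * z₁ + ρ h 1 1),
            hs (ρ h 0 0 * z₂ + ρ h 0 1) (ρ h 1 0 * z₂ + ρ h 1 1)]
    · obtain ⟨hA, hB, hC⟩ := wallFun_coeff hl hz hdet hε hN he
      rw [← sub_eq_zero, wallFun_sub, hA, hB, hC]
      simp [herm]

/-- The coefficients of the form of an element that preserves the wall up to the sign `ε`. -/
theorem wallFun_coeff_of_forall (hl : Complex.normSq l = 1) (hz : z₁ ≠ z₂)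
    (hdet : ∀ g, ρ g 0 0 * ρ g 1 1 - ρ g 0 1 * ρ g 1 0 = 1)
    (hN : ∀ g, ∃ ε : ℝ, (ε = 1 ∨ ε = -1) ∧ 1 ≤ ε * (formB l (ρ g) * conj l).re)
    (hpos : ∃ h, 0 < wallFun l ρ z₁ z₂ h) (hneg : ∃ h, wallFun l ρ z₁ z₂ h < 0) {g : G} {ε : ℝ}
    (hε : ε = 1 ∨ ε = -1) (h : ∀ h, wallFun l ρ z₁ z₂ (g * h) = ε * wallFun l ρ z₁ z₂ h) :
    formA l (ρ g) = 0 ∧ formB l (ρ g) = ε * l ∧ formC l (ρ g) = 0 := by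
  obtain ⟨ε', hε', hN⟩ := hN g
  obtain ⟨p, hp⟩ := hpos
  obtain ⟨n, hn⟩ := hneg
  by_cases hεε : ε' = ε
  · subst hεε
    exact wallFun_coeff hl hz hdet hε' hN (h 1)
  -- With the wrong sign `ε' = -ε`, the difference `F (g * h) - ε' F h` equals `2 ε F h`. It takes
  -- both signs, contradicting semidefiniteness.
  · exfalso
    have hp' := wallFun_sub (l := l) (ρ := ρ) (z₁ := z₁) (z₂ := z₂) ε' g p
    have hn' := wallFun_sub (l := l) (ρ := ρ) (z₁ := z₁) (z₂ := z₂) ε' g n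
    rw [h] at hp' hn'
    have hs := wallFun_herm_semidefinite hl (hdet g) hε' hN
    rcases hs with hs | hs
    · have h₁ := hs (ρ p 0 0 * z₁ + ρ p 0 1) (ρ p 1 0 * z₁ + ρ p 1 1)
      have h₂ := hs (ρ p 0 0 * z₂ + ρ p 0 1) (ρ p 1 0 * z₂ + ρ p 1 1)
      have h₃ := hs (ρ n 0 0 * z₁ + ρ n 0 1) (ρ n 1 0 * z₁ + ρ n 1 1)
      have h₄ := hs (ρ n 0 0 * z₂ + ρ n 0 1) (ρ n 1 0 * z₂ + ρ n 1 1)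
      rcases hε with rfl | rfl <;> rcases hε' with rfl | rfl <;>
        first | exact hεε rfl | linarith
    · have h₁ := hs (ρ p 0 0 * z₁ + ρ p 0 1) (ρ p 1 0 * z₁ + ρ p 1 1)
      have h₂ := hs (ρ p 0 0 * z₂ + ρ p 0 1) (ρ p 1 0 * z₂ + ρ p 1 1)
      have h₃ := hs (ρ n 0 0 * z₁ + ρ n 0 1) (ρ n 1 0 * z₁ + ρ n 1 1)
      have h₄ := hs (ρ n 0 0 * z₂ + ρ n 0 1) (ρ n 1 0 * z₂ + ρ n 1 1)
      rcases hε with rfl | rfl <;> rcases hε' with rfl | rfl <;>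
        first | exact hεε rfl | linarith

end WallForm

/-! ### The group `E₂(R)` -/

section ElTwo

variable {R : Type*} [CommRing R]

theorem det_of_mem_E₂ {g : GL (Fin 2) R} (hg : g ∈ E₂ R) : g 0 0 * g 1 1 - g 0 1 * g 1 0 = 1 := by
  have : g ∈ (Matrix.GeneralLinearGroup.det (n := Fin 2) (R := R)).ker := by
    refine (Subgroup.closure_le _).2 ?_ hg
    rintro _ ⟨x, rfl⟩
    refine MonoidHom.mem_ker.2 (Units.ext ?_)
    simp [elemE, Matrix.det_fin_two]
  have := congrArg Units.val (MonoidHom.mem_ker.1 this)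
  rw [Matrix.GeneralLinearGroup.val_det_apply, Matrix.det_fin_two] at this
  exact this

variable (R) in
/-- The element `E(x)` of `E₂(R)`. -/
def elE (x : R) : E₂ R := ⟨elemE x, Subgroup.subset_closure ⟨x, rfl⟩⟩

/-- The unipotent element `(1, x; 0, 1)` of `E₂(R)`. -/
def unip (x : R) : E₂ R := elE R (-x) * (elE R 0)⁻¹

theorem coe_elE (x : R) : ((elE R x : GL (Fin 2) R) : Matrix (Fin 2) (Fin 2) R) = !![x, 1; -1, 0] :=
  rfl

theorem coe_unip (x : R) :
    ((unip x : GL (Fin 2) R) : Matrix (Fin 2) (Fin 2) R) = !![1, x; 0, 1] := by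
  change !![-x, 1; -1, 0] * !![(0 : R), -1; 1, 0] = _
  simp

theorem coe_inv {g : GL (Fin 2) R} (hg : g ∈ E₂ R) :
    ((g⁻¹ : GL (Fin 2) R) : Matrix (Fin 2) (Fin 2) R) = !![g 1 1, -g 0 1; -g 1 0, g 0 0] := by
  rw [Matrix.coe_units_inv, Matrix.inv_def, Matrix.adjugate_fin_two, Matrix.det_fin_two]
  have := det_of_mem_E₂ hg
  rw [this]
  simp

theorem E₂_ext {g h : E₂ R}
    (H : ((g : GL (Fin 2) R) : Matrix (Fin 2) (Fin 2) R) = (h : GL (Fin 2) R)) :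
    g = h :=
  Subtype.ext (Units.ext H)

theorem unip_add (x y : R) : unip (x + y) = unip x * unip y := by
  refine E₂_ext ?_
  rw [Subgroup.coe_mul, Units.val_mul, coe_unip, coe_unip, coe_unip, Matrix.mul_fin_two]
  simp [add_comm]

theorem elE_eq (x : R) : elE R x = unip (-x) * elE R 0 := by
  rw [unip, neg_neg, inv_mul_cancel_right]

/-- The homomorphism `x ↦ (1, x; 0, 1)`. -/
def unipHom : Multiplicative R →* E₂ R where
  toFun x := unip x.toAdd
  map_one' := E₂_ext (by simp [coe_unip, Matrix.one_fin_two])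
  map_mul' x y := unip_add _ _

theorem unip_zsmul (n : ℤ) (x : R) : unip (n • x) = unip x ^ n :=
  map_zpow unipHom (Multiplicative.ofAdd x) n

theorem eq_top_of_unip_mem {L : Subgroup (E₂ R)} (h0 : elE R 0 ∈ L) (h : ∀ x, unip x ∈ L) :
    L = ⊤ := by
  have key : ∀ g, ∀ hg : g ∈ E₂ R, (⟨g, hg⟩ : E₂ R) ∈ L := by
    intro g hg
    induction hg using Subgroup.closure_induction with
    | mem x hx =>
      obtain ⟨x, rfl⟩ := hx
      have := mul_mem (h (-x)) h0
      rwa [← elE_eq] at this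
    | one => exact one_mem L
    | mul x y hx hy ihx ihy => exact mul_mem ihx ihy
    | inv x hx ih => exact inv_mem ih
  exact eq_top_iff.2 fun g _ => key g.1 g.2

/-- The matrix over `ℂ` of an element of `E₂(R)`, for a ring homomorphism `R → ℂ`. -/
def toMatrix (ι : R →+* ℂ) : E₂ R →* Matrix (Fin 2) (Fin 2) ℂ :=
  (ι.mapMatrix.toMonoidHom.comp (Units.coeHom _)).comp (E₂ R).subtype

@[simp]
theorem toMatrix_apply (ι : R →+* ℂ) (g : E₂ R) (i j : Fin 2) :
    toMatrix ι g i j = ι ((g : GL (Fin 2) R) i j) :=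
  rfl

theorem toMatrix_det (ι : R →+* ℂ) (g : E₂ R) :
    toMatrix ι g 0 0 * toMatrix ι g 1 1 - toMatrix ι g 0 1 * toMatrix ι g 1 0 = 1 := by
  have := congrArg ι (det_of_mem_E₂ g.2)
  simpa using this

end ElTwo

theorem wallForm_smul {l : ℂ} (M : Matrix (Fin 2) (Fin 2) ℂ) (c x y : ℂ) :
    wallForm l M (c * x) (c * y) = Complex.normSq c * wallForm l M x y := by
  simp [wallForm, Complex.normSq_apply]
  ring

/-! ### Rings whose elements have integral real part -/

open ComplexConjugate in
/-- If `R` is a ring of complex numbers that is compatible with the decomposition of `ℂ` into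
`ℝ` and `iℝ` in that all real parts and all products of imaginary parts are integers, then the
translates of the wall above the imaginary axis decompose `E₂(R)`. -/
theorem isNontrivialAmalgam_of_re_int {R : Type*} [CommRing R] (ι : R →+* ℂ)
    (hre : ∀ x, ∃ a : ℤ, (ι x).re = a) (him : ∀ x y, ∃ a : ℤ, (ι x).im * (ι y).im = a) :
    IsNontrivialAmalgam (E₂ R) := by
  have h3 : √3 * √3 = 3 := Real.mul_self_sqrt (by norm_num)
  -- The base point lies above `1/2` at height `√3/2`. The fixed points of `E(-1)` on the boundary
  -- are `z₁` and `z₂`, so this rotation of order three fixes the base point.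
  set z₁ : ℂ := ⟨1 / 2, √3 / 2⟩ with hz₁
  set z₂ : ℂ := ⟨1 / 2, -(√3 / 2)⟩ with hz₂
  have hz₁' : z₁ * z₁ = z₁ - 1 := by
    apply Complex.ext <;> simp [hz₁] <;> linarith
  have hz₂' : z₂ * z₂ = z₂ - 1 := by
    apply Complex.ext <;> simp [hz₂] <;> linarith
  have hn₁ : Complex.normSq z₁ = 1 := by
    rw [Complex.normSq_apply, hz₁]; dsimp only; linarith
  have hn₂ : Complex.normSq z₂ = 1 := by
    rw [Complex.normSq_apply, hz₂]; dsimp only; linarith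
  have hne : z₁ ≠ z₂ := fun h => by
    have := congrArg Complex.im h
    simp only [hz₁, hz₂] at this
    have h3' : 0 < √3 := by positivity
    linarith
  have hF : ∀ g : E₂ R, wallFun Complex.I (toMatrix ι) z₁ z₂ g =
      2 * formA Complex.I (toMatrix ι g) + (formB Complex.I (toMatrix ι g)).im +
        2 * formC Complex.I (toMatrix ι g) := by
    intro g
    rw [wallFun, wallForm_eq_herm, wallForm_eq_herm, herm, herm, hn₁, hn₂]
    simp [hz₁, hz₂]
    ring
  -- The real part of the determinant equation makes `Im B` odd. Hence `F g = 2A + Im B + 2C` is odd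
  -- as well, and both have absolute value at least 1: the first fact gives nestedness, the second
  -- minimality of the base point.
  have hint : ∀ g : E₂ R, ∃ a b c : ℤ, formA Complex.I (toMatrix ι g) = a ∧
      formC Complex.I (toMatrix ι g) = c ∧ (formB Complex.I (toMatrix ι g)).im = 2 * b + 1 := by
    intro g
    obtain ⟨p, hp⟩ := hre ((g : GL (Fin 2) R) 0 0)
    obtain ⟨q, hq⟩ := hre ((g : GL (Fin 2) R) 0 1)
    obtain ⟨r, hr⟩ := hre ((g : GL (Fin 2) R) 1 0)
    obtain ⟨s, hs⟩ := hre ((g : GL (Fin 2) R) 1 1)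
    obtain ⟨a, ha⟩ := him ((g : GL (Fin 2) R) 0 0) ((g : GL (Fin 2) R) 1 0)
    obtain ⟨c, hc⟩ := him ((g : GL (Fin 2) R) 0 1) ((g : GL (Fin 2) R) 1 1)
    obtain ⟨b, hb⟩ := him ((g : GL (Fin 2) R) 0 0) ((g : GL (Fin 2) R) 1 1)
    have hdet := congrArg Complex.re (toMatrix_det ι g)
    simp only [toMatrix_apply, Complex.sub_re, Complex.mul_re, Complex.one_re, hp, hq, hr, hs,
      hb] at hdet
    refine ⟨p * r + a, b + q * r, q * s + c, ?_, ?_, ?_⟩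
    · simp [formA, hp, hr]
      linarith
    · simp [formC, hq, hs]
      linarith
    · simp [formB, hp, hq, hr, hs]
      linarith
  have hodd : ∀ n : ℤ, (1 : ℝ) ≤ |2 * (n : ℝ) + 1| := by
    intro n
    have : (1 : ℤ) ≤ |2 * n + 1| := Int.one_le_abs (by omega)
    exact_mod_cast this
  have hwall : IsWall (wallFun Complex.I (toMatrix ι) z₁ z₂) 1 := by
    refine isWall_wallFun (by simp) hne (toMatrix_det ι) one_pos ?_ ?_ ?_
    · rw [hF, map_one, formA_one, formB_one, formC_one]
      simp
    · intro g
      obtain ⟨a, b, c, ha, hc, hb⟩ := hint g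
      rw [hF, ha, hc, hb]
      have := hodd (a + b + c)
      push_cast at this
      convert this using 2
      ring
    · intro g
      obtain ⟨a, b, c, ha, hc, hb⟩ := hint g
      have e : (formB Complex.I (toMatrix ι g) * conj Complex.I).re = 2 * b + 1 := by
        rw [← hb]
        simp
      rw [e]
      rcases le_abs.1 (hodd b) with h | h
      · exact ⟨1, Or.inl rfl, by linarith⟩
      · exact ⟨-1, Or.inr rfl, by linarith⟩
  have hE0 : ∀ h, wallFun Complex.I (toMatrix ι) z₁ z₂ (elE R 0 * h) =
      -wallFun Complex.I (toMatrix ι) z₁ z₂ h := by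
    intro h
    simp only [wallFun, map_mul, wallForm_mul]
    simp [wallForm, coe_elE]
    ring
  have hE1 : elE R (-1) ∈ wallComp (wallFun Complex.I (toMatrix ι) z₁ z₂) := by
    have key : ∀ (M : Matrix (Fin 2) (Fin 2) ℂ) (z : ℂ), z * z = z - 1 → Complex.normSq z = 1 →
        wallForm Complex.I (M * toMatrix ι (elE R (-1))) z 1 = wallForm Complex.I M z 1 := by
      intro M z hz hn
      rw [wallForm_mul]
      simp only [toMatrix_apply, coe_elE]
      have e₁ : ι (!![(-1 : R), 1; -1, 0] 0 0) * z + ι (!![(-1 : R), 1; -1, 0] 0 1) * 1 =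
          (-z) * z := by
        simp; linear_combination hz
      have e₂ : ι (!![(-1 : R), 1; -1, 0] 1 0) * z + ι (!![(-1 : R), 1; -1, 0] 1 1) * 1 =
          (-z) * 1 := by
        simp
      rw [e₁, e₂, wallForm_smul, Complex.normSq_neg, hn, one_mul]
    intro h
    rw [wallFun, wallFun, map_mul, key _ _ hz₁' hn₁, key _ _ hz₂' hn₂]
  refine hwall.isNontrivialAmalgam_of_flip hE0 hE1 ?_ ?_
  · intro hst
    have := hst (unip (-1))
    rw [hF, hF] at this
    simp [formA, formB, formC, coe_elE, coe_unip, Matrix.mul_apply, Fin.sum_univ_two] at this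
    norm_num at this
  · have h0 : elE R 0 ∈ wallComp (wallFun Complex.I (toMatrix ι) z₁ z₂) ⊔
        wallFlip (wallFun Complex.I (toMatrix ι) z₁ z₂) :=
      (le_sup_right : wallFlip (wallFun Complex.I (toMatrix ι) z₁ z₂) ≤ _) (Or.inr hE0)
    refine eq_top_of_unip_mem h0 fun x => ?_
    obtain ⟨a, ha⟩ := hre x
    have h1 : unip (1 : R) ∈ wallComp (wallFun Complex.I (toMatrix ι) z₁ z₂) ⊔
        wallFlip (wallFun Complex.I (toMatrix ι) z₁ z₂) :=
      mul_mem ((le_sup_left : wallComp (wallFun Complex.I (toMatrix ι) z₁ z₂) ≤ _) hE1)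
        (inv_mem h0)
    -- Removing the integral real part leaves a purely imaginary translation, which preserves the
    -- wall and its sides.
    have h2 : unip (x - a) ∈ wallStab (wallFun Complex.I (toMatrix ι) z₁ z₂) := by
      intro h
      simp only [wallFun, map_mul, wallForm_mul]
      simp [wallForm, coe_unip, ha]
      ring
    have e : x = a • (1 : R) + (x - a) := by simp
    rw [e, unip_add, unip_zsmul]
    exact mul_mem (zpow_mem h1 a)
      ((le_sup_left : wallComp (wallFun Complex.I (toMatrix ι) z₁ z₂) ≤ _)
        (hwall.stab_le_comp h2))

/-! ### The rings `ℤ[ω]` with `ω² = ω - n` -/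

section QuadRing

/-- The ring `ℤ[ω]`, where `ω² = ω - n`. -/
abbrev QuadRing (n : ℤ) : Type := QuadraticAlgebra ℤ (-n) 1

/-- Half of the square root of the absolute value of the discriminant. -/
def halfSqrt (n : ℤ) : ℝ := √(4 * n - 1) / 2

theorem halfSqrt_sq {n : ℤ} (hn : 1 ≤ n) : halfSqrt n * halfSqrt n = n - 1 / 4 := by
  have : (0 : ℝ) ≤ 4 * n - 1 := by
    have : (1 : ℝ) ≤ n := by exact_mod_cast hn
    linarith
  have := Real.mul_self_sqrt this
  rw [halfSqrt]
  linarith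

theorem halfSqrt_pos {n : ℤ} (hn : 1 ≤ n) : 0 < halfSqrt n := by
  have : (0 : ℝ) < 4 * n - 1 := by
    have : (1 : ℝ) ≤ n := by exact_mod_cast hn
    linarith
  rw [halfSqrt]
  positivity

/-- The embedding of `ℤ[ω]` into the complex numbers. -/
def quadEmb (n : ℤ) (hn : 1 ≤ n) : QuadRing n →+* ℂ :=
  (QuadraticAlgebra.lift (R := ℤ) (A := ℂ) (a := -n) (b := 1) ⟨⟨1 / 2, halfSqrt n⟩, by
    have := halfSqrt_sq hn
    apply Complex.ext
    · simp
      linarith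
    · simp
      ring⟩).toRingHom

theorem quadEmb_re {n : ℤ} (hn : 1 ≤ n) (x : QuadRing n) :
    (quadEmb n hn x).re = x.re + x.im / 2 := by
  simp [quadEmb, QuadraticAlgebra.lift]
  ring

theorem quadEmb_im {n : ℤ} (hn : 1 ≤ n) (x : QuadRing n) :
    (quadEmb n hn x).im = x.im * halfSqrt n := by
  simp [quadEmb, QuadraticAlgebra.lift]

variable {n : ℤ}

theorem det_re (g : E₂ (QuadRing n)) :
    ((g : GL (Fin 2) (QuadRing n)) 0 0).re * ((g : GL (Fin 2) (QuadRing n)) 1 1).re -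
      n * (((g : GL (Fin 2) (QuadRing n)) 0 0).im * ((g : GL (Fin 2) (QuadRing n)) 1 1).im) -
      ((g : GL (Fin 2) (QuadRing n)) 0 1).re * ((g : GL (Fin 2) (QuadRing n)) 1 0).re +
      n *
        (((g : GL (Fin 2) (QuadRing n)) 0 1).im * ((g : GL (Fin 2) (QuadRing n)) 1 0).im) = 1 := by
  have := congrArg QuadraticAlgebra.re (det_of_mem_E₂ g.2)
  simp at this
  rw [QuadraticAlgebra.re_one] at this
  linarith

theorem det_im (g : E₂ (QuadRing n)) :
    ((g : GL (Fin 2) (QuadRing n)) 0 0).re * ((g : GL (Fin 2) (QuadRing n)) 1 1).im +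
      ((g : GL (Fin 2) (QuadRing n)) 0 0).im * ((g : GL (Fin 2) (QuadRing n)) 1 1).re +
      ((g : GL (Fin 2) (QuadRing n)) 0 0).im * ((g : GL (Fin 2) (QuadRing n)) 1 1).im -
      ((g : GL (Fin 2) (QuadRing n)) 0 1).re * ((g : GL (Fin 2) (QuadRing n)) 1 0).im -
      ((g : GL (Fin 2) (QuadRing n)) 0 1).im * ((g : GL (Fin 2) (QuadRing n)) 1 0).re -
      ((g : GL (Fin 2) (QuadRing n)) 0 1).im * ((g : GL (Fin 2) (QuadRing n)) 1 0).im = 0 := by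
  have := congrArg QuadraticAlgebra.im (det_of_mem_E₂ g.2)
  simp at this
  rw [QuadraticAlgebra.im_one] at this
  linarith

variable (n) in
/-- The elements of `E₂(ℤ[ω])` whose entries lie in `ℤ + pℤ[ω]`. -/
def conductorSubgroup (p : ℤ) : Subgroup (E₂ (QuadRing n)) where
  carrier := {g | ∀ i j, p ∣ ((g : GL (Fin 2) (QuadRing n)) i j).im}
  one_mem' := by
    intro i j
    fin_cases i <;> fin_cases j <;> simp [QuadraticAlgebra.im_one]
  mul_mem' := by
    intro a b ha hb i j
    simp only [Subgroup.coe_mul, Units.val_mul, Matrix.mul_apply, Fin.sum_univ_two,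
      QuadraticAlgebra.im_add, QuadraticAlgebra.im_mul, one_mul]
    have h₁ := ha i 0
    have h₂ := ha i 1
    have h₃ := hb 0 j
    have h₄ := hb 1 j
    exact dvd_add (dvd_add (dvd_add (h₃.mul_left _) (h₁.mul_right _)) (h₁.mul_right _))
      (dvd_add (dvd_add (h₄.mul_left _) (h₂.mul_right _)) (h₂.mul_right _))
  inv_mem' := by
    intro a ha i j
    have : (((a⁻¹ : E₂ (QuadRing n)) : GL (Fin 2) (QuadRing n)) :
        Matrix (Fin 2) (Fin 2) (QuadRing n)) = _ := coe_inv a.2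
    rw [this]
    fin_cases i <;> fin_cases j
    · exact ha 1 1
    · exact (dvd_neg.2 (ha 0 1) :)
    · exact (dvd_neg.2 (ha 1 0) :)
    · exact ha 0 0

theorem unip_neg {R : Type*} [CommRing R] (x : R) : unip (-x) = (unip x)⁻¹ :=
  map_inv (unipHom (R := R)) (Multiplicative.ofAdd x)

/-- Minimality of the base point for `𝓘_7` and `𝓘_11`. With `m = 4n - 1` and `s = a + c`, failure
means `my - 4 < 4s < my`, whereas `s² ≥ 4ac = (2x + y)² + my² - 4y`. For `m = 7, 11` this leaves
only `y = 0`, excluded modulo 4, and `y = 1`, excluded because `2x + 1` is odd. -/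
theorem two_le_abs_of_mul_eq (hn : n = 2 ∨ n = 3) {a c x y : ℤ}
    (h : a * c = x ^ 2 + x * y + n * y ^ 2 - y) :
    2 ≤ |4 * (a + c) + 2 - (4 * n - 1) * y| := by
  have hs : (2 * x + y) ^ 2 + (4 * n - 1) * y ^ 2 - 4 * y ≤ (a + c) ^ 2 := by
    nlinarith [sq_nonneg (a - c)]
  by_contra hlt
  rw [not_le, abs_lt] at hlt
  obtain ⟨h₁, h₂⟩ := hlt
  have hm : 4 * n - 1 = 7 ∨ 4 * n - 1 = 11 := by omega
  generalize 4 * n - 1 = m at *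
  generalize a + c = s at *
  rcases lt_trichotomy y 0 with hy | rfl | hy
  · have h₃ : 16 * s ^ 2 < (m * y - 4) ^ 2 := by
      rcases hm with rfl | rfl <;> nlinarith
    rcases hm with rfl | rfl <;> nlinarith [sq_nonneg (2 * x + y)]
  · omega
  · have h₃ : 16 * s ^ 2 < (m * y) ^ 2 := by
      rcases hm with rfl | rfl <;> nlinarith
    have hy1 : y = 1 := by
      rcases hm with rfl | rfl <;> nlinarith [sq_nonneg (2 * x + y)]
    subst hy1
    have : 1 ≤ (2 * x + 1) ^ 2 := by
      have : 2 * x + 1 ≠ 0 := by omega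
      have := sq_pos_of_ne_zero this
      omega
    rcases hm with rfl | rfl <;> omega

open ComplexConjugate in
/-- If the reductions of the stabilizer of a component modulo `p` contain the reduction of
`(1, ω; 0, 1)`, then `E₂(ℤ[ω])` is a nontrivial amalgamated product. -/
theorem isNontrivialAmalgam_quadRing (hn : n = 2 ∨ n = 3) (p : ℤ) (hp : ¬ p ∣ 1)
    (hk : ∃ k ∈ Subgroup.closure {elE (QuadRing n) 0, unip (-1),
      unip QuadraticAlgebra.omega * elE (QuadRing n) 0 * (unip QuadraticAlgebra.omega)⁻¹},
      k * unip QuadraticAlgebra.omega ∈ conductorSubgroup n p) :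
    IsNontrivialAmalgam (E₂ (QuadRing n)) := by
  have hn1 : 1 ≤ n := by omega
  set ι := quadEmb n hn1 with hι
  set t := halfSqrt n with ht
  have htpos : 0 < t := halfSqrt_pos hn1
  have htsq : t * t = n - 1 / 4 := halfSqrt_sq hn1
  have hn3 : (n : ℝ) ≤ 3 := by
    have : n ≤ 3 := by omega
    exact_mod_cast this
  have hττ : √(1 - t * t / 4) * √(1 - t * t / 4) = 1 - t * t / 4 :=
    Real.mul_self_sqrt (by linarith)
  have hτ : 0 < √(1 - t * t / 4) := Real.sqrt_pos.2 (by linarith)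
  set τ := √(1 - t * t / 4)
  -- The base point lies above `it/2`, midway between the walls over `Im z = 0` and `Im z = t`.
  -- Translation by `ω` carries the first to the second.
  set z₁ : ℂ := ⟨τ, t / 2⟩ with hz₁
  set z₂ : ℂ := ⟨-τ, t / 2⟩ with hz₂
  have hn₁ : Complex.normSq z₁ = 1 := by
    rw [Complex.normSq_apply, hz₁]; dsimp only; linarith
  have hn₂ : Complex.normSq z₂ = 1 := by
    rw [Complex.normSq_apply, hz₂]; dsimp only; linarith
  have hne : z₁ ≠ z₂ := fun h => by
    have := congrArg Complex.re h
    simp only [hz₁, hz₂] at this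
    linarith
  have hF : ∀ g : E₂ (QuadRing n), wallFun 1 (toMatrix ι) z₁ z₂ g =
      2 * formA 1 (toMatrix ι g) + t * (formB 1 (toMatrix ι g)).re +
        2 * formC 1 (toMatrix ι g) := by
    intro g
    rw [wallFun, wallForm_eq_herm, wallForm_eq_herm, herm, herm, hn₁, hn₂]
    simp [hz₁, hz₂]
    ring
  -- The coefficients in terms of the coordinates of the entries.
  have hcoeff : ∀ g : E₂ (QuadRing n), ∃ a c x y : ℤ,
      a = ((g : GL (Fin 2) (QuadRing n)) 0 0).im * ((g : GL (Fin 2) (QuadRing n)) 1 0).re -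
        ((g : GL (Fin 2) (QuadRing n)) 0 0).re * ((g : GL (Fin 2) (QuadRing n)) 1 0).im ∧
      c = ((g : GL (Fin 2) (QuadRing n)) 0 1).im * ((g : GL (Fin 2) (QuadRing n)) 1 1).re -
        ((g : GL (Fin 2) (QuadRing n)) 0 1).re * ((g : GL (Fin 2) (QuadRing n)) 1 1).im ∧
      x = ((g : GL (Fin 2) (QuadRing n)) 0 1).im * ((g : GL (Fin 2) (QuadRing n)) 1 0).re -
        ((g : GL (Fin 2) (QuadRing n)) 0 0).re * ((g : GL (Fin 2) (QuadRing n)) 1 1).im ∧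
      y = ((g : GL (Fin 2) (QuadRing n)) 0 1).im * ((g : GL (Fin 2) (QuadRing n)) 1 0).im -
        ((g : GL (Fin 2) (QuadRing n)) 0 0).im * ((g : GL (Fin 2) (QuadRing n)) 1 1).im ∧
      formA 1 (toMatrix ι g) = t * a ∧ formC 1 (toMatrix ι g) = t * c ∧
      (formB 1 (toMatrix ι g)).re = 1 - (4 * n - 1) * y / 2 ∧
      (formB 1 (toMatrix ι g)).im = t * (2 * x + y) ∧
      a * c = x ^ 2 + x * y + n * y ^ 2 - y := by
    intro g
    have h₁ := det_re g
    have h₂ := det_im g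
    have h₁' := congrArg (Int.cast : ℤ → ℝ) h₁
    have h₂' := congrArg (Int.cast : ℤ → ℝ) h₂
    push_cast at h₁' h₂'
    refine ⟨_, _, _, _, rfl, rfl, rfl, rfl, ?_, ?_, ?_, ?_, ?_⟩
    · simp [formA, hι, quadEmb_re, quadEmb_im]
      ring
    · simp [formC, hι, quadEmb_re, quadEmb_im]
      ring
    · simp [formB, hι, quadEmb_re, quadEmb_im]
      linear_combination h₁' + h₂' / 2 +
        ((((g : GL (Fin 2) (QuadRing n)) 0 0).im : ℝ) * ((g : GL (Fin 2) (QuadRing n)) 1 1).im -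
          ((g : GL (Fin 2) (QuadRing n)) 0 1).im * ((g : GL (Fin 2) (QuadRing n)) 1 0).im) * htsq
    · simp [formB, hι, quadEmb_re, quadEmb_im]
      linear_combination t * h₂'
    -- This is the discriminant identity `|B|² = 4AC + 1` in integral coordinates, derived from the
    -- two components of the determinant equation.
    · linear_combination
        (((g : GL (Fin 2) (QuadRing n)) 0 1).im * ((g : GL (Fin 2) (QuadRing n)) 1 0).re -
          ((g : GL (Fin 2) (QuadRing n)) 0 0).re * ((g : GL (Fin 2) (QuadRing n)) 1 1).im) * h₂ -
        (((g : GL (Fin 2) (QuadRing n)) 0 1).im * ((g : GL (Fin 2) (QuadRing n)) 1 0).im -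
          ((g : GL (Fin 2) (QuadRing n)) 0 0).im * ((g : GL (Fin 2) (QuadRing n)) 1 1).im) * h₁
  have hwall : IsWall (wallFun 1 (toMatrix ι) z₁ z₂) t := by
    refine isWall_wallFun (by simp) hne (toMatrix_det ι) htpos ?_ ?_ ?_
    · rw [hF, map_one, formA_one, formB_one, formC_one]
      simp
    · intro g
      obtain ⟨a, c, x, y, -, -, -, -, ha, hc, hb, -, hrel⟩ := hcoeff g
      have h2 : (2 : ℝ) ≤ |4 * ((a : ℝ) + c) + 2 - (4 * n - 1) * y| := by
        exact_mod_cast two_le_abs_of_mul_eq hn hrel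
      rw [hF, ha, hc, hb, show 2 * (t * (a : ℝ)) + t * (1 - (4 * n - 1) * y / 2) + 2 * (t * c) =
        t / 2 * (4 * ((a : ℝ) + c) + 2 - (4 * n - 1) * y) by ring, abs_mul,
        abs_of_pos (half_pos htpos)]
      nlinarith
    · intro g
      obtain ⟨a, c, x, y, -, -, -, -, ha, hc, hb, -, hrel⟩ := hcoeff g
      rw [map_one, mul_one, hb]
      have hn2 : (2 : ℝ) ≤ n := by
        have : 2 ≤ n := by omega
        exact_mod_cast this
      -- The coefficient `1 - (4n - 1)y/2` is at least 1 for `y ≤ 0` and at most `-5/2` for `y ≥ 1`,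
      -- so its absolute value never drops below 1.
      rcases le_or_gt y 0 with hy | hy
      · have hy' : (y : ℝ) ≤ 0 := by exact_mod_cast hy
        exact ⟨1, Or.inl rfl, by nlinarith⟩
      · have hy' : (1 : ℝ) ≤ y := by exact_mod_cast hy
        exact ⟨-1, Or.inr rfl, by nlinarith⟩
  set u : E₂ (QuadRing n) := unip QuadraticAlgebra.omega with hu
  have huF : wallFun 1 (toMatrix ι) z₁ z₂ u⁻¹ = -t := by
    rw [hu, ← unip_neg, hF]
    simp [formA, formB, formC, coe_unip, hι, quadEmb_im]
    ring
  have hcoeff' : ∀ (g : E₂ (QuadRing n)) (ε : ℝ), (ε = 1 ∨ ε = -1) →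
      (∀ h, wallFun 1 (toMatrix ι) z₁ z₂ (g * h) = ε * wallFun 1 (toMatrix ι) z₁ z₂ h) →
      formA 1 (toMatrix ι g) = 0 ∧ formB 1 (toMatrix ι g) = ε * 1 ∧
        formC 1 (toMatrix ι g) = 0 := by
    intro g ε hε h
    refine wallFun_coeff_of_forall (by simp) hne (toMatrix_det ι) (fun g => ?_)
      ⟨1, by rw [hwall.one]; exact htpos⟩ ⟨u⁻¹, by rw [huF]; linarith⟩ hε h
    obtain ⟨a, c, x, y, -, -, -, -, ha, hc, hb, -, hrel⟩ := hcoeff g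
    rw [map_one, mul_one, hb]
    have hn2 : (2 : ℝ) ≤ n := by
      have : 2 ≤ n := by omega
      exact_mod_cast this
    rcases le_or_gt y 0 with hy | hy
    · have hy' : (y : ℝ) ≤ 0 := by exact_mod_cast hy
      exact ⟨1, Or.inl rfl, by nlinarith⟩
    · have hy' : (1 : ℝ) ≤ y := by exact_mod_cast hy
      exact ⟨-1, Or.inr rfl, by nlinarith⟩
  -- A flip would require `1 - (4n - 1)y/2 = -1`, that is `(4n - 1)y = 4`, impossible since `4n - 1`
  -- is 7 or 11.
  have hflip : ¬ ∃ g, ∀ h, wallFun 1 (toMatrix ι) z₁ z₂ (g * h) =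
      -wallFun 1 (toMatrix ι) z₁ z₂ h := by
    rintro ⟨g, hg⟩
    obtain ⟨-, hB, -⟩ := hcoeff' g (-1) (Or.inr rfl) fun h => by rw [hg, neg_one_mul]
    obtain ⟨a, c, x, y, -, -, -, -, ha, hc, hb, -, hrel⟩ := hcoeff g
    rw [hB] at hb
    simp at hb
    have : (4 * n - 1) * y = 4 := by
      have : ((4 * n - 1) * y : ℝ) = 4 := by linarith
      exact_mod_cast this
    rcases hn with rfl | rfl <;> omega
  have hreal : ∀ g : E₂ (QuadRing n), (∀ i j, ((g : GL (Fin 2) (QuadRing n)) i j).im = 0) →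
      g ∈ wallStab (wallFun 1 (toMatrix ι) z₁ z₂) := by
    intro g hg h
    have h00 : (toMatrix ι g 0 0).im = 0 := by simp [hι, quadEmb_im, hg]
    have h01 : (toMatrix ι g 0 1).im = 0 := by simp [hι, quadEmb_im, hg]
    have h10 : (toMatrix ι g 1 0).im = 0 := by simp [hι, quadEmb_im, hg]
    have h11 : (toMatrix ι g 1 1).im = 0 := by simp [hι, quadEmb_im, hg]
    have hdet := congrArg Complex.re (toMatrix_det ι g)
    rw [Complex.sub_re, Complex.mul_re, Complex.mul_re, h00, h01, Complex.one_re] at hdet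
    have key' : ∀ x y, wallForm 1 (toMatrix ι g) x y = (x * conj y).im := by
      intro x y
      simp only [wallForm, one_mul, Complex.mul_im, Complex.add_re, Complex.add_im,
        Complex.mul_re, Complex.conj_re, Complex.conj_im, h00, h01, h10, h11]
      linear_combination (x.im * y.re - x.re * y.im) * hdet
    simp only [wallFun, map_mul, wallForm_mul, key']
    simp only [wallForm, one_mul]
  -- Once `y = 0`, the integral parts of the entries form a matrix of determinant 1. The remaining
  -- equations are then homogeneous linear in the `ω`-coordinates and force these to vanish.
  have hstab : ∀ g ∈ wallStab (wallFun 1 (toMatrix ι) z₁ z₂),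
      ∀ i j, ((g : GL (Fin 2) (QuadRing n)) i j).im = 0 := by
    intro g hg
    obtain ⟨hA, hB, hC⟩ := hcoeff' g 1 (Or.inl rfl) fun h => by rw [hg, one_mul]
    obtain ⟨a, c, x, y, ha', hc', hx', hy', ha, hc, hb, hb', -⟩ := hcoeff g
    rw [hA] at ha
    rw [hC] at hc
    rw [hB] at hb hb'
    rw [mul_one, Complex.ofReal_re] at hb
    rw [mul_one, Complex.ofReal_im] at hb'
    have ha0 : a = 0 := by
      rcases mul_eq_zero.1 ha.symm with h | h
      · exact absurd h htpos.ne'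
      · exact_mod_cast h
    have hc0 : c = 0 := by
      rcases mul_eq_zero.1 hc.symm with h | h
      · exact absurd h htpos.ne'
      · exact_mod_cast h
    have hy0 : y = 0 := by
      have h : (4 * n - 1) * y = 0 := by
        have : ((4 * n - 1) * y : ℝ) = 0 := by linarith
        exact_mod_cast this
      exact (mul_eq_zero.1 h).resolve_left (by omega)
    have hx0 : x = 0 := by
      rcases mul_eq_zero.1 hb'.symm with h | h
      · exact absurd h htpos.ne'
      · rw [hy0, Int.cast_zero, add_zero] at h
        have : (x : ℝ) = 0 := by linarith
        exact_mod_cast this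
    subst ha0 hc0 hy0 hx0
    have h₁ := det_re g
    have h₂ := det_im g
    have key : ((g : GL (Fin 2) (QuadRing n)) 0 0).im = 0 ∧
        ((g : GL (Fin 2) (QuadRing n)) 0 1).im = 0 ∧
        ((g : GL (Fin 2) (QuadRing n)) 1 0).im = 0 ∧
        ((g : GL (Fin 2) (QuadRing n)) 1 1).im = 0 := by
      generalize ((g : GL (Fin 2) (QuadRing n)) 0 0) = p at *
      generalize ((g : GL (Fin 2) (QuadRing n)) 0 1) = q at *
      generalize ((g : GL (Fin 2) (QuadRing n)) 1 0) = r at *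
      generalize ((g : GL (Fin 2) (QuadRing n)) 1 1) = s at *
      have hdet : p.re * s.re - q.re * r.re = 1 := by linear_combination h₁ + n * hy'
      have hs : s.im = 0 := by
        linear_combination (-s.im) * hdet + s.re * hx' - r.re * hc'
      have hq : q.im = 0 := by
        linear_combination (-q.im) * hdet - p.re * hc' + q.re * hx'
      rw [hs, hq] at h₂
      have hp' : p.im = 0 := by
        linear_combination (-p.im) * hdet + p.re * h₂ + q.re * ha'
      have hr : r.im = 0 := by
        linear_combination (-r.im) * hdet + r.re * h₂ + s.re * ha'
      exact ⟨hp', hq, hr, hs⟩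
    intro i j
    fin_cases i <;> fin_cases j
    exacts [key.1, key.2.1, key.2.2.1, key.2.2.2]
  have hE : elE (QuadRing n) 0 ∈ wallStab (wallFun 1 (toMatrix ι) z₁ z₂) := by
    refine hreal _ fun i j => ?_
    fin_cases i <;> fin_cases j <;> simp [coe_elE, QuadraticAlgebra.im_one]
  have hT : ∀ a : ℤ, unip (a : QuadRing n) ∈ wallStab (wallFun 1 (toMatrix ι) z₁ z₂) := by
    refine fun a => hreal _ fun i j => ?_
    fin_cases i <;> fin_cases j <;>
      simp [coe_unip, QuadraticAlgebra.im_one, QuadraticAlgebra.im_intCast]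
  obtain ⟨k, hk, hku⟩ := hk
  have hkcomp : k ∈ wallComp (wallFun 1 (toMatrix ι) z₁ z₂) := by
    refine (Subgroup.closure_le _).2 ?_ hk
    rintro _ (rfl | rfl | rfl)
    · exact hwall.stab_le_comp hE
    · have := hT (-1)
      rw [Int.cast_neg, Int.cast_one] at this
      exact hwall.stab_le_comp this
    · exact hwall.conj_mem_comp huF hE
  have hcomap : ∀ g, g ∈ (conductorSubgroup n p).comap (MulAut.conj u⁻¹).toMonoidHom ↔
      u⁻¹ * g * u ∈ conductorSubgroup n p := by
    intro g
    rw [Subgroup.mem_comap, MulEquiv.coe_toMonoidHom, MulAut.conj_apply, inv_inv]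
  -- The conjugated conductor subgroup contains `u C u⁻¹` because the wall stabilizer `C` has
  -- entries in `ℤ`. It misses `E(0)`, since `u⁻¹ * E(0) * u` has upper left entry `ω`.
  refine hwall.isNontrivialAmalgam_of_translate huF hflip
    ((conductorSubgroup n p).comap (MulAut.conj u⁻¹).toMonoidHom) ?_ hkcomp ?_ ?_ ?_
  · intro c hc
    rw [hcomap]
    refine fun i j => ?_
    rw [show u⁻¹ * (u * c * u⁻¹) * u = c by group, hstab c hc]
    exact dvd_zero p
  · rw [hcomap]
    rwa [show u⁻¹ * (u * k) * u = k * u by group]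
  · intro hle
    have h := (hcomap _).1 (hle (hwall.stab_le_comp hE)) 0 0
    rw [hu, ← unip_neg] at h
    refine hp ?_
    simpa [coe_unip, coe_elE, Matrix.mul_apply, Fin.sum_univ_two] using h
  · intro L hL huL
    refine eq_top_of_unip_mem (hL (hwall.stab_le_comp hE)) fun x => ?_
    have e : x = (x.re : QuadRing n) + x.im • QuadraticAlgebra.omega := by
      ext <;> simp [QuadraticAlgebra.re_intCast, QuadraticAlgebra.im_intCast]
    rw [e, unip_add, unip_zsmul]
    exact mul_mem (hL (hwall.stab_le_comp (hT _))) (zpow_mem huL _)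

theorem isNontrivialAmalgam_quadRing_three : IsNontrivialAmalgam (E₂ (QuadRing 3)) := by
  refine isNontrivialAmalgam_quadRing (Or.inr rfl) 2 (by decide) ?_
  set S := elE (QuadRing 3) 0
  set b := unip QuadraticAlgebra.omega * S * (unip QuadraticAlgebra.omega)⁻¹ with hb
  have hS : S ∈ Subgroup.closure {S, unip (-1), b} := Subgroup.subset_closure (by simp)
  have hb' : b ∈ Subgroup.closure {S, unip (-1), b} := Subgroup.subset_closure (by simp)
  -- This word agrees modulo 2 with an integral matrix after right multiplication by `unip ω`. It is
  -- a finite check on four entries.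
  refine ⟨b * S * b * S, mul_mem (mul_mem (mul_mem hb' hS) hb') hS, ?_⟩
  rw [hb, ← unip_neg]
  intro i j
  simp only [Subgroup.coe_mul, Units.val_mul, coe_unip, S, coe_elE]
  revert i j
  decide

theorem isNontrivialAmalgam_quadRing_two : IsNontrivialAmalgam (E₂ (QuadRing 2)) := by
  refine isNontrivialAmalgam_quadRing (Or.inl rfl) 5 (by decide) ?_
  set S := elE (QuadRing 2) 0
  set b := unip QuadraticAlgebra.omega * S * (unip QuadraticAlgebra.omega)⁻¹ with hb
  have hS : S ∈ Subgroup.closure {S, unip (-1), b} := Subgroup.subset_closure (by simp)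
  have ht : unip (-1) ∈ Subgroup.closure {S, unip (-1), b} := Subgroup.subset_closure (by simp)
  have hb' : b ∈ Subgroup.closure {S, unip (-1), b} := Subgroup.subset_closure (by simp)
  -- The analogous word for the modulus 5, again verified entry by entry.
  refine ⟨b * unip (-1) * S * (b * S) * (b * S) * (b * unip (-1) * S),
    mul_mem (mul_mem (mul_mem (mul_mem (mul_mem hb' ht) hS) (mul_mem hb' hS)) (mul_mem hb' hS))
      (mul_mem (mul_mem hb' ht) hS), ?_⟩
  rw [hb, ← unip_neg]
  intro i j
  simp only [Subgroup.coe_mul, Units.val_mul, coe_unip, S, coe_elE]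
  revert i j
  decide

end QuadRing

/-! ### The Eisenstein integers -/

section Eisenstein

open QuadraticAlgebra (omega)

/-- The group `E₂` of the Eisenstein integers is generated by three elements of finite order whose
pairwise products have finite order, hence it is not a nontrivial amalgamated product. -/
theorem not_isNontrivialAmalgam_quadRing_one : ¬ IsNontrivialAmalgam (E₂ (QuadRing 1)) := by
  -- For a unit `v`, `E(v) E(v⁻¹) E(v) = diag(-v, -v⁻¹)`; here `ω⁻¹ = 1 - ω`. Conjugation by this
  -- diagonal matrix takes `unip (1 - ω)` to `unip ω`, and the product of these is `unip 1`, so all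
  -- translations are generated.
  set a : E₂ (QuadRing 1) := elE _ omega * elE _ (1 - omega) * elE _ omega with ha
  set b : E₂ (QuadRing 1) := a * unip (1 - omega) with hb
  set c : E₂ (QuadRing 1) := elE _ 0 with hc
  have hcoea : ((a : GL (Fin 2) (QuadRing 1)) : Matrix (Fin 2) (Fin 2) (QuadRing 1)) =
      !![-omega, 0; 0, omega - 1] := by
    simp only [ha, Subgroup.coe_mul, Units.val_mul, coe_elE]
    ext i j <;> revert i j <;> decide
  have hcoeb : ((b : GL (Fin 2) (QuadRing 1)) : Matrix (Fin 2) (Fin 2) (QuadRing 1)) =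
      !![-omega, -1; 0, omega - 1] := by
    simp only [hb, Subgroup.coe_mul, Units.val_mul, hcoea, coe_unip]
    ext i j <;> revert i j <;> decide
  have hfin : ∀ {g : E₂ (QuadRing 1)} (k : ℕ), 0 < k → g ^ k = 1 → IsOfFinOrder g :=
    fun k hk h => isOfFinOrder_iff_pow_eq_one.2 ⟨k, hk, h⟩
  refine not_isNontrivialAmalgam_of_isOfFinOrder (a := a) (b := b) (c := c) ?_
    (hfin 3 (by norm_num) ?_) (hfin 3 (by norm_num) ?_) (hfin 4 (by norm_num) ?_)
    (hfin 3 (by norm_num) ?_) (hfin 4 (by norm_num) ?_) (hfin 6 (by norm_num) ?_)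
  · set L := Subgroup.closure {a, b, c}
    have haL : a ∈ L := Subgroup.subset_closure (by simp)
    have hbL : b ∈ L := Subgroup.subset_closure (by simp)
    have hcL : c ∈ L := Subgroup.subset_closure (by simp)
    have h₁ : unip (1 - omega) ∈ L := by
      have := mul_mem (inv_mem haL) hbL
      rwa [hb, inv_mul_cancel_left] at this
    have h₂ : unip omega ∈ L := by
      have h : a * unip (1 - omega) = unip omega * a := by
        refine E₂_ext ?_
        simp only [Subgroup.coe_mul, Units.val_mul, hcoea, coe_unip]
        ext i j <;> revert i j <;> decide
      have := mul_mem (mul_mem haL h₁) (inv_mem haL)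
      rwa [h, mul_inv_cancel_right] at this
    have h₃ : unip 1 ∈ L := by
      have := mul_mem h₁ h₂
      rwa [← unip_add, sub_add_cancel] at this
    refine eq_top_of_unip_mem hcL fun x => ?_
    have e : x = x.re • (1 : QuadRing 1) + x.im • omega := by
      ext
      · simp
      · simp
    rw [e, unip_add, unip_zsmul, unip_zsmul]
    exact mul_mem (zpow_mem h₃ _) (zpow_mem h₂ _)
  all_goals
    refine E₂_ext ?_
    simp only [pow_succ, pow_zero, one_mul, Subgroup.coe_mul, Units.val_mul, hcoea, hcoeb, hc,
      coe_elE, Subgroup.coe_one, Units.val_one]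
    ext i j <;> revert i j <;> decide

end Eisenstein

/-! ### Functoriality of `E₂` -/

section Functoriality

variable {R S : Type*} [CommRing R] [CommRing S]

theorem E₂_le_comap (f : R →+* S) : E₂ R ≤ (E₂ S).comap (Matrix.GeneralLinearGroup.map f) := by
  refine (Subgroup.closure_le _).2 ?_
  rintro _ ⟨x, rfl⟩
  exact Subgroup.subset_closure ⟨f x, (map_elemE f x).symm⟩

/-- The homomorphism `E₂(R) → E₂(S)` that applies a ring homomorphism entrywise. -/
def mapE₂ (f : R →+* S) : E₂ R →* E₂ S :=
  ((Matrix.GeneralLinearGroup.map f).comp (E₂ R).subtype).codRestrict (E₂ S)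
    fun g => E₂_le_comap f g.2

@[simp]
theorem mapE₂_apply (f : R →+* S) (g : E₂ R) (i j : Fin 2) :
    (mapE₂ f g : GL (Fin 2) S) i j = f ((g : GL (Fin 2) R) i j) :=
  rfl

theorem mapE₂_injective {f : R →+* S} (hf : Function.Injective f) :
    Function.Injective (mapE₂ f) := by
  intro g h hgh
  refine E₂_ext ?_
  ext i j
  refine hf ?_
  rw [← mapE₂_apply, ← mapE₂_apply, hgh]

/-- Isomorphic rings have isomorphic groups `E₂`. -/
def E₂Congr (e : R ≃+* S) : E₂ R ≃* E₂ S :=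
  MonoidHom.toMulEquiv (mapE₂ (e : R →+* S)) (mapE₂ (e.symm : S →+* R))
    (MonoidHom.ext fun g => E₂_ext (by ext i j; exact e.symm_apply_apply _))
    (MonoidHom.ext fun g => E₂_ext (by ext i j; exact e.apply_symm_apply _))

end Functoriality

theorem IsNontrivialAmalgam.of_mulEquiv.{u} {G G' : Type u} [Group G] [Group G'] (e : G ≃* G')
    (h : IsNontrivialAmalgam G') : IsNontrivialAmalgam G := by
  obtain ⟨H, G₁, G₂, _, _, _, f₁, f₂, h₁, h₂, h₃, h₄, ⟨e'⟩⟩ := h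
  exact ⟨H, G₁, G₂, _, _, _, f₁, f₂, h₁, h₂, h₃, h₄, ⟨e.trans e'⟩⟩

/-! ### Rings without short non-integral elements -/

section PingPong

open ComplexConjugate

/-- The vectors whose quotient has distance less than one from some integer. -/
def NearInt (v w : ℂ) : Prop := ∃ n : ℤ, ‖v - n * w‖ < ‖w‖

/-- The vectors whose quotient has distance greater than one from all integers. -/
def FarInt (v w : ℂ) : Prop := ∀ n : ℤ, ‖w‖ < ‖v - n * w‖

theorem normSq_int_comb (r s : ℤ) (v w : ℂ) : Complex.normSq (r * v + s * w) =
    r ^ 2 * Complex.normSq v + 2 * (r * s) * (v * conj w).re + s ^ 2 * Complex.normSq w := by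
  simp [Complex.normSq_apply]
  ring

theorem exists_int_two_mul_abs_re_le (v w : ℂ) :
    ∃ n : ℤ, 2 * |((v - n * w) * conj w).re| ≤ Complex.normSq w := by
  rcases eq_or_ne w 0 with rfl | hw
  · exact ⟨0, by simp⟩
  have hpos : 0 < Complex.normSq w := Complex.normSq_pos.2 hw
  refine ⟨round ((v * conj w).re / Complex.normSq w), ?_⟩
  have h := abs_sub_round ((v * conj w).re / Complex.normSq w)
  set n := round ((v * conj w).re / Complex.normSq w)
  have e : ((v - n * w) * conj w).re =
      ((v * conj w).re / Complex.normSq w - n) * Complex.normSq w := by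
    rw [sub_mul, sub_mul (_ / _), div_mul_cancel₀ _ hpos.ne', mul_assoc, Complex.mul_conj]
    simp
  rw [e, abs_mul, abs_of_pos hpos]
  nlinarith

theorem one_le_sq_sub_abs_mul_add_sq {r : ℤ} (hr : r ≠ 0) (s : ℤ) :
    1 ≤ r ^ 2 - |r * s| + s ^ 2 := by
  have h1 : 1 ≤ r ^ 2 := by have := sq_pos_of_ne_zero hr; omega
  rcases le_total 0 (r * s) with h | h
  · rw [abs_of_nonneg h]
    nlinarith [sq_nonneg (r - 2 * s), sq_nonneg (2 * r - s)]
  · rw [abs_of_nonpos h]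
    nlinarith [sq_nonneg (r + 2 * s), sq_nonneg (2 * r + s)]

/-- A lower bound for `|rv + sw|` obtained by reducing the real part of `v / w`. -/
theorem normSq_le_normSq_int_comb (v w : ℂ) {r : ℤ} (hr : r ≠ 0) (s : ℤ) :
    ∃ n : ℤ, r ^ 2 * (Complex.normSq (v - n * w) - Complex.normSq w) + Complex.normSq w ≤
      Complex.normSq (r * v + s * w) := by
  obtain ⟨n, hn⟩ := exists_int_two_mul_abs_re_le v w
  refine ⟨n, ?_⟩
  -- With `v - nw` reduced against `w`, the mixed term costs at most `|r(s + rn)| |w|²`. The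
  -- integral form `r² - |rs'| + s'²`, at least 1 for `r ≠ 0`, then pays for it.
  have e : (r * v + s * w : ℂ) = r * (v - n * w) + ((s + r * n : ℤ) : ℂ) * w := by
    push_cast
    ring
  rw [e, normSq_int_comb]
  set x := ((v - n * w) * conj w).re
  set N := Complex.normSq w
  have hN : 0 ≤ N := Complex.normSq_nonneg w
  have h1 : (1 : ℝ) ≤ r ^ 2 - |(r : ℝ) * (s + r * n : ℤ)| + (s + r * n : ℤ) ^ 2 := by
    exact_mod_cast one_le_sq_sub_abs_mul_add_sq hr (s + r * n)
  set t : ℝ := ((s + r * n : ℤ) : ℝ)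
  have h2 : -(|(r : ℝ) * t| * N) ≤ 2 * (r * t) * x := by
    have := neg_abs_le (2 * (r * t) * x)
    rw [abs_mul, abs_mul, abs_two] at this
    nlinarith [abs_nonneg ((r : ℝ) * t)]
  nlinarith

theorem FarInt.norm_lt {v w : ℂ} (h : FarInt v w) {r : ℤ} (hr : r ≠ 0) (s : ℤ) :
    ‖w‖ < ‖r * v + s * w‖ := by
  have h' : ∀ n : ℤ, Complex.normSq w < Complex.normSq (v - n * w) := fun n => by
    rw [Complex.normSq_eq_norm_sq, Complex.normSq_eq_norm_sq]
    exact pow_lt_pow_left₀ (h n) (norm_nonneg _) two_ne_zero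
  obtain ⟨n, hn⟩ := normSq_le_normSq_int_comb v w hr s
  have hr' : (0 : ℝ) < r ^ 2 := by positivity
  have : Complex.normSq w < Complex.normSq (r * v + s * w) := by
    nlinarith [mul_pos hr' (sub_pos.2 (h' n))]
  rw [Complex.normSq_eq_norm_sq, Complex.normSq_eq_norm_sq] at this
  exact lt_of_pow_lt_pow_left₀ 2 (norm_nonneg _) this

theorem norm_le_of_not_nearInt {v w : ℂ} (h : ¬ NearInt v w) {r : ℤ} (hr : r ≠ 0) (s : ℤ) :
    ‖w‖ ≤ ‖r * v + s * w‖ := by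
  have h' : ∀ n : ℤ, Complex.normSq w ≤ Complex.normSq (v - n * w) := fun n => by
    rw [Complex.normSq_eq_norm_sq, Complex.normSq_eq_norm_sq]
    exact pow_le_pow_left₀ (norm_nonneg _) (not_lt.1 fun hlt => h ⟨n, hlt⟩) 2
  obtain ⟨n, hn⟩ := normSq_le_normSq_int_comb v w hr s
  have hr' : (0 : ℝ) ≤ r ^ 2 := by positivity
  have : Complex.normSq w ≤ Complex.normSq (r * v + s * w) := by
    nlinarith [mul_nonneg hr' (sub_nonneg.2 (h' n))]
  rw [Complex.normSq_eq_norm_sq, Complex.normSq_eq_norm_sq] at this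
  exact le_of_sq_le_sq this (norm_nonneg _)

/-- Farness gives `|w| < |rv + sw|`. If the image were not near, the same estimate for the inverse
matrix, whose lower row `(-r, p)` recovers `w`, would give `|rv + sw| ≤ |w|`. -/
theorem FarInt.nearInt {v w : ℂ} (h : FarInt v w) {p q r s : ℤ} (hdet : p * s - q * r = 1)
    (hr : r ≠ 0) : NearInt (p * v + q * w) (r * v + s * w) := by
  by_contra hn
  have h₁ := h.norm_lt hr s
  have h₂ := norm_le_of_not_nearInt hn (neg_ne_zero.2 hr) p
  have hdet' : (p * s - q * r : ℂ) = 1 := by exact_mod_cast hdet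
  have e : ((-r : ℤ) : ℂ) * (p * v + q * w) + p * (r * v + s * w) = w := by
    push_cast
    linear_combination w * hdet'
  rw [e] at h₂
  exact absurd h₂ (not_le.2 h₁)

theorem NearInt.ne_zero {v w : ℂ} (h : NearInt v w) : w ≠ 0 := by
  rintro rfl
  obtain ⟨n, hn⟩ := h
  rw [norm_zero] at hn
  exact absurd hn (not_lt.2 (norm_nonneg _))

theorem farInt_one_zero : FarInt 1 0 := fun n => by simp

theorem FarInt.neg {v w : ℂ} (h : FarInt v w) : FarInt (-v) (-w) := fun n => by
  rw [norm_neg, mul_neg, ← neg_sub', norm_neg]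
  exact h n

/-- Triangle inequality: the translation is by at least 2 relative to every integer, and less than 1
is lost. This is where the bound 2 comes from. -/
theorem NearInt.farInt {v w x : ℂ} (h : NearInt v w) (hx : ∀ n : ℤ, 2 ≤ ‖x + n‖) :
    FarInt (v + x * w) w := by
  obtain ⟨k, hk⟩ := h
  intro n
  have h₁ : 2 * ‖w‖ ≤ ‖(x + (k - n : ℤ)) * w‖ := by
    rw [norm_mul]
    exact mul_le_mul_of_nonneg_right (hx _) (norm_nonneg _)
  have h₂ := norm_sub_le (v + x * w - n * w) (v - k * w)
  have e : v + x * w - n * w - (v - k * w) = (x + (k - n : ℤ)) * w := by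
    push_cast
    ring
  rw [e] at h₂
  linarith

variable {R : Type} [CommRing R]

/-! ### Triangular matrices and the ping-pong decomposition. -/

theorem borelToE₂_injective : Function.Injective (borelToE₂ R) :=
  Subgroup.inclusion_injective _

theorem borelMap_injective {S : Type*} [CommRing S] {f : R →+* S} (hf : Function.Injective f) :
    Function.Injective (borelMap f) := by
  intro g h hgh
  refine borelToE₂_injective (mapE₂_injective hf ?_)
  exact congrArg (borelToE₂ S) hgh

theorem mem_range_borelToE₂ {g : E₂ R} :
    g ∈ (borelToE₂ R).range ↔ (g : GL (Fin 2) R) 1 0 = 0 := by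
  constructor
  · rintro ⟨x, rfl⟩
    exact x.2.2
  · intro h
    exact ⟨⟨g, g.2, h⟩, rfl⟩

theorem not_surjective_borelToE₂ [Nontrivial R] : ¬ Function.Surjective (borelToE₂ R) := by
  intro h
  have := mem_range_borelToE₂.1 (MonoidHom.range_eq_top.2 h ▸ Subgroup.mem_top (elE R 0))
  simp [coe_elE] at this

/-- The element `(1, x; 0, 1)` of `B₂'(R)`. -/
def borelUnip (x : R) : B₂' R := ⟨unip x, (unip x).2, by
  change ((unip x : GL (Fin 2) R) : Matrix (Fin 2) (Fin 2) R) 1 0 = 0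
  simp [coe_unip]⟩

theorem not_surjective_borelMap (h : ∃ x : R, ∀ n : ℤ, x ≠ n) :
    ¬ Function.Surjective (borelMap (Int.castRingHom R)) := by
  obtain ⟨x, hx⟩ := h
  intro hs
  obtain ⟨g, hg⟩ := hs (borelUnip x)
  have h₁ : (Int.castRingHom R) ((g : GL (Fin 2) ℤ) 0 1) =
      ((unip x : GL (Fin 2) R) : Matrix (Fin 2) (Fin 2) R) 0 1 :=
    congrArg (fun b : B₂' R => (b : GL (Fin 2) R) 0 1) hg
  rw [coe_unip] at h₁
  exact hx _ h₁.symm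

theorem elE_zero_mul_self : (((elE R 0 * elE R 0 : E₂ R) : GL (Fin 2) R) :
    Matrix (Fin 2) (Fin 2) R) = !![-1, 0; 0, -1] := by
  simp [coe_elE]

/-- The image of `B₂'(ℤ)` consists of the triangular matrices over `ℤ`. -/
theorem mem_range_borelMap {b : B₂' R} {ε x : ℤ} (hε : ε = 1 ∨ ε = -1)
    (hb : ((b : GL (Fin 2) R) : Matrix (Fin 2) (Fin 2) R) = !![(ε : R), (x : R); 0, (ε : R)]) :
    b ∈ (borelMap (Int.castRingHom R)).range := by
  have h : ∃ g : B₂' ℤ, ((g : GL (Fin 2) ℤ) : Matrix (Fin 2) (Fin 2) ℤ) = !![ε, x; 0, ε] := by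
    rcases hε with rfl | rfl
    · exact ⟨borelUnip x, coe_unip x⟩
    · have h0 : (((elE ℤ 0 * elE ℤ 0 * unip (-x) : E₂ ℤ) : GL (Fin 2) ℤ) :
          Matrix (Fin 2) (Fin 2) ℤ) = !![-1, x; 0, -1] := by
        rw [Subgroup.coe_mul, Units.val_mul, elE_zero_mul_self, coe_unip, Matrix.mul_fin_two]
        simp
      refine ⟨⟨_, (elE ℤ 0 * elE ℤ 0 * unip (-x)).2, ?_⟩, h0⟩
      change (((elE ℤ 0 * elE ℤ 0 * unip (-x) : E₂ ℤ) : GL (Fin 2) ℤ) :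
          Matrix (Fin 2) (Fin 2) ℤ) 1 0 = 0
      rw [h0]
      rfl
  obtain ⟨g, hg⟩ := h
  refine ⟨g, Subtype.ext (Units.ext ?_)⟩
  rw [hb]
  ext i j
  change (Int.castRingHom R) (((g : GL (Fin 2) ℤ) : Matrix (Fin 2) (Fin 2) ℤ) i j) = _
  rw [hg]
  fin_cases i <;> fin_cases j <;> simp

/-- Diagonal entries are units. A unit of absolute value at least 2 would need an inverse of
absolute value at most `1/2`, but nonzero elements have absolute value at least 1. Hence the units
are `±1`. -/
theorem exists_int_of_mem_borel (ι : R →+* ℂ)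
    (hR : ∀ x : R, (∃ n : ℤ, x = n) ∨ 2 ≤ ‖ι x‖) {b : B₂' R} :
    ∃ ε : ℤ, (ε = 1 ∨ ε = -1) ∧ ((b : GL (Fin 2) R) : Matrix (Fin 2) (Fin 2) R) =
      !![(ε : R), (b : GL (Fin 2) R) 0 1; 0, (ε : R)] := by
  have h0 : (b : GL (Fin 2) R) 1 0 = 0 := b.2.2
  have hdet := det_of_mem_E₂ b.2.1
  rw [h0, mul_zero, sub_zero] at hdet
  have hint : ∀ x y : R, x * y = 1 → ∃ n : ℤ, x = n := by
    intro x y hxy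
    rcases hR x with h | h
    · exact h
    have hn : ‖ι x‖ * ‖ι y‖ = 1 := by rw [← norm_mul, ← map_mul, hxy, map_one, norm_one]
    rcases hR y with ⟨m, rfl⟩ | h'
    · rw [map_intCast, Complex.norm_intCast] at hn
      have hm : m ≠ 0 := by
        rintro rfl
        simp at hn
      have : (1 : ℝ) ≤ |(m : ℝ)| := by exact_mod_cast Int.one_le_abs hm
      nlinarith
    · nlinarith
  obtain ⟨m, hm⟩ := hint _ _ hdet
  obtain ⟨k, hk⟩ := hint _ _ ((mul_comm _ _).trans hdet)
  have hmk : m * k = 1 := by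
    rw [hm, hk] at hdet
    have := congrArg ι hdet
    rw [map_mul, map_intCast, map_intCast, map_one] at this
    exact_mod_cast this
  have hkm : k = m ∧ (m = 1 ∨ m = -1) := by
    rcases Int.mul_eq_one_iff_eq_one_or_neg_one.1 hmk with ⟨rfl, rfl⟩ | ⟨rfl, rfl⟩ <;> simp
  refine ⟨m, hkm.2, ?_⟩
  rw [hkm.1] at hk
  ext i j
  fin_cases i <;> fin_cases j
  exacts [hm, rfl, h0, hk]

/-- The amalgamated product decomposition of `E₂(R)` for a ring `R` of complex numbers all of
whose non-integral elements have absolute value at least two, by the ping-pong lemma. -/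
theorem nonempty_mulEquiv_amalgam_of_two_le_norm (ι : R →+* ℂ)
    (hR : ∀ x : R, (∃ n : ℤ, x = n) ∨ 2 ≤ ‖ι x‖) :
    Nonempty (E₂ R ≃* Amalgam (borelToE₂ ℤ) (borelMap (Int.castRingHom R))) := by
  have hcast : Function.Injective (Int.castRingHom R) := by
    intro m n hmn
    have := congrArg ι hmn
    simpa using this
  refine nonempty_mulEquiv_amalgam (j₁ := mapE₂ (Int.castRingHom R)) (j₂ := borelToE₂ R)
    ((mapE₂_injective hcast).comp borelToE₂_injective) (fun x => rfl) ?_ ?_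
  · refine eq_top_of_unip_mem (Subgroup.mem_sup_left ⟨elE ℤ 0, E₂_ext ?_⟩) fun x =>
      Subgroup.mem_sup_right ⟨borelUnip x, rfl⟩
    ext i j
    rw [mapE₂_apply, coe_elE, coe_elE]
    fin_cases i <;> fin_cases j <;> simp
  have hfalse : ∀ g ∈ imageLetters (borelToE₂ ℤ) (borelMap (Int.castRingHom R))
      (mapE₂ (Int.castRingHom R)) (borelToE₂ R) false, ∃ (ε : ℤ) (x : R), (ε = 1 ∨ ε = -1) ∧
        ((g : GL (Fin 2) R) : Matrix (Fin 2) (Fin 2) R) = !![(ε : R), x; 0, (ε : R)] ∧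
        ∀ n : ℤ, 2 ≤ ‖ι x + n‖ := by
    rintro _ ⟨b, hb, rfl⟩
    obtain ⟨ε, hε, h⟩ := exists_int_of_mem_borel ι hR (b := b)
    refine ⟨ε, _, hε, h, fun n => ?_⟩
    -- The bound is applied to every integral translate of the upper right entry: none of them is an
    -- integer, since otherwise `b` would come from `ℤ`.
    rcases hR ((b : GL (Fin 2) R) 0 1 + n) with ⟨m, hm⟩ | h2
    · refine absurd ?_ hb
      refine mem_range_borelMap hε (x := m - n) ?_
      rw [Int.cast_sub, ← hm, add_sub_cancel_right]
      exact h
    · rwa [map_add, map_intCast] at h2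
  have htrue : ∀ g ∈ imageLetters (borelToE₂ ℤ) (borelMap (Int.castRingHom R))
      (mapE₂ (Int.castRingHom R)) (borelToE₂ R) true, ∀ v w : ℂ, FarInt v w →
        NearInt (ι ((g : GL (Fin 2) R) 0 0) * v + ι ((g : GL (Fin 2) R) 0 1) * w)
          (ι ((g : GL (Fin 2) R) 1 0) * v + ι ((g : GL (Fin 2) R) 1 1) * w) := by
    rintro _ ⟨a, ha, rfl⟩ v w hvw
    simp only [mapE₂_apply, eq_intCast, map_intCast]
    exact hvw.nearInt (det_of_mem_E₂ a.2) fun h => ha (mem_range_borelToE₂.2 h)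
  -- The first column is the image of `∞`, which is itself a far point. A single triangular letter
  -- fixes `∞` and cannot be told apart from `1` this way, hence the extra disjunct.
  have key : ∀ i j n g, AltProd (imageLetters (borelToE₂ ℤ) (borelMap (Int.castRingHom R))
      (mapE₂ (Int.castRingHom R)) (borelToE₂ R)) i j n g →
      (i = true → NearInt (ι ((g : GL (Fin 2) R) 0 0)) (ι ((g : GL (Fin 2) R) 1 0))) ∧
      (i = false → FarInt (ι ((g : GL (Fin 2) R) 0 0)) (ι ((g : GL (Fin 2) R) 1 0)) ∧
        ((g : GL (Fin 2) R) 1 0 ≠ 0 ∨ g ∈ imageLetters (borelToE₂ ℤ)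
          (borelMap (Int.castRingHom R)) (mapE₂ (Int.castRingHom R)) (borelToE₂ R) false)) := by
    intro i j n g hg
    induction hg with
    | @single i a ha =>
      refine ⟨?_, ?_⟩
      · rintro rfl
        simpa using htrue a ha 1 0 farInt_one_zero
      · rintro rfl
        refine ⟨?_, Or.inr ha⟩
        obtain ⟨ε, x, hε, h, -⟩ := hfalse a ha
        rw [h]
        rcases hε with rfl | rfl
        · simpa using farInt_one_zero
        · simpa using farInt_one_zero.neg
    | @cons i j n a g ha hg ih =>
      have e0 : ((a * g : E₂ R) : GL (Fin 2) R) 0 0 = (a : GL (Fin 2) R) 0 0 *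
          (g : GL (Fin 2) R) 0 0 + (a : GL (Fin 2) R) 0 1 * (g : GL (Fin 2) R) 1 0 := by
        simp [Matrix.mul_apply, Fin.sum_univ_two]
      have e1 : ((a * g : E₂ R) : GL (Fin 2) R) 1 0 = (a : GL (Fin 2) R) 1 0 *
          (g : GL (Fin 2) R) 0 0 + (a : GL (Fin 2) R) 1 1 * (g : GL (Fin 2) R) 1 0 := by
        simp [Matrix.mul_apply, Fin.sum_univ_two]
      rw [e0, e1]
      refine ⟨?_, ?_⟩
      · rintro rfl
        simp only [map_add, map_mul]
        exact htrue a ha _ _ (ih.2 rfl).1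
      · rintro rfl
        obtain ⟨ε, x, hε, h, hx⟩ := hfalse a ha
        have hn := ih.1 rfl
        have hf : FarInt (ι ((g : GL (Fin 2) R) 0 0) +
            (ε * ι x) * ι ((g : GL (Fin 2) R) 1 0)) (ι ((g : GL (Fin 2) R) 1 0)) := by
          refine hn.farInt fun n => ?_
          rcases hε with rfl | rfl
          · simpa using hx n
          · have := hx (-n)
            rw [← norm_neg] at this
            refine this.trans_eq (congrArg _ ?_)
            push_cast
            ring
        have hg0 : (g : GL (Fin 2) R) 1 0 ≠ 0 := fun h0 => hn.ne_zero (by rw [h0, map_zero])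
        rw [h]
        rcases hε with rfl | rfl
        · simp only [Matrix.of_apply, Matrix.cons_val', Matrix.cons_val_zero, Matrix.cons_val_one,
            Int.cast_one, one_mul, zero_mul, zero_add]
          simp only [Int.cast_one, one_mul] at hf
          refine ⟨by simpa using hf, Or.inl (by simpa using hg0)⟩
        · refine ⟨?_, Or.inl (by simpa using hg0)⟩
          have := hf.neg
          simpa [add_comm] using this
  intro i j n h
  obtain ⟨h₁, h₂⟩ := key i j n 1 h
  cases i with
  | true => exact (h₁ rfl).ne_zero (by simp)
  | false =>
    rcases (h₂ rfl).2 with h | ⟨b, hb, hb1⟩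
    · exact h (by simp)
    · refine hb ?_
      have : b = 1 := borelToE₂_injective (hb1.trans (map_one _).symm)
      rw [this]
      exact one_mem _

end PingPong

/-! ### Integral elements of `ℚ(√-d)` -/

section Orders

variable {d : ℕ}

theorem coe_sqrtNeg : ((sqrtNeg d : QuadField d) : ℂ) = Complex.I * (Real.sqrt d : ℂ) := rfl

theorem I_mul_sqrt_sq : Complex.I * (Real.sqrt d : ℂ) * (Complex.I * (Real.sqrt d : ℂ)) = -d := by
  have : (Real.sqrt d : ℂ) * (Real.sqrt d : ℂ) = d := by
    rw [← Complex.ofReal_mul, Real.mul_self_sqrt (Nat.cast_nonneg d), Complex.ofReal_natCast]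
  linear_combination Complex.I * Complex.I * this + (d : ℂ) * Complex.I_mul_I

theorem sqrtNeg_mul_self : sqrtNeg d * sqrtNeg d = -(d : QuadField d) :=
  Subtype.ext (by simpa [coe_sqrtNeg] using I_mul_sqrt_sq)

theorem exists_rat_coords (x : QuadField d) :
    ∃ a b : ℚ, (x : ℂ) = a + b * (Complex.I * (Real.sqrt d : ℂ)) := by
  have halg : IsAlgebraic ℚ (Complex.I * (Real.sqrt d : ℂ)) := by
    refine ⟨Polynomial.X ^ 2 + Polynomial.C (d : ℚ),
      (Polynomial.monic_X_pow_add_C _ two_ne_zero).ne_zero, ?_⟩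
    simp [pow_two, I_mul_sqrt_sq]
  have hx : (x : ℂ) ∈ Algebra.adjoin ℚ {Complex.I * (Real.sqrt d : ℂ)} := by
    rw [← IntermediateField.adjoin_simple_toSubalgebra_of_isAlgebraic halg]
    exact x.2
  generalize (x : ℂ) = z at hx
  induction hx using Algebra.adjoin_induction with
  | mem y hy => exact ⟨0, 1, by simp [Set.mem_singleton_iff.1 hy]⟩
  | algebraMap r => exact ⟨r, 0, by simp⟩
  | add y z _ _ hy hz =>
    obtain ⟨a, b, hy⟩ := hy
    obtain ⟨a', b', hz⟩ := hz
    refine ⟨a + a', b + b', ?_⟩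
    rw [hy, hz]
    push_cast
    ring
  | mul y z _ _ hy hz =>
    obtain ⟨a, b, hy⟩ := hy
    obtain ⟨a', b', hz⟩ := hz
    refine ⟨a * a' - d * (b * b'), a * b' + b * a', ?_⟩
    rw [hy, hz]
    push_cast
    linear_combination (b * b' : ℂ) * I_mul_sqrt_sq (d := d)

theorem exists_int_of_isIntegral_ratCast {q : ℚ} (h : IsIntegral ℤ (q : ℂ)) : ∃ n : ℤ, q = n := by
  have h' : IsIntegral ℤ (algebraMap ℚ ℂ q) := h
  rw [isIntegral_algebraMap_iff (algebraMap ℚ ℂ).injective, IsIntegrallyClosed.isIntegral_iff] at h'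
  obtain ⟨n, hn⟩ := h'
  exact ⟨n, by simpa using hn.symm⟩

/-- The square of the denominator of `q` is coprime to the square of its numerator, so it divides
`d`. -/
theorem exists_int_of_squarefree_mul_sq {q : ℚ} (hd : Squarefree d) {n : ℤ}
    (h : d * q ^ 2 = n) : ∃ c : ℤ, q = c := by
  have hden : (q.den : ℚ) ≠ 0 := by exact_mod_cast q.den_nz
  have h₁ : (d : ℤ) * q.num ^ 2 = n * q.den ^ 2 := by
    rw [← Rat.num_div_den q, div_pow] at h
    field_simp at h
    rw [mul_comm n]
    exact_mod_cast h
  have h₂ : ((q.den : ℤ) * q.den) ∣ d := by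
    have hc : IsCoprime ((q.den : ℤ) ^ 2) (q.num ^ 2) := by
      refine IsCoprime.pow ?_
      rw [Int.isCoprime_iff_gcd_eq_one]
      exact (Nat.Coprime.symm q.reduced)
    rw [← pow_two]
    exact hc.dvd_of_dvd_mul_right ⟨n, by rw [h₁, mul_comm]⟩
  have h₃ : q.den = 1 := Nat.isUnit_iff.1 (hd _ (by exact_mod_cast h₂))
  exact ⟨q.num, (Rat.den_eq_one_iff q).1 h₃ |>.symm⟩

open ComplexConjugate in
/-- Integral elements have the form `(t + c√-d) / 2`. -/
theorem exists_int_coords (hd : d = 0 ∨ Squarefree d) {x : QuadField d} (hx : IsIntegral ℤ x) :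
    ∃ t c m : ℤ, 2 * x = t + c * sqrtNeg d ∧ t ^ 2 + d * c ^ 2 = 4 * m ∧ ‖(x : ℂ)‖ ^ 2 = m := by
  obtain ⟨a, b, hab⟩ := exists_rat_coords x
  have hz : IsIntegral ℤ (x : ℂ) := hx.map (QuadField d).val
  have hz' : IsIntegral ℤ (conj (x : ℂ)) := hz.map (RingHom.toIntAlgHom (starRingEnd ℂ))
  have hconj : conj (x : ℂ) = a - b * (Complex.I * (Real.sqrt d : ℂ)) := by
    rw [hab]
    simp [sub_eq_add_neg]
  -- The trace `2a` and the norm `a² + db²` are rational and integral, hence integers.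
  obtain ⟨t, ht⟩ := exists_int_of_isIntegral_ratCast (q := 2 * a) (by
    have e : ((2 * a : ℚ) : ℂ) = x + conj (x : ℂ) := by
      rw [hconj, hab]
      push_cast
      ring
    rw [e]
    exact hz.add hz')
  have hmul : (x : ℂ) * conj (x : ℂ) = ((a ^ 2 + d * b ^ 2 : ℚ) : ℂ) := by
    rw [hconj, hab]
    push_cast
    linear_combination (-(b : ℂ) ^ 2) * I_mul_sqrt_sq (d := d)
  obtain ⟨m, hm⟩ := exists_int_of_isIntegral_ratCast (q := a ^ 2 + d * b ^ 2) (by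
    rw [← hmul]
    exact hz.mul hz')
  have hnorm : ‖(x : ℂ)‖ ^ 2 = m := by
    rw [Complex.mul_conj, hm, Complex.normSq_eq_norm_sq] at hmul
    exact_mod_cast hmul
  have hc : ∃ c : ℤ, d * c ^ 2 = d * (2 * b) ^ 2 ∧
      (c : ℂ) * (Complex.I * (Real.sqrt d : ℂ)) = 2 * b * (Complex.I * (Real.sqrt d : ℂ)) := by
    rcases hd with rfl | hd
    -- For `d = 0` the coefficient of `√-d = 0` is arbitrary, and 0 is chosen.
    · exact ⟨0, by simp⟩
    · obtain ⟨c, hc⟩ := exists_int_of_squarefree_mul_sq (q := 2 * b) hd (n := 4 * m - t ^ 2) (by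
        push_cast
        rw [← hm, ← ht]
        ring)
      refine ⟨c, by rw [hc], ?_⟩
      have : ((2 * b : ℚ) : ℂ) = ((c : ℚ) : ℂ) := by rw [hc]
      push_cast at this
      rw [this]
  obtain ⟨c, hc, hc'⟩ := hc
  refine ⟨t, c, m, Subtype.ext ?_, ?_, hnorm⟩
  · have h : ((2 * a : ℚ) : ℂ) = ((t : ℚ) : ℂ) := by rw [ht]
    push_cast at h
    change (2 : ℂ) * (x : ℂ) = t + c * (Complex.I * (Real.sqrt d : ℂ))
    rw [hab, hc']
    linear_combination h
  · have : (t : ℚ) ^ 2 + d * c ^ 2 = 4 * m := by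
      rw [hc, ← ht, ← hm]
      ring
    exact_mod_cast this

theorem isIntegral_of_mem {O : Subring (QuadField d)} (hO : IsZOrder O) {x : QuadField d}
    (hx : x ∈ O) : IsIntegral ℤ x := by
  have := hO.1
  exact (IsIntegral.of_finite ℤ (⟨x, hx⟩ : O)).map O.subtype.toIntAlgHom

theorem le_maxOrder {O : Subring (QuadField d)} (hO : IsZOrder O) : O ≤ maxOrder d :=
  fun _ hx => isIntegral_of_mem hO hx

theorem even_of_sq_add {t c m : ℤ} (hd : d = 1 ∨ d = 2) (h : t ^ 2 + d * c ^ 2 = 4 * m) :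
    (∃ p, t = 2 * p) ∧ ∃ q, c = 2 * q := by
  rcases Int.even_or_odd' t with ⟨p, rfl | rfl⟩ <;> rcases Int.even_or_odd' c with ⟨q, rfl | rfl⟩
  · exact ⟨⟨p, rfl⟩, q, rfl⟩
  all_goals
    exfalso
    rcases hd with rfl | rfl
    all_goals
      push_cast at h
      ring_nf at h
      omega

theorem parity_of_sq_add {t c m n : ℤ} (hd : (d : ℤ) = 4 * n - 1) (h : t ^ 2 + d * c ^ 2 = 4 * m) :
    ∃ p, t - c = 2 * p := by
  have h' : (t - c) * (t - c) = 2 * (2 * m - 2 * n * c ^ 2 + c ^ 2 - t * c) := by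
    rw [hd] at h
    linear_combination h
  rcases Int.even_or_odd' (t - c) with ⟨p, hp | hp⟩
  · exact ⟨p, hp⟩
  · rw [hp] at h'
    ring_nf at h'
    omega

variable (d) in
/-- The element `(1 + √-d) / 2` of `ℚ(√-d)`. -/
def halfOne : QuadField d := (1 + sqrtNeg d) / 2

theorem halfOne_mul_self {n : ℤ} (hd : (d : ℤ) = 4 * n - 1) :
    halfOne d * halfOne d = halfOne d - n := by
  have : (d : QuadField d) = 4 * n - 1 := by
    exact_mod_cast congrArg (Int.cast (R := QuadField d)) hd
  rw [halfOne]
  linear_combination sqrtNeg_mul_self (d := d) / 4 - this / 4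

theorem isIntegral_halfOne {n : ℤ} (hd : (d : ℤ) = 4 * n - 1) : IsIntegral ℤ (halfOne d) := by
  refine ⟨Polynomial.X ^ 2 + (-Polynomial.X + Polynomial.C n),
    Polynomial.monic_X_pow_add (by compute_degree!), ?_⟩
  simp only [Polynomial.eval₂_add, Polynomial.eval₂_X_pow, Polynomial.eval₂_X, Polynomial.eval₂_neg,
    Polynomial.eval₂_C]
  rw [pow_two, halfOne_mul_self hd, eq_intCast]
  ring

theorem eq_of_parity {n : ℤ} (hd : Squarefree d) (hdn : (d : ℤ) = 4 * n - 1) {x : QuadField d}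
    (hx : IsIntegral ℤ x) : ∃ p c : ℤ, x = p + c * halfOne d := by
  obtain ⟨t, c, m, h, hm, -⟩ := exists_int_coords (Or.inr hd) hx
  obtain ⟨p, hp⟩ := parity_of_sq_add hdn hm
  refine ⟨p, c, ?_⟩
  have hp' : (t : QuadField d) - c = 2 * p := by
    exact_mod_cast congrArg (Int.cast (R := QuadField d)) hp
  rw [halfOne]
  linear_combination h / 2 + hp' / 2

theorem eq_maxOrder_of_halfOne_mem {O : Subring (QuadField d)} (hO : IsZOrder O) {n : ℤ}
    (hd : Squarefree d) (hdn : (d : ℤ) = 4 * n - 1) (h : halfOne d ∈ O) : O = maxOrder d := by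
  refine le_antisymm (le_maxOrder hO) fun x hx => ?_
  obtain ⟨p, c, rfl⟩ := eq_of_parity hd hdn hx
  exact add_mem (intCast_mem O p) (mul_mem (intCast_mem O c) h)

theorem eq_of_isIntegral_one_two (hd : d = 1 ∨ d = 2) {x : QuadField d} (hx : IsIntegral ℤ x) :
    ∃ p q : ℤ, x = p + q * sqrtNeg d := by
  have hsq : Squarefree d := by
    rcases hd with rfl | rfl
    · exact squarefree_one
    · exact Nat.prime_two.squarefree
  obtain ⟨t, c, m, h, hm, -⟩ := exists_int_coords (Or.inr hsq) hx
  obtain ⟨⟨p, rfl⟩, q, rfl⟩ := even_of_sq_add hd hm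
  refine ⟨p, q, ?_⟩
  push_cast at h
  linear_combination h / 2

theorem eq_maxOrder_of_sqrtNeg_mem {O : Subring (QuadField d)} (hO : IsZOrder O)
    (hd : d = 1 ∨ d = 2) (h : sqrtNeg d ∈ O) : O = maxOrder d := by
  refine le_antisymm (le_maxOrder hO) fun x hx => ?_
  obtain ⟨p, c, rfl⟩ := eq_of_isIntegral_one_two hd hx
  exact add_mem (intCast_mem O p) (mul_mem (intCast_mem O c) h)

theorem eq_of_mem_zSqrtNeg {x : QuadField d} (hx : x ∈ zSqrtNeg d) :
    ∃ p q : ℤ, x = p + q * sqrtNeg d := by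
  induction hx using Subring.closure_induction with
  | mem y hy => exact ⟨0, 1, by simp [Set.mem_singleton_iff.1 hy]⟩
  | zero => exact ⟨0, 0, by simp⟩
  | one => exact ⟨1, 0, by simp⟩
  | add y z _ _ hy hz =>
    obtain ⟨a, b, rfl⟩ := hy
    obtain ⟨a', b', rfl⟩ := hz
    exact ⟨a + a', b + b', by push_cast; ring⟩
  | neg y _ hy =>
    obtain ⟨a, b, rfl⟩ := hy
    exact ⟨-a, -b, by push_cast; ring⟩
  | mul y z _ _ hy hz =>
    obtain ⟨a, b, rfl⟩ := hy
    obtain ⟨a', b', rfl⟩ := hz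
    refine ⟨a * a' - d * (b * b'), a * b' + b * a', ?_⟩
    push_cast
    linear_combination (b * b' : QuadField d) * sqrtNeg_mul_self (d := d)

/-- There is no room between the two rings, as `ℤ[√-3]` has index 2: an integral element outside it
has an odd coefficient at `(1 + √-3)/2`, and subtracting an element of `ℤ[√-3]` leaves `(1 +
√-3)/2`. -/
theorem eq_zSqrtNeg_or_eq_maxOrder {O : Subring (QuadField 3)} (hO : IsZOrder O)
    (h : sqrtNeg 3 ∈ O) : O = zSqrtNeg 3 ∨ O = maxOrder 3 := by
  have hle : zSqrtNeg 3 ≤ O := (Subring.closure_le).2 (by simpa using h)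
  refine or_iff_not_imp_left.2 fun hne => ?_
  obtain ⟨x, hx, hx'⟩ : ∃ x ∈ O, x ∉ zSqrtNeg 3 := by
    by_contra! hall
    exact hne (le_antisymm hall hle)
  refine eq_maxOrder_of_halfOne_mem hO (n := 1) Nat.prime_three.squarefree (by norm_num) ?_
  obtain ⟨p, c, rfl⟩ := eq_of_parity (n := 1) Nat.prime_three.squarefree (by norm_num)
    (isIntegral_of_mem hO hx)
  rcases Int.even_or_odd' c with ⟨k, rfl | rfl⟩
  · refine absurd ?_ hx'
    have e : (p + ((2 * k : ℤ) : QuadField 3) * halfOne 3 : QuadField 3) =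
        ((p + k : ℤ) : QuadField 3) + k * sqrtNeg 3 := by
      rw [halfOne]
      push_cast
      ring
    rw [e]
    exact add_mem (intCast_mem _ _) (mul_mem (intCast_mem _ _)
      (Subring.subset_closure (Set.mem_singleton _)))
  · have e : halfOne 3 = (p + ((2 * k + 1 : ℤ) : QuadField 3) * halfOne 3) -
        (((p + k : ℤ) : QuadField 3) + k * sqrtNeg 3) := by
      rw [halfOne]
      push_cast
      ring
    rw [e]
    exact sub_mem hx (add_mem (intCast_mem _ _) (mul_mem (intCast_mem _ _) h))

/-- An order with a non-integral element of absolute value less than two is `ℤ[√-3]` or one of the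
five maximal orders that are norm-Euclidean. -/
theorem exceptional_of_norm_lt_two (hd : d = 0 ∨ Squarefree d) {O : Subring (QuadField d)}
    (hO : IsZOrder O) {x : QuadField d} (hx : x ∈ O) (hxn : ∀ n : ℤ, x ≠ n)
    (hlt : ‖(x : ℂ)‖ < 2) :
    (d = 3 ∧ O = zSqrtNeg d) ∨ (d ∈ ({1, 2, 3, 7, 11} : Set ℕ) ∧ O = maxOrder d) := by
  obtain ⟨t, c, m, h, hm, hnorm⟩ := exists_int_coords hd (isIntegral_of_mem hO hx)
  have hm4 : m < 4 := by
    have : (m : ℝ) < 4 := by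
      rw [← hnorm]
      nlinarith [norm_nonneg (x : ℂ)]
    exact_mod_cast this
  have hdc : (d : ℤ) * c ^ 2 ≠ 0 := by
    intro h0
    have h0' : (c : QuadField d) * sqrtNeg d = 0 := by
      rcases mul_eq_zero.1 h0 with h1 | h1
      · have : d = 0 := by exact_mod_cast h1
        subst this
        have : sqrtNeg 0 = 0 := Subtype.ext (by simp [coe_sqrtNeg])
        rw [this, mul_zero]
      · rw [pow_eq_zero_iff two_ne_zero] at h1
        rw [h1, Int.cast_zero, zero_mul]
    rw [h0, add_zero] at hm
    rcases Int.even_or_odd' t with ⟨p, rfl | rfl⟩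
    · refine hxn p ?_
      rw [h0'] at h
      push_cast at h
      linear_combination h / 2
    · ring_nf at hm
      omega
  have hd0 : d ≠ 0 := fun h0 => hdc (by simp [h0])
  have hc0 : c ≠ 0 := fun h0 => hdc (by simp [h0])
  have hsq : Squarefree d := hd.resolve_left hd0
  have hd1 : (1 : ℤ) ≤ d := by omega
  have hc2 : 0 < c ^ 2 := by positivity
  have ht1 : -3 ≤ t := by nlinarith
  have ht2 : t ≤ 3 := by nlinarith
  have hc3 : c ≤ 3 := by nlinarith
  have hc4 : -3 ≤ c := by nlinarith
  have hnot : ∀ k : ℕ, d ≠ 4 * k := by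
    rintro k rfl
    have := hsq 2 ⟨k, by ring⟩
    simp at this
  have hnot4 := hnot 1
  have hnot8 := hnot 2
  have hnot12 := hnot 3
  -- Here `t² + dc² = 4m ≤ 12`. If `c² = 1`, reduction modulo 4 leaves `d ≡ 3` or `4 ∣ d`, and the
  -- latter is not squarefree. If `c² = 4`, then `d ≤ 3`. If `c² = 9`, then `d = 1` and `t² ≡ 3`
  -- modulo 4, which is impossible.
  have hcases : (c ^ 2 = 1 ∧ ∃ n : ℤ, (d : ℤ) = 4 * n - 1 ∧ (d = 3 ∨ d = 7 ∨ d = 11)) ∨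
      (c ^ 2 = 4 ∧ (d = 1 ∨ d = 2 ∨ d = 3)) := by
    have hcabs : c ^ 2 = 1 ∨ c ^ 2 = 4 ∨ c ^ 2 = 9 := by
      interval_cases c <;> simp at *
    have htabs : t ^ 2 = 0 ∨ t ^ 2 = 1 ∨ t ^ 2 = 4 ∨ t ^ 2 = 9 := by
      clear h
      interval_cases t <;> simp
    rcases hcabs with hc | hc | hc
    · left
      rw [hc] at hm
      have : d = 3 ∨ d = 7 ∨ d = 11 := by omega
      refine ⟨hc, (d + 1) / 4, by omega, this⟩
    · right
      rw [hc] at hm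
      exact ⟨hc, by omega⟩
    · rw [hc] at hm
      omega
  rcases hcases with ⟨hc, n, hn, hd'⟩ | ⟨hc, hd'⟩
  · right
    refine ⟨by rcases hd' with rfl | rfl | rfl <;> simp, ?_⟩
    refine eq_maxOrder_of_halfOne_mem hO hsq hn ?_
    obtain ⟨p, c', hx'⟩ := eq_of_parity hsq hn (isIntegral_of_mem hO hx)
    obtain ⟨q, hq⟩ := parity_of_sq_add hn hm
    have hq' : (t : QuadField d) - c = 2 * q := by
      exact_mod_cast congrArg (Int.cast (R := QuadField d)) hq
    have e : (c : QuadField d) * halfOne d = x - q := by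
      rw [halfOne]
      linear_combination -h / 2 - hq' / 2
    have hmem : (c : QuadField d) * ((c : QuadField d) * halfOne d) ∈ O :=
      e ▸ mul_mem (intCast_mem O c) (sub_mem hx (intCast_mem O q))
    have hcc : (c : QuadField d) * c = 1 := by
      rw [← pow_two]
      exact_mod_cast congrArg (Int.cast (R := QuadField d)) hc
    rwa [← mul_assoc, hcc, one_mul] at hmem
  · have hmem : sqrtNeg d ∈ O := by
      have hc' : c = 2 ∨ c = -2 := by
        have : (c - 2) * (c + 2) = 0 := by linear_combination hc
        rcases mul_eq_zero.1 this with h | h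
        · left; omega
        · right; omega
      rcases Int.even_or_odd' t with ⟨p, rfl | rfl⟩
      · rcases hc' with rfl | rfl
        · have e : sqrtNeg d = x - p := by
            push_cast at h
            linear_combination -h / 2
          exact e ▸ sub_mem hx (intCast_mem O p)
        · have e : sqrtNeg d = p - x := by
            push_cast at h
            linear_combination h / 2
          exact e ▸ sub_mem (intCast_mem O p) hx
      · rw [hc] at hm
        ring_nf at hm
        omega
    rcases hd' with rfl | rfl | rfl
    · exact Or.inr ⟨by simp, eq_maxOrder_of_sqrtNeg_mem hO (Or.inl rfl) hmem⟩
    · exact Or.inr ⟨by simp, eq_maxOrder_of_sqrtNeg_mem hO (Or.inr rfl) hmem⟩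
    · rcases eq_zSqrtNeg_or_eq_maxOrder hO hmem with h | h
      · exact Or.inl ⟨rfl, h⟩
      · exact Or.inr ⟨by simp, h⟩

/-- The maximal order for `d = 4n - 1` is `ℤ[ω]` with `ω² = ω - n`. -/
theorem nonempty_quadRing_equiv_maxOrder {n : ℤ} (hd : Squarefree d)
    (hdn : (d : ℤ) = 4 * n - 1) : Nonempty (maxOrder d ≃+* QuadRing n) := by
  let φ : QuadRing n →+* QuadField d :=
    (QuadraticAlgebra.lift (R := ℤ) (A := QuadField d) (a := -n) (b := 1) ⟨halfOne d, by
      rw [halfOne_mul_self hdn]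
      simp
      ring⟩).toRingHom
  have hφ : ∀ x, φ x = x.re + x.im * halfOne d := by
    intro x
    simp [φ, QuadraticAlgebra.lift]
  have hmem : ∀ x, φ x ∈ maxOrder d := by
    intro x
    rw [hφ]
    exact add_mem (intCast_mem _ _) (mul_mem (intCast_mem _ _) (isIntegral_halfOne hdn))
  refine ⟨(RingEquiv.ofBijective (φ.codRestrict (maxOrder d) hmem) ⟨?_, ?_⟩).symm⟩
  · rw [injective_iff_map_eq_zero]
    intro x hx
    have hx' : φ x = 0 := congrArg Subtype.val hx
    rw [hφ] at hx'
    have hx'' : (x.re : ℂ) + x.im * ((1 + Complex.I * (Real.sqrt d : ℂ)) / 2) = 0 :=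
      congrArg Subtype.val hx'
    have him := congrArg Complex.im hx''
    have hre := congrArg Complex.re hx''
    simp at him hre
    have h0 : x.im = 0 := him.resolve_right hd.ne_zero
    rw [h0] at hre
    simp at hre
    exact QuadraticAlgebra.ext hre h0
  · rintro ⟨y, hy⟩
    obtain ⟨p, c, rfl⟩ := eq_of_parity hd hdn hy
    exact ⟨⟨p, c⟩, Subtype.ext (hφ _)⟩

/-- The embedding of an order into the complex numbers. -/
def orderEmb (O : Subring (QuadField d)) : O →+* ℂ :=
  (algebraMap (QuadField d) ℂ).comp O.subtype

theorem orderEmb_apply (O : Subring (QuadField d)) (x : O) :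
    orderEmb O x = ((x : QuadField d) : ℂ) :=
  rfl

/-- Covers `ℤ`, `ℤ[√-3]`, `𝓘_1` and `𝓘_2`: real parts are integers, and products of imaginary parts
are integral multiples of `d`. -/
theorem isNontrivialAmalgam_of_forall_eq {O : Subring (QuadField d)}
    (h : ∀ x ∈ O, ∃ p q : ℤ, x = p + q * sqrtNeg d) : IsNontrivialAmalgam (E₂ O) := by
  have hre : ∀ x : O, ∃ p q : ℤ, (orderEmb O x).re = p ∧ (orderEmb O x).im = q * √d := by
    rintro ⟨x, hx⟩
    obtain ⟨p, q, rfl⟩ := h x hx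
    refine ⟨p, q, ?_, ?_⟩ <;> simp [orderEmb_apply, coe_sqrtNeg]
  refine isNontrivialAmalgam_of_re_int (orderEmb O) (fun x => ?_) fun x y => ?_
  · obtain ⟨p, q, hp, -⟩ := hre x
    exact ⟨p, hp⟩
  · obtain ⟨-, q, -, hq⟩ := hre x
    obtain ⟨-, q', -, hq'⟩ := hre y
    refine ⟨q * q' * d, ?_⟩
    rw [hq, hq']
    push_cast
    linear_combination (q * q' : ℝ) * Real.mul_self_sqrt (Nat.cast_nonneg (α := ℝ) d)

theorem isNontrivialAmalgam_maxOrder (hd : d = 1 ∨ d = 2 ∨ d = 7 ∨ d = 11) :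
    IsNontrivialAmalgam (E₂ (maxOrder d)) := by
  rcases hd with rfl | rfl | rfl | rfl
  · exact isNontrivialAmalgam_of_forall_eq fun x hx => eq_of_isIntegral_one_two (Or.inl rfl) hx
  · exact isNontrivialAmalgam_of_forall_eq fun x hx => eq_of_isIntegral_one_two (Or.inr rfl) hx
  · obtain ⟨e⟩ := nonempty_quadRing_equiv_maxOrder (d := 7) (n := 2)
      (Nat.Prime.prime (by norm_num)).squarefree (by norm_num)
    exact isNontrivialAmalgam_quadRing_two.of_mulEquiv (E₂Congr e)
  · obtain ⟨e⟩ := nonempty_quadRing_equiv_maxOrder (d := 11) (n := 3)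
      (Nat.Prime.prime (by norm_num)).squarefree (by norm_num)
    exact isNontrivialAmalgam_quadRing_three.of_mulEquiv (E₂Congr e)

theorem not_isNontrivialAmalgam_maxOrder_three : ¬ IsNontrivialAmalgam (E₂ (maxOrder 3)) := by
  obtain ⟨e⟩ := nonempty_quadRing_equiv_maxOrder (d := 3) (n := 1)
    Nat.prime_three.squarefree (by norm_num)
  exact fun h => not_isNontrivialAmalgam_quadRing_one (h.of_mulEquiv (E₂Congr e).symm)

theorem exists_ne_intCast {O : Subring (QuadField d)} (hO : O ≠ ⊥) : ∃ x : O, ∀ n : ℤ, x ≠ n := by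
  by_contra! h
  refine hO (eq_bot_iff.2 fun x hx => ?_)
  obtain ⟨n, hn⟩ := h ⟨x, hx⟩
  exact Subring.mem_bot.2 ⟨n, (congrArg Subtype.val hn).symm⟩

theorem intCast_or_two_le_norm (hd : d = 0 ∨ Squarefree d) {O : Subring (QuadField d)}
    (hO : IsZOrder O) (h₁ : ¬ (d = 3 ∧ O = zSqrtNeg d))
    (h₂ : ¬ (d ∈ ({1, 2, 3, 7, 11} : Set ℕ) ∧ O = maxOrder d)) (x : O) :
    (∃ n : ℤ, x = n) ∨ 2 ≤ ‖orderEmb O x‖ := by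
  by_contra! h
  rcases exceptional_of_norm_lt_two hd hO x.2 (fun n hn => h.1 n (Subtype.ext hn)) h.2 with h | h
  · exact h₁ h
  · exact h₂ h

theorem intCastRingHom_injective (O : Subring (QuadField d)) :
    Function.Injective (Int.castRingHom O) :=
  Int.cast_injective

end Orders

end EltwoAmalgam

end

/-! ### The main theorem. -/

open EltwoAmalgam in
theorem theorem6p4 (d : ℕ) (hd : d = 0 ∨ Squarefree d)
    (O : Subring (QuadField d)) (hO : IsZOrder O) :
    (IsNontrivialAmalgam (E₂ O) ↔ ¬ (d = 3 ∧ O = maxOrder d)) ∧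
    (¬ (d = 3 ∧ O = zSqrtNeg d) →
      ¬ (d ∈ ({1, 2, 3, 7, 11} : Set ℕ) ∧ O = maxOrder d) →
      Function.Injective (borelToE₂ ℤ) ∧
      Function.Injective (borelMap (Int.castRingHom O)) ∧
      (O ≠ ⊥ → ¬ Function.Surjective (borelToE₂ ℤ) ∧
        ¬ Function.Surjective (borelMap (Int.castRingHom O))) ∧
      Nonempty (E₂ O ≃* Amalgam (borelToE₂ ℤ) (borelMap (Int.castRingHom O)))) := by
  have key : ¬ (d = 3 ∧ O = zSqrtNeg d) →
      ¬ (d ∈ ({1, 2, 3, 7, 11} : Set ℕ) ∧ O = maxOrder d) →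
      Function.Injective (borelToE₂ ℤ) ∧
      Function.Injective (borelMap (Int.castRingHom O)) ∧
      (O ≠ ⊥ → ¬ Function.Surjective (borelToE₂ ℤ) ∧
        ¬ Function.Surjective (borelMap (Int.castRingHom O))) ∧
      Nonempty (E₂ O ≃* Amalgam (borelToE₂ ℤ) (borelMap (Int.castRingHom O))) :=
    fun h₁ h₂ => ⟨borelToE₂_injective, borelMap_injective (intCastRingHom_injective O),
      fun h => ⟨not_surjective_borelToE₂, not_surjective_borelMap (exists_ne_intCast h)⟩,
      nonempty_mulEquiv_amalgam_of_two_le_norm (orderEmb O) (intCast_or_two_le_norm hd hO h₁ h₂)⟩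
  refine ⟨⟨?_, fun h => ?_⟩, key⟩
  · rintro h ⟨rfl, rfl⟩
    exact not_isNontrivialAmalgam_maxOrder_three h
  -- For `O = ℤ` the decomposition of the second part degenerates, because one of its maps is
  -- surjective. This case needs the wall argument.
  by_cases hbot : O = ⊥
  · refine isNontrivialAmalgam_of_forall_eq fun x hx => ?_
    rw [hbot] at hx
    obtain ⟨n, rfl⟩ := Subring.mem_bot.1 hx
    exact ⟨n, 0, by simp⟩
  by_cases h₁ : d = 3 ∧ O = zSqrtNeg d
  · obtain ⟨-, rfl⟩ := h₁
    exact isNontrivialAmalgam_of_forall_eq fun x hx => eq_of_mem_zSqrtNeg hx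
  by_cases h₂ : d ∈ ({1, 2, 3, 7, 11} : Set ℕ) ∧ O = maxOrder d
  · obtain ⟨hd', rfl⟩ := h₂
    refine isNontrivialAmalgam_maxOrder ?_
    have h3 : d ≠ 3 := fun h3 => h ⟨h3, rfl⟩
    simp only [Set.mem_insert_iff, Set.mem_singleton_iff] at hd'
    tauto
  · obtain ⟨i₁, i₂, hs, e⟩ := key h₁ h₂
    exact ⟨_, _, _, _, _, _, _, _, i₁, i₂, (hs hbot).1, (hs hbot).2, e⟩
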